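/- Setting. Let $X\in\mathbb R^{n\times p}$ be a random matrix with i.i.d. centered rows whose covariance matrix is $\Sigma=\mathrm{diag}(\lambda_1,\dots,\lambda_p)$, $\lambda_1\ge\dots\ge\lambda_p>0$, and suppose the rows of $X\Sigma^{-1/2}$ have sub-gaussian norm at most $\sigma_x$. Here $\|Z\|_{\psi_2}=\inf\{s>0:\mathbb E\exp(Z^2/s^2)\le 2\}$ for a random variable $Z$, and $\|Z\|_{\psi_2}=\sup_{s\ne0}\|\langle s,Z\rangle/\|s\|\|_{\psi_2}$ for a random vector. Let $\varepsilon\in\mathbb R^n$ be independent of $X$, with independent centered components of sub-gaussian norm at most $\sigma_\varepsilon$, and let $\theta^*\in\mathbb R^p$. Write $\|x\|_M=\sqrt{x^\top Mx}$, and let $\mu_1(M)\ge\dots\ge\mu_n(M)$ be the eigenvalues of a symmetric $M\in\mathbb R^{n\times n}$. For $\lambda\in\mathbb R$ the bias and variance terms of the ridge estimator $X^\top(\lambda I_n+XX^\top)^{-1}(X\theta^*+\varepsilon)$ are $$B=\|(I_p-X^\top(\lambda I_n+XX^\top)^{-1}X)\theta^*\|_\Sigma^2,\qquad V=\|X^\top(\lambda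 I_n+XX^\top)^{-1}\varepsilon\|_\Sigma^2 .$$ For an integer $k\ge0$, the subscripts $0{:}k$ and $k{:}\infty$ denote restriction to the first $k$ coordinates (or columns) and to the remaining ones; $\Sigma_{0:k}=\mathrm{diag}(\lambda_i)_{i\le k}$, $\Sigma_{k:\infty}=\mathrm{diag}(\lambda_i)_{i>k}$, and $A_k=X_{k:\infty}X_{k:\infty}^\top+\lambda I_n$. Put $\lambda_{k+1}=0$ if $k\ge p$. The condition number of a positive semidefinite matrix $M$ is $\mu_1(M)/\mu_n(M)$, and it is $\infty$ if $M$ is singular. Theorem. For every $\sigma_x$ there are constants $c_x,C_x>0$, depending only on $\sigma_x$, such that in the above setting (for all $n,p$, all laws of $X$ and $\varepsilon$, all $\theta^*$ and $\sigma_\varepsilon\ge 0$), for every $\lambda\in\mathbb R$, every integer $0\le k\le n/c_x$ and every $t\in(1,n/c_x)$: (1) With probability at least $1-18e^{-t/c_x}$, if $A_k$ is positive definite, then $$B\le C_x\Big[\|\theta^*_{k:\infty}\|_{\Sigma_{k:\infty}}^2\Big(1+\tfrac{\mu_1(A_k^{-1})^2}{\mu_n(A_k^{-1})^2}+\mu_1(A_k^{-1})^2\big(n^2\lambda_{k+1}^2+n\sum_{i>k}\lambda_i^2\big)\Big)+\|\theta^*_{0:k}\|_{\Sigma_{0:k}^{-1}}^2\Big(\tfrac{1}{n^2\mu_n(A_k^{-1})^2}+\tfrac{\mu_1(A_k^{-1})^2}{\mu_n(A_k^{-1})^2}\big(\lambda_{k+1}^2+\tfrac1n\sum_{i>k}\lambda_i^2\big)\Big)\Big]$$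 and $$V\le C_x\,\sigma_\varepsilon^2t\Big[\tfrac{\mu_1(A_k^{-1})^2}{\mu_n(A_k^{-1})^2}\,\tfrac kn+n\,\mu_1(A_k^{-1})^2\sum_{i>k}\lambda_i^2\Big].$$ (2) Suppose in addition that $\lambda\ge0$ and that, for some $\delta<1-4e^{-n/c_x^2}$ and some $L$, the condition number of $A_k$ is at most $L$ with probability at least $1-\delta$. Then with probability at least $1-\delta-20e^{-t/c_x}$ $$B\le C_xL^4\Big[\|\theta^*_{k:\infty}\|_{\Sigma_{k:\infty}}^2+\|\theta^*_{0:k}\|_{\Sigma_{0:k}^{-1}}^2\Big(\tfrac{\lambda+\sum_{i>k}\lambda_i}{n}\Big)^2\Big],\qquad V\le C_x\,\sigma_\varepsilon^2tL^2\Big[\tfrac kn+\tfrac{n\sum_{i>k}\lambda_i^2}{(\lambda+\sum_{i>k}\lambda_i)^2}\Big],$$ and moreover, if $k<p$, $$\rho_k=\frac{\lambda+\sum_{i>k}\lambda_i}{n\lambda_{k+1}}\ge\frac1{c_xL}.$$ -/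

import Mathlib

open MeasureTheory ProbabilityTheory
open scoped ENNReal Matrix

namespace Ridge

noncomputable section

/-- Sub-gaussian norm `‖Z‖_ψ₂ = inf {t > 0 : E exp(Z² / t²) ≤ 2}` of a real random variable,
with value `∞` if there is no such `t`. -/
def psi2Norm {Ω : Type*} [MeasurableSpace Ω] (μ : Measure Ω) (Z : Ω → ℝ) : ℝ≥0∞ :=
  ⨅ (t : ℝ) (_ : 0 < t) (_ : ∫⁻ ω, ENNReal.ofReal (Real.exp (Z ω ^ 2 / t ^ 2)) ∂μ ≤ 2),
    ENNReal.ofReal t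

/-- Sub-gaussian norm of a random vector: the supremum over `s ≠ 0` of the sub-gaussian norms of
`⟨s, Z⟩ / ‖s‖`, where `‖s‖` is the Euclidean norm. -/
def psi2NormVec {Ω : Type*} [MeasurableSpace Ω] (μ : Measure Ω) {p : ℕ}
    (Z : Ω → Fin p → ℝ) : ℝ≥0∞ :=
  ⨆ (s : Fin p → ℝ) (_ : s ≠ 0), psi2Norm μ (fun ω => (s ⬝ᵥ Z ω) / √(s ⬝ᵥ s))

/-- `‖x‖_M = √(xᵀ M x)`. -/
def mNorm {ι : Type*} [Fintype ι] (M : Matrix ι ι ℝ) (x : ι → ℝ) : ℝ :=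
  √(x ⬝ᵥ (M *ᵥ x))

/-- `eig M i` is the `i`-th largest eigenvalue `μ_i(M)` of a symmetric `n × n` matrix,
`1 ≤ i ≤ n` (counted with multiplicity). -/
def eig {n : ℕ} (M : Matrix (Fin n) (Fin n) ℝ) (i : ℕ) : ℝ :=
  open scoped Classical in
  if h : M.IsHermitian ∧ 1 ≤ i ∧ i ≤ n then
    h.1.eigenvalues₀ ⟨i - 1, by rw [Fintype.card_fin]; omega⟩
  else 0

/-- Condition number `μ₁(M) / μ_n(M)` of a positive semidefinite matrix; it is `∞` when the matrix
is not positive definite. -/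
def condNumber {n : ℕ} (M : Matrix (Fin n) (Fin n) ℝ) : ℝ≥0∞ :=
  open scoped Classical in
  if M.PosDef then ENNReal.ofReal (eig M 1 / eig M n) else ⊤

/-- Indices of the first `k` coordinates. Coordinates are numbered from `0` in the code, so
`i ≤ k` for `1 ≤ i ≤ p` becomes `j < k` with `j = i - 1`. -/
abbrev Head (p k : ℕ) : Type := {j : Fin p // (j : ℕ) < k}

/-- Indices of the coordinates after the first `k`. -/
abbrev Tail (p k : ℕ) : Type := {j : Fin p // k ≤ (j : ℕ)}

/-- `η_{0:k}`. -/
def headVec {p : ℕ} (k : ℕ) (η : Fin p → ℝ) : Head p k → ℝ := fun j => η j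

/-- `η_{k:∞}`. -/
def tailVec {p : ℕ} (k : ℕ) (η : Fin p → ℝ) : Tail p k → ℝ := fun j => η j

/-- `M_{k:∞}`: the columns of `M` after the first `k`. -/
def tailCols {n p : ℕ} (k : ℕ) (M : Matrix (Fin n) (Fin p) ℝ) : Matrix (Fin n) (Tail p k) ℝ :=
  M.submatrix id Subtype.val

/-- `Σ_{0:k} = diag(λ₁, …, λ_k)`. -/
def SigmaHead {p : ℕ} (lam : Fin p → ℝ) (k : ℕ) : Matrix (Head p k) (Head p k) ℝ :=
  Matrix.diagonal (headVec k lam)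

/-- `Σ_{k:∞} = diag(λ_{k+1}, λ_{k+2}, …)`. -/
def SigmaTail {p : ℕ} (lam : Fin p → ℝ) (k : ℕ) : Matrix (Tail p k) (Tail p k) ℝ :=
  Matrix.diagonal (tailVec k lam)

/-- `∑_{i > k} a_i`. -/
def tailSum {p : ℕ} (a : Fin p → ℝ) (k : ℕ) : ℝ := ∑ j, tailVec k a j

/-- `λ_{k+1}`, which is `0` by convention when `k ≥ p`. -/
def lamNext {p : ℕ} (lam : Fin p → ℝ) (k : ℕ) : ℝ := if h : k < p then lam ⟨k, h⟩ else 0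

/-- `A_k = X_{k:∞} X_{k:∞}ᵀ + λ I_n`; here `r` is the regularization parameter `λ`. -/
def Amat {n p : ℕ} (X : Matrix (Fin n) (Fin p) ℝ) (r : ℝ) (k : ℕ) : Matrix (Fin n) (Fin n) ℝ :=
  tailCols k X * (tailCols k X)ᵀ + r • (1 : Matrix (Fin n) (Fin n) ℝ)

/-- Bias term `B = ‖(I_p - Xᵀ (λ I_n + X Xᵀ)⁻¹ X) θ*‖²_Σ`. -/
def bias {n p : ℕ} (lam : Fin p → ℝ) (X : Matrix (Fin n) (Fin p) ℝ) (r : ℝ) (θ : Fin p → ℝ) : ℝ :=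
  mNorm (Matrix.diagonal lam)
    ((1 - Xᵀ * (r • (1 : Matrix (Fin n) (Fin n) ℝ) + X * Xᵀ)⁻¹ * X) *ᵥ θ) ^ 2

/-- Variance term `V = ‖Xᵀ (λ I_n + X Xᵀ)⁻¹ ε‖²_Σ`. -/
def variance {n p : ℕ} (lam : Fin p → ℝ) (X : Matrix (Fin n) (Fin p) ℝ) (r : ℝ)
    (ε : Fin n → ℝ) : ℝ :=
  mNorm (Matrix.diagonal lam)
    ((Xᵀ * (r • (1 : Matrix (Fin n) (Fin n) ℝ) + X * Xᵀ)⁻¹) *ᵥ ε) ^ 2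

/-- `ρ_k = (λ + ∑_{i > k} λ_i) / (n λ_{k+1})`. -/
def rho {p : ℕ} (n : ℕ) (lam : Fin p → ℝ) (r : ℝ) (k : ℕ) : ℝ :=
  (r + tailSum lam k) / (n * lamNext lam k)

/-- The standing assumptions on the random design `X` and the noise `ε`. -/
structure IsModel {Ω : Type*} [MeasurableSpace Ω] (μ : Measure Ω) {n p : ℕ}
    (X : Ω → Matrix (Fin n) (Fin p) ℝ) (ε : Ω → Fin n → ℝ) (lam : Fin p → ℝ)
    (σx σε : ℝ) : Prop where
  measurable_X : ∀ i j, Measurable fun ω => X ω i j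
  measurable_ε : ∀ i, Measurable fun ω => ε ω i
  lam_pos : ∀ j, 0 < lam j
  lam_antitone : Antitone lam
  rows_indep : iIndepFun (fun i ω => X ω i) μ
  rows_identDistrib : ∀ i i', IdentDistrib (fun ω => X ω i) (fun ω => X ω i') μ μ
  rows_centered : ∀ i j, ∫ ω, X ω i j ∂μ = 0
  rows_cov : ∀ i j j', ∫ ω, X ω i j * X ω i j' ∂μ = Matrix.diagonal lam j j'
  rows_subgaussian : ∀ i,
    psi2NormVec μ (fun ω => (X ω * Matrix.diagonal fun j => (√(lam j))⁻¹) i) ≤ ENNReal.ofReal σx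
  noise_indep_design : IndepFun (fun ω i j => X ω i j) ε μ
  noise_indep : iIndepFun (fun i ω => ε ω i) μ
  noise_centered : ∀ i, ∫ ω, ε ω i ∂μ = 0
  noise_subgaussian : ∀ i, psi2Norm μ (fun ω => ε ω i) ≤ ENNReal.ofReal σε

end

end Ridge

/-! Let `X₀`, `X₁` be the head and tail columns of the design and `θ₀`, `θ₁` the two parts of the
signal. With `A = A_k` the ridge matrix is `A + X₀X₀ᵀ`. If `w` is this inverse applied to `X₀θ₀ +
X₁θ₁`, the head error `ζ = X₀ᵀw - θ₀` obeys the energy identity `|ζ|² + ⟨X₀ζ, A⁻¹X₀ζ⟩ = ⟨X₀ζ,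
A⁻¹X₁θ₁⟩ - ⟨θ₀, ζ⟩`. The whitened head is a tall matrix whose squared singular values are at least
`n/16`, so the second term on the left dominates `(μ_n(A⁻¹) n/16) ‖ζ‖²_Σ` and absorbs the right
side. The tail error follows from `w = A⁻¹(X₁θ₁ - X₀ζ)` and an operator norm bound for `X₁Σ₁X₁ᵀ`.
The head of the variance satisfies an analogous identity, and its tail is a linear image of the
noise (`bias_split_le`, `variance_split_le`).

The random inputs come from exponential moments. Squares of jointly sub-gaussian variables are
linearized by an auxiliary Gaussian vector (`lintegral_exp_sum_mul_sq_le`), and nets make the bounds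
uniform: `measure_exists_form_gt` bounds `X₁Σ₁X₁ᵀ`, `measure_exists_mulVec_sq_lt` bounds the head
from below. Given the design, the noise enters through Frobenius norms only
(`measure_mulVec_sq_gt_le`), by Jensen's inequality over the rows of the matrix.

For part (2), the trace of `A` is of order `n(λ + ∑_{i>k} λ_i)`, so a condition number at most `L`
places every eigenvalue of `A` within constant multiples of `L^{±1}(λ + ∑_{i>k} λ_i)`. Moreover
`μ₁(A)` is at least the squared norm of column `k+1`, typically at least `nλ_{k+1}/2`. The resulting
bound on `ρ_k` is deterministic, so a single outcome in the relevant events proves it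
(`mul_lamNext_le`). -/

namespace Ridge

/-! ### Extreme eigenvalues and quadratic forms -/

section Eigenvalues

variable {n : ℕ} {M : Matrix (Fin n) (Fin n) ℝ}

theorem sum_eigenvalues_mul_sq (hM : M.IsHermitian) (v : Fin n → ℝ) :
    v ⬝ᵥ (M *ᵥ v) = ∑ i, hM.eigenvalues i * ((hM.eigenvectorBasis i).ofLp ⬝ᵥ v) ^ 2 := by
  have h := hM.eigenvectorBasis.sum_inner_mul_inner (WithLp.toLp 2 v) (WithLp.toLp 2 (M *ᵥ v))
  simp only [EuclideanSpace.inner_eq_star_dotProduct, star_trivial] at h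
  rw [dotProduct_comm v, ← h]
  refine Finset.sum_congr rfl fun i _ => ?_
  have hs : (M *ᵥ v) ⬝ᵥ (hM.eigenvectorBasis i).ofLp
      = hM.eigenvalues i * ((hM.eigenvectorBasis i).ofLp ⬝ᵥ v) := by
    have h1 := hM.mulVec_eigenvectorBasis i
    have h2 : Mᵀ = M := (show M.IsSymm by simpa using hM)
    rw [dotProduct_comm, Matrix.dotProduct_mulVec, ← Matrix.mulVec_transpose, h2, h1,
      smul_dotProduct, smul_eq_mul]
  rw [hs]; ring

theorem sum_eigenvectorBasis_sq (hM : M.IsHermitian) (v : Fin n → ℝ) :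
    v ⬝ᵥ v = ∑ i, ((hM.eigenvectorBasis i).ofLp ⬝ᵥ v) ^ 2 := by
  have h := hM.eigenvectorBasis.sum_inner_mul_inner (WithLp.toLp 2 v) (WithLp.toLp 2 v)
  simp only [EuclideanSpace.inner_eq_star_dotProduct, star_trivial] at h
  rw [← h]
  refine Finset.sum_congr rfl fun i _ => ?_
  rw [dotProduct_comm v]; ring

theorem eigenvalues_le_eig_one (hM : M.IsHermitian) (i : Fin n) :
    hM.eigenvalues i ≤ eig M 1 := by
  have hn : 1 ≤ n := by have := i.2; omega
  rw [eig, dif_pos ⟨hM, le_rfl, hn⟩]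
  exact hM.eigenvalues₀_antitone (Fin.mk_le_mk.2 (Nat.zero_le _))

theorem eig_last_le_eigenvalues (hM : M.IsHermitian) (i : Fin n) :
    eig M n ≤ hM.eigenvalues i := by
  have hn : 1 ≤ n := by have := i.2; omega
  rw [eig, dif_pos ⟨hM, hn, le_rfl⟩]
  refine hM.eigenvalues₀_antitone ?_
  rw [Fin.le_def]
  -- The position of `i` in the decreasing list is below `n`, hence at most `n - 1`, the slot read
  -- by `eig M n`.
  have := ((Fintype.equivOfCardEq (Fintype.card_fin (Fintype.card (Fin n)))).symm i).2
  simp only [Fintype.card_fin] at this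
  exact Nat.le_sub_one_of_lt this

theorem exists_eigenvector_eig (hM : M.IsHermitian) {i : ℕ} (h1 : 1 ≤ i) (hi : i ≤ n) :
    ∃ v : Fin n → ℝ, v ⬝ᵥ v = 1 ∧ M *ᵥ v = eig M i • v := by
  set e : Fin (Fintype.card (Fin n)) ≃ Fin n := Fintype.equivOfCardEq (Fintype.card_fin _)
  set j : Fin n := e ⟨i - 1, by rw [Fintype.card_fin]; omega⟩ with hj
  refine ⟨(hM.eigenvectorBasis j).ofLp, ?_, ?_⟩
  · have h := hM.eigenvectorBasis.orthonormal.1 j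
    have h2 := real_inner_self_eq_norm_sq (hM.eigenvectorBasis j)
    rw [h, EuclideanSpace.inner_eq_star_dotProduct] at h2
    simpa using h2
  · rw [hM.mulVec_eigenvectorBasis j]
    congr 1
    rw [eig, dif_pos ⟨hM, h1, hi⟩, Matrix.IsHermitian.eigenvalues]
    congr 1
    exact e.symm_apply_apply _

theorem dotProduct_mulVec_le_eig_one (hM : M.IsHermitian) (v : Fin n → ℝ) :
    v ⬝ᵥ (M *ᵥ v) ≤ eig M 1 * (v ⬝ᵥ v) := by
  rw [sum_eigenvalues_mul_sq hM, sum_eigenvectorBasis_sq hM, Finset.mul_sum]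
  exact Finset.sum_le_sum fun i _ =>
    mul_le_mul_of_nonneg_right (eigenvalues_le_eig_one hM i) (sq_nonneg _)

theorem eig_last_le_dotProduct_mulVec (hM : M.IsHermitian) (v : Fin n → ℝ) :
    eig M n * (v ⬝ᵥ v) ≤ v ⬝ᵥ (M *ᵥ v) := by
  rw [sum_eigenvalues_mul_sq hM, sum_eigenvectorBasis_sq hM, Finset.mul_sum]
  exact Finset.sum_le_sum fun i _ =>
    mul_le_mul_of_nonneg_right (eig_last_le_eigenvalues hM i) (sq_nonneg _)

theorem eig_pos (hM : M.PosDef) {i : ℕ} (h1 : 1 ≤ i) (hi : i ≤ n) : 0 < eig M i := by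
  obtain ⟨v, hv, hMv⟩ := exists_eigenvector_eig hM.isHermitian h1 hi
  have hv0 : v ≠ 0 := by rintro rfl; simp at hv
  have := hM.dotProduct_mulVec_pos hv0
  simpa [hMv, hv] using this

theorem eig_last_le_eig_one (hM : M.IsHermitian) (hn : 1 ≤ n) : eig M n ≤ eig M 1 :=
  (eig_last_le_eigenvalues hM ⟨0, hn⟩).trans (eigenvalues_le_eig_one hM _)

theorem trace_le_eig_one (hM : M.IsHermitian) : M.trace ≤ n * eig M 1 := by
  have h : ∀ i, M i i ≤ eig M 1 := fun i => by
    simpa using dotProduct_mulVec_le_eig_one hM (Pi.single i 1)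
  calc M.trace = ∑ i, M i i := rfl
    _ ≤ ∑ _i : Fin n, eig M 1 := Finset.sum_le_sum fun i _ => h i
    _ = n * eig M 1 := by simp

theorem eig_last_le_trace (hM : M.IsHermitian) : n * eig M n ≤ M.trace := by
  have h : ∀ i, eig M n ≤ M i i := fun i => by
    simpa using eig_last_le_dotProduct_mulVec hM (Pi.single i 1)
  calc n * eig M n = ∑ _i : Fin n, eig M n := by simp
    _ ≤ ∑ i, M i i := Finset.sum_le_sum fun i _ => h i
    _ = M.trace := rfl

theorem mulVec_inv_mulVec {ι : Type*} [Fintype ι] [DecidableEq ι] {A : Matrix ι ι ℝ}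
    (hA : A.PosDef) (v : ι → ℝ) : A *ᵥ (A⁻¹ *ᵥ v) = v := by
  rw [Matrix.mulVec_mulVec, Matrix.mul_nonsing_inv _ ((Matrix.isUnit_iff_isUnit_det A).1 hA.isUnit),
    Matrix.one_mulVec]

theorem inv_mulVec_mulVec {ι : Type*} [Fintype ι] [DecidableEq ι] {A : Matrix ι ι ℝ}
    (hA : A.PosDef) (v : ι → ℝ) : A⁻¹ *ᵥ (A *ᵥ v) = v := by
  rw [Matrix.mulVec_mulVec, Matrix.nonsing_inv_mul _ ((Matrix.isUnit_iff_isUnit_det A).1 hA.isUnit),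
    Matrix.one_mulVec]

/-- Apply `M` to `M⁻¹v = μv` and pair with the unit vector `v`. Bounds on the form of `M` thereby
become bounds on the extreme eigenvalues of the inverse. -/
theorem eig_inv_mul_eigenvector (hM : M.PosDef) {i : ℕ} (h1 : 1 ≤ i) (hi : i ≤ n) :
    ∃ v : Fin n → ℝ, v ⬝ᵥ v = 1 ∧ eig M⁻¹ i * (v ⬝ᵥ (M *ᵥ v)) = 1 := by
  obtain ⟨v, hv, hMv⟩ := exists_eigenvector_eig hM.inv.isHermitian h1 hi
  refine ⟨v, hv, ?_⟩
  have h := mulVec_inv_mulVec hM v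
  rw [hMv, Matrix.mulVec_smul] at h
  rw [← smul_eq_mul, ← dotProduct_smul, h, hv]

theorem eig_inv_one_le (hM : M.PosDef) (hn : 1 ≤ n) : eig M⁻¹ 1 ≤ 1 / eig M n := by
  obtain ⟨v, hv, h⟩ := eig_inv_mul_eigenvector hM le_rfl hn
  have h2 := eig_last_le_dotProduct_mulVec hM.isHermitian v
  rw [hv, mul_one] at h2
  rw [le_div_iff₀ (eig_pos hM hn le_rfl), ← h]
  exact mul_le_mul_of_nonneg_left h2 (eig_pos hM.inv le_rfl hn).le

theorem le_eig_inv_last (hM : M.PosDef) (hn : 1 ≤ n) : 1 / eig M 1 ≤ eig M⁻¹ n := by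
  obtain ⟨v, hv, h⟩ := eig_inv_mul_eigenvector hM hn le_rfl
  have h2 := dotProduct_mulVec_le_eig_one hM.isHermitian v
  rw [hv, mul_one] at h2
  rw [div_le_iff₀ (eig_pos hM le_rfl hn), ← h]
  exact mul_le_mul_of_nonneg_left h2 (eig_pos hM.inv hn le_rfl).le

end Eigenvalues

/-! ### Positive semidefinite quadratic forms -/

section Forms

variable {ι : Type*} [Fintype ι]

theorem dotProduct_self_nonneg' (v : ι → ℝ) : 0 ≤ v ⬝ᵥ v :=
  Finset.sum_nonneg fun i _ => mul_self_nonneg (v i)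

theorem dotProduct_mulVec_symm {B : Matrix ι ι ℝ} (hB : B.IsHermitian) (v w : ι → ℝ) :
    v ⬝ᵥ (B *ᵥ w) = w ⬝ᵥ (B *ᵥ v) := by
  have h2 : Bᵀ = B := (show B.IsSymm by simpa using hB)
  rw [Matrix.dotProduct_mulVec, ← Matrix.mulVec_transpose, h2, dotProduct_comm]

/-- A positive semidefinite form bounded by `m` satisfies `|B v|² ≤ m ⟨v, B v⟩`. -/
theorem mulVec_sq_le {B : Matrix ι ι ℝ} (hB : B.PosSemidef) {m : ℝ} (hm : 0 < m)
    (h : ∀ v, v ⬝ᵥ (B *ᵥ v) ≤ m * (v ⬝ᵥ v)) (v : ι → ℝ) :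
    (B *ᵥ v) ⬝ᵥ (B *ᵥ v) ≤ m * (v ⬝ᵥ (B *ᵥ v)) := by
  set x := B *ᵥ v with hx
  -- Positivity of the form at `Bv - mv`, together with the upper bound at `Bv`, gives `m(m⟨v, Bv⟩ -
  -- |Bv|²) ≥ 0`.
  have h1 := hB.dotProduct_mulVec_nonneg (x - m • v)
  have h2 := h x
  have h3 := dotProduct_mulVec_symm hB.isHermitian v x
  simp only [star_trivial, Matrix.mulVec_sub, Matrix.mulVec_smul, sub_dotProduct, dotProduct_sub,
    smul_dotProduct, dotProduct_smul, smul_eq_mul, ← hx] at h1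
  rw [h3] at h1
  have h4 : 0 ≤ m * (m * (v ⬝ᵥ x) - x ⬝ᵥ x) := by nlinarith
  have := nonneg_of_mul_nonneg_right h4 hm
  linarith

theorem mulVec_sq_le_sq {B : Matrix ι ι ℝ} (hB : B.PosSemidef) {m : ℝ} (hm : 0 < m)
    (h : ∀ v, v ⬝ᵥ (B *ᵥ v) ≤ m * (v ⬝ᵥ v)) (v : ι → ℝ) :
    (B *ᵥ v) ⬝ᵥ (B *ᵥ v) ≤ m ^ 2 * (v ⬝ᵥ v) := by
  have h1 := mulVec_sq_le hB hm h v
  have h2 := mul_le_mul_of_nonneg_left (h v) hm.le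
  linarith

/-- If `A ≤ F` and `A⁻¹` is bounded by `m`, then `|F⁻¹ v| ≤ m |v|`. -/
theorem inv_mulVec_sq_le_of_le [DecidableEq ι] {A F : Matrix ι ι ℝ} (hA : A.PosDef)
    (hF : F.PosDef) (hAF : ∀ v, v ⬝ᵥ (A *ᵥ v) ≤ v ⬝ᵥ (F *ᵥ v)) {m : ℝ} (hm : 0 < m)
    (h : ∀ v, v ⬝ᵥ (A⁻¹ *ᵥ v) ≤ m * (v ⬝ᵥ v)) (v : ι → ℝ) :
    (F⁻¹ *ᵥ v) ⬝ᵥ (F⁻¹ *ᵥ v) ≤ m ^ 2 * (v ⬝ᵥ v) := by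
  set x := F⁻¹ *ᵥ v with hx
  have hFx : F *ᵥ x = v := mulVec_inv_mulVec hF v
  -- The chain is `|x|² = |A⁻¹Ax|² ≤ m⟨x, Ax⟩ ≤ m⟨x, Fx⟩ = m⟨x, v⟩`; expanding `|x - mv|² ≥ 0`
  -- finishes.
  have h1 := mulVec_sq_le hA.inv.posSemidef hm h (A *ᵥ x)
  rw [inv_mulVec_mulVec hA, dotProduct_comm (A *ᵥ x)] at h1
  have h2 := hAF x
  rw [hFx] at h2
  have h3 := dotProduct_self_nonneg' (x - m • v)
  simp only [sub_dotProduct, dotProduct_sub, smul_dotProduct, dotProduct_smul, smul_eq_mul,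
    dotProduct_comm v x] at h3
  nlinarith

end Forms

/-! ### Deterministic bounds for the ridge estimator with a split design -/

section Deterministic

variable {N H T : Type*} [Fintype N] [Fintype H] [Fintype T]

theorem dotProduct_mul_transpose_mulVec (Y : Matrix N H ℝ) (v : N → ℝ) :
    v ⬝ᵥ ((Y * Yᵀ) *ᵥ v) = (Yᵀ *ᵥ v) ⬝ᵥ (Yᵀ *ᵥ v) := by
  rw [← Matrix.mulVec_mulVec, Matrix.dotProduct_mulVec, ← Matrix.mulVec_transpose]

theorem posSemidef_mul_transpose (Y : Matrix N H ℝ) : (Y * Yᵀ).PosSemidef := by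
  simpa using Matrix.posSemidef_self_mul_conjTranspose Y

theorem mulVec_dotProduct_eq (Y : Matrix N H ℝ) (b : H → ℝ) (x : N → ℝ) :
    (Y *ᵥ b) ⬝ᵥ x = b ⬝ᵥ (Yᵀ *ᵥ x) := by
  rw [Matrix.dotProduct_mulVec, ← Matrix.mulVec_transpose, Matrix.transpose_transpose]

/-- Weighted Young inequality, one completed square per coordinate. The factor `1/4` lets the first
term be absorbed by the head form in the energy identities. -/
theorem neg_sum_mul_le {l : H → ℝ} (hl : ∀ h, 0 < l h) {η : ℝ} (hη : 0 < η) (a b : H → ℝ) :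
    -(a ⬝ᵥ b) ≤ η / 4 * ∑ h, l h * b h ^ 2 + (∑ h, a h ^ 2 / l h) / η := by
  rw [dotProduct, ← Finset.sum_neg_distrib, Finset.mul_sum, Finset.sum_div,
    ← Finset.sum_add_distrib]
  refine Finset.sum_le_sum fun h _ => ?_
  have hlh := hl h
  have : η / 4 * (l h * b h ^ 2) + a h ^ 2 / l h / η + a h * b h
      = (η * l h * b h / 2 + a h) ^ 2 / (l h * η) := by
    field_simp
    ring
  have h2 : 0 ≤ (η * l h * b h / 2 + a h) ^ 2 / (l h * η) := by positivity
  linarith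

/-- The energy identity controls `Q = ⟨v, A⁻¹v⟩` for `v = X₀ζ`. The head error is at most `Q/η`, and
the tail error is governed by `|A⁻¹v|² ≤ mQ` and `|A⁻¹τ|² ≤ m²|τ|²`, where `τ = X₁θ₁`. -/
theorem bias_split_le [DecidableEq N] {A : Matrix N N ℝ} (hA : A.PosDef) (X₀ : Matrix N H ℝ) (X₁ : Matrix N T ℝ)
    {l₀ : H → ℝ} (hl₀ : ∀ h, 0 < l₀ h) {l₁ : T → ℝ} (hl₁ : ∀ j, 0 ≤ l₁ j) {m η op : ℝ}
    (hm : 0 < m) (hη : 0 < η) (hop : 0 ≤ op) (hup : ∀ v, v ⬝ᵥ (A⁻¹ *ᵥ v) ≤ m * (v ⬝ᵥ v))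
    (hlow : ∀ ζ : H → ℝ, η * ∑ h, l₀ h * ζ h ^ 2 ≤ (X₀ *ᵥ ζ) ⬝ᵥ (A⁻¹ *ᵥ (X₀ *ᵥ ζ)))
    (hX₁ : ∀ x : N → ℝ, ∑ j, l₁ j * (X₁ᵀ *ᵥ x) j ^ 2 ≤ op * (x ⬝ᵥ x))
    (θ₀ : H → ℝ) (θ₁ : T → ℝ) {w : N → ℝ}
    (hw : w = (A + X₀ * X₀ᵀ)⁻¹ *ᵥ (X₀ *ᵥ θ₀ + X₁ *ᵥ θ₁)) :
    ∑ h, l₀ h * (θ₀ h - (X₀ᵀ *ᵥ w) h) ^ 2 + ∑ j, l₁ j * (θ₁ j - (X₁ᵀ *ᵥ w) j) ^ 2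
      ≤ (2 * (m * ((X₁ *ᵥ θ₁) ⬝ᵥ (X₁ *ᵥ θ₁))) + 2 * ((∑ h, θ₀ h ^ 2 / l₀ h) / η)) / η
        + 3 * (∑ j, l₁ j * θ₁ j ^ 2)
        + 3 * op * m * (3 * (m * ((X₁ *ᵥ θ₁) ⬝ᵥ (X₁ *ᵥ θ₁)))
          + 2 * ((∑ h, θ₀ h ^ 2 / l₀ h) / η)) := by
  have hF : (A + X₀ * X₀ᵀ).PosDef := hA.add_posSemidef (posSemidef_mul_transpose X₀)
  have hFw : (A + X₀ * X₀ᵀ) *ᵥ w = X₀ *ᵥ θ₀ + X₁ *ᵥ θ₁ := by rw [hw, mulVec_inv_mulVec hF]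
  set ζ : H → ℝ := X₀ᵀ *ᵥ w - θ₀ with hζ
  set v := X₀ *ᵥ ζ with hv
  set τ := X₁ *ᵥ θ₁ with hτ
  set G := (∑ h, θ₀ h ^ 2 / l₀ h) / η with hG
  have hAw : A *ᵥ w = τ - v := by
    rw [Matrix.add_mulVec, ← Matrix.mulVec_mulVec] at hFw
    rw [hv, hζ, Matrix.mulVec_sub]
    have := eq_sub_of_add_eq hFw
    rw [this]; abel
  have hw' : w = A⁻¹ *ᵥ τ - A⁻¹ *ᵥ v := by
    rw [← Matrix.mulVec_sub, ← hAw, inv_mulVec_mulVec hA]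
  have hζζ : ζ ⬝ᵥ ζ = v ⬝ᵥ w - θ₀ ⬝ᵥ ζ := by
    have h1 : v ⬝ᵥ w = ζ ⬝ᵥ (X₀ᵀ *ᵥ w) := by
      rw [hv, Matrix.dotProduct_mulVec, ← Matrix.mulVec_transpose, Matrix.transpose_transpose]
    have h2 : X₀ᵀ *ᵥ w = ζ + θ₀ := by rw [hζ]; abel
    rw [h1, h2, dotProduct_add, dotProduct_comm θ₀]; ring
  set Q := v ⬝ᵥ (A⁻¹ *ᵥ v) with hQ
  set S := τ ⬝ᵥ (A⁻¹ *ᵥ τ) with hS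
  have hvw : v ⬝ᵥ w = v ⬝ᵥ (A⁻¹ *ᵥ τ) - Q := by
    conv_lhs => rw [hw']
    rw [dotProduct_sub]
  have hcs : v ⬝ᵥ (A⁻¹ *ᵥ τ) ≤ Q / 4 + S := by
    have h1 := hA.inv.posSemidef.dotProduct_mulVec_nonneg ((1 / 2 : ℝ) • v - τ)
    have h2 := dotProduct_mulVec_symm hA.inv.isHermitian τ v
    simp only [star_trivial, Matrix.mulVec_sub, Matrix.mulVec_smul, sub_dotProduct, dotProduct_sub,
      smul_dotProduct, dotProduct_smul, smul_eq_mul] at h1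
    rw [h2] at h1
    linarith
  have hD := hlow ζ
  have hcross := neg_sum_mul_le hl₀ hη θ₀ ζ
  have hζ0 := dotProduct_self_nonneg' ζ
  -- In `|ζ|² + Q = ⟨v, A⁻¹τ⟩ - ⟨θ₀, ζ⟩` each term on the right costs at most `Q/4` besides `S` or
  -- `G`, the second because `ηD ≤ Q` for the head error `D`. Half of `Q` survives.
  have hQle : Q ≤ 2 * S + 2 * G := by linarith
  have hSle : S ≤ m * (τ ⬝ᵥ τ) := hup τ
  have hhead : ∑ h, l₀ h * (θ₀ h - (X₀ᵀ *ᵥ w) h) ^ 2 = ∑ h, l₀ h * ζ h ^ 2 := by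
    refine Finset.sum_congr rfl fun h _ => ?_
    simp only [hζ, Pi.sub_apply]; ring
  have hDle : ∑ h, l₀ h * ζ h ^ 2 ≤ (2 * (m * (τ ⬝ᵥ τ)) + 2 * G) / η := by
    rw [le_div_iff₀ hη]; linarith
  have hτ2 := mulVec_sq_le hA.inv.posSemidef hm hup τ
  have hv2 := mulVec_sq_le hA.inv.posSemidef hm hup v
  -- Since `w = A⁻¹τ - A⁻¹v`, the tail error is a sum of three vectors, whence the factor 3.
  have htail : ∑ j, l₁ j * (θ₁ j - (X₁ᵀ *ᵥ w) j) ^ 2 ≤ 3 * (∑ j, l₁ j * θ₁ j ^ 2)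
      + 3 * (∑ j, l₁ j * (X₁ᵀ *ᵥ (A⁻¹ *ᵥ τ)) j ^ 2)
      + 3 * (∑ j, l₁ j * (X₁ᵀ *ᵥ (A⁻¹ *ᵥ v)) j ^ 2) := by
    rw [Finset.mul_sum, Finset.mul_sum, Finset.mul_sum, ← Finset.sum_add_distrib,
      ← Finset.sum_add_distrib]
    refine Finset.sum_le_sum fun j _ => ?_
    have : (X₁ᵀ *ᵥ w) j = (X₁ᵀ *ᵥ (A⁻¹ *ᵥ τ)) j - (X₁ᵀ *ᵥ (A⁻¹ *ᵥ v)) j := by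
      conv_lhs => rw [hw', Matrix.mulVec_sub]
      rfl
    rw [this]
    generalize (X₁ᵀ *ᵥ (A⁻¹ *ᵥ τ)) j = a
    generalize (X₁ᵀ *ᵥ (A⁻¹ *ᵥ v)) j = b
    have h3 : (θ₁ j - (a - b)) ^ 2 ≤ 3 * θ₁ j ^ 2 + 3 * a ^ 2 + 3 * b ^ 2 := by
      nlinarith [sq_nonneg (θ₁ j + a), sq_nonneg (θ₁ j - b), sq_nonneg (a + b)]
    nlinarith [mul_le_mul_of_nonneg_left h3 (hl₁ j)]
  have h4 := hX₁ (A⁻¹ *ᵥ τ)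
  have h5 := hX₁ (A⁻¹ *ᵥ v)
  have h6 : (A⁻¹ *ᵥ τ) ⬝ᵥ (A⁻¹ *ᵥ τ) + (A⁻¹ *ᵥ v) ⬝ᵥ (A⁻¹ *ᵥ v)
      ≤ m * (3 * (m * (τ ⬝ᵥ τ)) + 2 * G) := by nlinarith
  have h7 := mul_le_mul_of_nonneg_left h6 hop
  rw [hhead]
  linarith

/-- With `β = X₀ᵀw` and `u = X₀β`, the identity is `|β|² + ⟨u, A⁻¹u⟩ = ⟨X₀ᵀA⁻¹e, β⟩`. The right side
depends on the noise only through the linear image `X₀ᵀA⁻¹e`. -/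
theorem variance_split_le [DecidableEq N] {A : Matrix N N ℝ} (hA : A.PosDef) (X₀ : Matrix N H ℝ)
    {l₀ : H → ℝ} (hl₀ : ∀ h, 0 < l₀ h) {η : ℝ} (hη : 0 < η)
    (hlow : ∀ ζ : H → ℝ, η * ∑ h, l₀ h * ζ h ^ 2 ≤ (X₀ *ᵥ ζ) ⬝ᵥ (A⁻¹ *ᵥ (X₀ *ᵥ ζ)))
    (e : N → ℝ) {w : N → ℝ} (hw : w = (A + X₀ * X₀ᵀ)⁻¹ *ᵥ e) :
    ∑ h, l₀ h * (X₀ᵀ *ᵥ w) h ^ 2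
      ≤ 4 / 3 * (∑ h, (X₀ᵀ *ᵥ (A⁻¹ *ᵥ e)) h ^ 2 / l₀ h) / η ^ 2 := by
  have hF : (A + X₀ * X₀ᵀ).PosDef := hA.add_posSemidef (posSemidef_mul_transpose X₀)
  have hFw : (A + X₀ * X₀ᵀ) *ᵥ w = e := by rw [hw, mulVec_inv_mulVec hF]
  set β : H → ℝ := X₀ᵀ *ᵥ w with hβ
  set u := X₀ *ᵥ β with hu
  have hAw : A *ᵥ w = e - u := by
    rw [Matrix.add_mulVec, ← Matrix.mulVec_mulVec] at hFw
    exact eq_sub_of_add_eq hFw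
  have hw' : w = A⁻¹ *ᵥ e - A⁻¹ *ᵥ u := by
    rw [← Matrix.mulVec_sub, ← hAw, inv_mulVec_mulVec hA]
  have hββ : β ⬝ᵥ β = u ⬝ᵥ w := by
    rw [hu, mulVec_dotProduct_eq X₀ β w]
  have huw : u ⬝ᵥ w = u ⬝ᵥ (A⁻¹ *ᵥ e) - u ⬝ᵥ (A⁻¹ *ᵥ u) := by
    conv_lhs => rw [hw']
    rw [dotProduct_sub]
  have hβ0 := dotProduct_self_nonneg' β
  have hD := hlow β
  have hcross := neg_sum_mul_le hl₀ hη (-(X₀ᵀ *ᵥ (A⁻¹ *ᵥ e))) β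
  have h1 : u ⬝ᵥ (A⁻¹ *ᵥ e) = -(-(X₀ᵀ *ᵥ (A⁻¹ *ᵥ e)) ⬝ᵥ β) := by
    rw [hu, mulVec_dotProduct_eq, neg_dotProduct, neg_neg, dotProduct_comm]
  simp only [Pi.neg_apply, neg_sq] at hcross
  set N₁ := ∑ h, (X₀ᵀ *ᵥ (A⁻¹ *ᵥ e)) h ^ 2 / l₀ h
  rw [← hu] at hD
  have h2 : 3 / 4 * (η * ∑ h, l₀ h * β h ^ 2) ≤ N₁ / η := by linarith
  rw [le_div_iff₀ hη] at h2
  rw [le_div_iff₀ (by positivity)]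
  linarith

/-- By symmetry of `B`, row `j` of `YᵀB` is `B` applied to column `j` of `Y`. This bounds Frobenius
norms of the noise matrices by traces. -/
theorem sum_transpose_mul_sq_le {J : Type*} {B : Matrix N N ℝ} (hB : B.IsHermitian) {c : ℝ}
    (h : ∀ v, (B *ᵥ v) ⬝ᵥ (B *ᵥ v) ≤ c * (v ⬝ᵥ v)) (Y : Matrix N J ℝ) (j : J) :
    ∑ i, (Yᵀ * B) j i ^ 2 ≤ c * ∑ i, Y i j ^ 2 := by
  have h2 : Bᵀ = B := (show B.IsSymm by simpa using hB)
  have h1 := h (fun i => Y i j)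
  have h3 : ∀ i, (Yᵀ * B) j i = (B *ᵥ fun i => Y i j) i := fun i => by
    conv_rhs => rw [← h2]
    simp only [Matrix.mul_apply, Matrix.mulVec, dotProduct, Matrix.transpose_apply]
    exact Finset.sum_congr rfl fun _ _ => mul_comm _ _
  simp only [h3]
  simpa only [dotProduct, ← sq] using h1

end Deterministic

/-! ### Exponential moments -/

section ExpMoments

/-- The linear term integrates to zero for a centered variable, leaving only the moment of the
square. -/
theorem exp_le_add_exp_sq (x : ℝ) : Real.exp x ≤ x + Real.exp (x ^ 2) := by
  have h0 := Real.add_one_le_exp (x ^ 2)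
  rcases le_or_gt |x| 1 with h | h
  · have := (abs_le.1 (Real.abs_exp_sub_one_sub_id_le h)).2
    linarith
  · rcases lt_abs.1 h with h | h
    · have : Real.exp x ≤ Real.exp (x ^ 2) := Real.exp_le_exp.2 (by nlinarith)
      linarith
    · have : Real.exp x ≤ 1 := Real.exp_le_one_iff.2 (by linarith)
      nlinarith

/-- Convexity of `exp` between `0` and `q`. Integrated, it improves `E exp q ≤ 2` to `E exp(θq) ≤ 1
+ θ`. -/
theorem exp_mul_le_of_le_one {θ : ℝ} (h0 : 0 ≤ θ) (h1 : θ ≤ 1) (q : ℝ) :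
    Real.exp (θ * q) ≤ (1 - θ) + θ * Real.exp q := by
  have := convexOn_exp.2 (Set.mem_univ 0) (Set.mem_univ q) (sub_nonneg.2 h1) h0 (by ring)
  simpa using this

/-- Follows from `exp y ≥ 1 + y + y²/2` and `(1 - y + y²/2)(1 + y + y²/2) = 1 + y⁴/4 ≥ 1`. -/
theorem exp_neg_le_quadratic {y : ℝ} (hy : 0 ≤ y) : Real.exp (-y) ≤ 1 - y + y ^ 2 / 2 := by
  have h := Real.quadratic_le_exp_of_nonneg hy
  rw [Real.exp_neg, inv_le_iff_one_le_mul₀ (Real.exp_pos y)]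
  have h2 : 0 ≤ 1 - y + y ^ 2 / 2 := by nlinarith [sq_nonneg (y - 1)]
  have h3 := mul_le_mul_of_nonneg_left h h2
  nlinarith [sq_nonneg (y ^ 2)]

variable {Ω : Type*} [MeasurableSpace Ω] {μ : Measure Ω}

theorem measure_lt_le_of_lintegral_exp_le {q : Ω → ℝ} (hq : Measurable q) {C : ℝ≥0∞}
    (h : ∫⁻ ω, ENNReal.ofReal (Real.exp (q ω)) ∂μ ≤ C) (b : ℝ) :
    μ {ω | b < q ω} ≤ C * ENNReal.ofReal (Real.exp (-b)) := by
  have hm : Measurable fun ω => ENNReal.ofReal (Real.exp (q ω)) := by fun_prop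
  have h1 := mul_meas_ge_le_lintegral (μ := μ) hm (ENNReal.ofReal (Real.exp b))
  have h2 : μ {ω | b < q ω} ≤
      μ {ω | ENNReal.ofReal (Real.exp b) ≤ ENNReal.ofReal (Real.exp (q ω))} :=
    measure_mono fun ω hω => ENNReal.ofReal_le_ofReal (Real.exp_le_exp.2 (le_of_lt hω))
  have h3 : ENNReal.ofReal (Real.exp b) * ENNReal.ofReal (Real.exp (-b)) = 1 := by
    rw [← ENNReal.ofReal_mul (Real.exp_pos _).le, ← Real.exp_add]; simp
  calc μ {ω | b < q ω}
      ≤ μ {ω | ENNReal.ofReal (Real.exp b) ≤ ENNReal.ofReal (Real.exp (q ω))} := h2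
    _ = (ENNReal.ofReal (Real.exp b) *
          μ {ω | ENNReal.ofReal (Real.exp b) ≤ ENNReal.ofReal (Real.exp (q ω))})
          * ENNReal.ofReal (Real.exp (-b)) := by
        rw [mul_right_comm, h3, one_mul]
    _ ≤ C * ENNReal.ofReal (Real.exp (-b)) := by gcongr; exact h1.trans h

theorem lintegral_exp_sum_le {ι : Type*} [Fintype ι] {x : ι → Ω → ℝ} (hx : ∀ i, Measurable (x i))
    (hind : iIndepFun x μ) {c : ι → ℝ}
    (h : ∀ i, ∫⁻ ω, ENNReal.ofReal (Real.exp (x i ω)) ∂μ ≤ ENNReal.ofReal (Real.exp (c i))) :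
    ∫⁻ ω, ENNReal.ofReal (Real.exp (∑ i, x i ω)) ∂μ ≤ ENNReal.ofReal (Real.exp (∑ i, c i)) := by
  have h1 : ∀ y : ι → ℝ, ENNReal.ofReal (Real.exp (∑ i, y i))
      = ∏ i, ENNReal.ofReal (Real.exp (y i)) := fun y => by
    rw [Real.exp_sum, ENNReal.ofReal_prod_of_nonneg fun i _ => (Real.exp_pos _).le]
  simp only [h1]
  have h2 := hind.comp (fun _ y => ENNReal.ofReal (Real.exp y)) (fun _ => by fun_prop)
  have h3 := lintegral_prod_eq_prod_lintegral_of_indepFun Finset.univ _ h2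
    (fun i => by have := hx i; simp only [Function.comp_def]; fun_prop)
  simp only [Function.comp_def] at h3
  rw [h3]
  exact Finset.prod_le_prod' fun i _ => h i

theorem integrable_of_lintegral_exp_le {q : Ω → ℝ} (hq : Measurable q) {C : ℝ≥0∞} (hC : C ≠ ∞)
    (h : ∫⁻ ω, ENNReal.ofReal (Real.exp (q ω)) ∂μ ≤ C) :
    Integrable (fun ω => Real.exp (q ω)) μ := by
  refine ⟨by fun_prop, ?_⟩
  rw [hasFiniteIntegral_iff_ofReal (ae_of_all _ fun ω => (Real.exp_pos _).le)]
  exact h.trans_lt hC.lt_top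

/-- Jensen's inequality for convex combinations of exponents. -/
theorem lintegral_exp_convexComb_le {ι : Type*} [Fintype ι] {q : ι → Ω → ℝ}
    (hq : ∀ i, Measurable (q i)) {w : ι → ℝ} (hw : ∀ i, 0 ≤ w i) (hw1 : ∑ i, w i = 1)
    (h : ∀ i, ∫⁻ ω, ENNReal.ofReal (Real.exp (q i ω)) ∂μ ≤ 2) :
    ∫⁻ ω, ENNReal.ofReal (Real.exp (∑ i, w i * q i ω)) ∂μ ≤ 2 := by
  calc ∫⁻ ω, ENNReal.ofReal (Real.exp (∑ i, w i * q i ω)) ∂μ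
      ≤ ∫⁻ ω, ∑ i, ENNReal.ofReal (w i) * ENNReal.ofReal (Real.exp (q i ω)) ∂μ := by
        refine lintegral_mono fun ω => ?_
        have h1 := convexOn_exp.map_sum_le (t := Finset.univ) (p := fun i => q i ω)
          (fun i _ => hw i) hw1 (fun i _ => Set.mem_univ _)
        simp only [smul_eq_mul] at h1
        refine (ENNReal.ofReal_le_ofReal h1).trans ?_
        rw [ENNReal.ofReal_sum_of_nonneg fun i _ => mul_nonneg (hw i) (Real.exp_pos _).le]
        exact le_of_eq (Finset.sum_congr rfl fun i _ => ENNReal.ofReal_mul (hw i))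
    _ = ∑ i, ENNReal.ofReal (w i) * ∫⁻ ω, ENNReal.ofReal (Real.exp (q i ω)) ∂μ := by
        rw [lintegral_finsetSum _ fun i _ => by have := hq i; fun_prop]
        exact Finset.sum_congr rfl fun i _ => lintegral_const_mul _ (by have := hq i; fun_prop)
    _ ≤ ∑ i, ENNReal.ofReal (w i) * 2 := by gcongr with i _; exact h i
    _ = 2 := by
        rw [← Finset.sum_mul, ← ENNReal.ofReal_sum_of_nonneg fun i _ => hw i, hw1]; simp

variable [IsProbabilityMeasure μ]

theorem lintegral_exp_mul_le {q : Ω → ℝ} (hq : Measurable q)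
    (h : ∫⁻ ω, ENNReal.ofReal (Real.exp (q ω)) ∂μ ≤ 2) {θ : ℝ} (h0 : 0 ≤ θ) (h1 : θ ≤ 1) :
    ∫⁻ ω, ENNReal.ofReal (Real.exp (θ * q ω)) ∂μ ≤ ENNReal.ofReal (1 + θ) := by
  calc ∫⁻ ω, ENNReal.ofReal (Real.exp (θ * q ω)) ∂μ
      ≤ ∫⁻ ω, (ENNReal.ofReal (1 - θ) + ENNReal.ofReal θ * ENNReal.ofReal (Real.exp (q ω))) ∂μ := by
        refine lintegral_mono fun ω => ?_
        rw [← ENNReal.ofReal_mul h0, ← ENNReal.ofReal_add (sub_nonneg.2 h1) (by positivity)]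
        exact ENNReal.ofReal_le_ofReal (exp_mul_le_of_le_one h0 h1 _)
    _ = ENNReal.ofReal (1 - θ) + ENNReal.ofReal θ * ∫⁻ ω, ENNReal.ofReal (Real.exp (q ω)) ∂μ := by
        rw [lintegral_add_left measurable_const, lintegral_const_mul _ (by fun_prop)]
        simp
    _ ≤ ENNReal.ofReal (1 - θ) + ENNReal.ofReal θ * 2 := by gcongr
    _ = ENNReal.ofReal (1 + θ) := by
        have : (2 : ℝ≥0∞) = ENNReal.ofReal 2 := by simp
        rw [this, ← ENNReal.ofReal_mul h0, ← ENNReal.ofReal_add (sub_nonneg.2 h1) (by positivity)]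
        congr 1; ring

/-- A centered variable with `E exp(y² / s²) ≤ 2` satisfies `E exp(a y) ≤ exp(a² s²)`. -/
theorem lintegral_exp_mul_le_of_centered {y : Ω → ℝ} (hy : Measurable y) (hy0 : ∫ ω, y ω ∂μ = 0)
    {s : ℝ} (hs : 0 < s) (h : ∫⁻ ω, ENNReal.ofReal (Real.exp (y ω ^ 2 / s ^ 2)) ∂μ ≤ 2) (a : ℝ) :
    ∫⁻ ω, ENNReal.ofReal (Real.exp (a * y ω)) ∂μ ≤ ENNReal.ofReal (Real.exp (a ^ 2 * s ^ 2)) := by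
  have hm : Measurable fun ω => y ω ^ 2 / s ^ 2 := by fun_prop
  -- For small `a` centering is used through `exp x ≤ x + exp(x²)`. For large `a` it is unnecessary:
  -- `ay ≤ a²s²/2 + y²/(2s²)`, and the leftover factor `3/2` is at most `exp(a²s²/2)`.
  rcases le_or_gt (a ^ 2 * s ^ 2) 1 with has | has
  · have h1 := lintegral_exp_mul_le hm h (by positivity) has
    have he : ∀ ω, a ^ 2 * s ^ 2 * (y ω ^ 2 / s ^ 2) = (a * y ω) ^ 2 := fun ω => by
      field_simp
    simp only [he] at h1
    have hint1 : Integrable (fun ω => Real.exp ((a * y ω) ^ 2)) μ :=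
      integrable_of_lintegral_exp_le (by fun_prop) ENNReal.ofReal_ne_top h1
    have hint0 : Integrable (fun ω => Real.exp (y ω ^ 2 / s ^ 2)) μ :=
      integrable_of_lintegral_exp_le (by fun_prop) ENNReal.ofNat_ne_top h
    have hint2 : Integrable y μ := by
      refine (hint0.const_mul s).mono' (by fun_prop) (ae_of_all _ fun ω => ?_)
      have h2 := Real.add_one_le_exp (y ω ^ 2 / s ^ 2)
      have h3 : |y ω| ≤ s * (y ω ^ 2 / s ^ 2 + 1) := by
        rw [← sq_abs (y ω)]
        have : s * (|y ω| ^ 2 / s ^ 2 + 1) - |y ω| = ((|y ω| - s / 2) ^ 2 + 3 / 4 * s ^ 2) / s := by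
          field_simp; ring
        have h5 : 0 ≤ ((|y ω| - s / 2) ^ 2 + 3 / 4 * s ^ 2) / s := by positivity
        linarith
      exact h3.trans (mul_le_mul_of_nonneg_left h2 hs.le)
    have hint3 : Integrable (fun ω => a * y ω + Real.exp ((a * y ω) ^ 2)) μ :=
      (hint2.const_mul a).add hint1
    have hnn : ∀ ω, 0 ≤ a * y ω + Real.exp ((a * y ω) ^ 2) := fun ω =>
      (Real.exp_pos _).le.trans (exp_le_add_exp_sq _)
    calc ∫⁻ ω, ENNReal.ofReal (Real.exp (a * y ω)) ∂μ
        ≤ ∫⁻ ω, ENNReal.ofReal (a * y ω + Real.exp ((a * y ω) ^ 2)) ∂μ :=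
          lintegral_mono fun ω => ENNReal.ofReal_le_ofReal (exp_le_add_exp_sq _)
      _ = ENNReal.ofReal (∫ ω, (a * y ω + Real.exp ((a * y ω) ^ 2)) ∂μ) :=
          (ofReal_integral_eq_lintegral_ofReal hint3 (ae_of_all _ hnn)).symm
      _ = ENNReal.ofReal (∫ ω, Real.exp ((a * y ω) ^ 2) ∂μ) := by
          rw [integral_add (hint2.const_mul a) hint1, integral_const_mul, hy0]; simp
      _ = ∫⁻ ω, ENNReal.ofReal (Real.exp ((a * y ω) ^ 2)) ∂μ :=
          ofReal_integral_eq_lintegral_ofReal hint1 (ae_of_all _ fun ω => (Real.exp_pos _).le)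
      _ ≤ ENNReal.ofReal (1 + a ^ 2 * s ^ 2) := h1
      _ ≤ ENNReal.ofReal (Real.exp (a ^ 2 * s ^ 2)) := by
          refine ENNReal.ofReal_le_ofReal ?_
          have := Real.add_one_le_exp (a ^ 2 * s ^ 2); linarith
  · have h1 := lintegral_exp_mul_le hm h (θ := 1 / 2) (by norm_num) (by norm_num)
    calc ∫⁻ ω, ENNReal.ofReal (Real.exp (a * y ω)) ∂μ
        ≤ ∫⁻ ω, ENNReal.ofReal (Real.exp (a ^ 2 * s ^ 2 / 2)) *
            ENNReal.ofReal (Real.exp (1 / 2 * (y ω ^ 2 / s ^ 2))) ∂μ := by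
          refine lintegral_mono fun ω => ?_
          rw [← ENNReal.ofReal_mul (Real.exp_pos _).le, ← Real.exp_add]
          refine ENNReal.ofReal_le_ofReal (Real.exp_le_exp.2 ?_)
          have : a ^ 2 * s ^ 2 / 2 + 1 / 2 * (y ω ^ 2 / s ^ 2) - a * y ω
              = (a * s - y ω / s) ^ 2 / 2 := by field_simp; ring
          have h5 : 0 ≤ (a * s - y ω / s) ^ 2 / 2 := by positivity
          linarith
      _ ≤ ENNReal.ofReal (Real.exp (a ^ 2 * s ^ 2 / 2)) * ENNReal.ofReal (1 + 1 / 2) := by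
          rw [lintegral_const_mul _ (by fun_prop)]
          gcongr
      _ ≤ ENNReal.ofReal (Real.exp (a ^ 2 * s ^ 2)) := by
          rw [← ENNReal.ofReal_mul (Real.exp_pos _).le]
          refine ENNReal.ofReal_le_ofReal ?_
          have h2 := Real.add_one_le_exp (a ^ 2 * s ^ 2 / 2)
          have h3 : Real.exp (a ^ 2 * s ^ 2)
              = Real.exp (a ^ 2 * s ^ 2 / 2) * Real.exp (a ^ 2 * s ^ 2 / 2) := by
            rw [← Real.exp_add]; ring_nf
          rw [h3]
          refine mul_le_mul_of_nonneg_left ?_ (Real.exp_pos _).le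
          linarith

end ExpMoments

/-! ### Gaussian linearization of squares -/

section Gaussian

theorem lintegral_exp_mul_gaussianReal (a : ℝ) :
    ∫⁻ x, ENNReal.ofReal (Real.exp (a * x)) ∂(gaussianReal 0 1)
      = ENNReal.ofReal (Real.exp (a ^ 2 / 2)) := by
  have h := congrFun (mgf_fun_id_gaussianReal (μ := 0) (v := 1)) a
  rw [← ofReal_integral_eq_lintegral_ofReal (integrable_exp_mul_gaussianReal a)
    (ae_of_all _ fun x => (Real.exp_pos _).le)]
  rw [mgf] at h
  rw [h]; simp

/-- The exact value is `√2`; the cruder bound 2 is the form required by `lintegral_exp_mul_le`. -/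
theorem lintegral_exp_sq_gaussianReal :
    ∫⁻ x, ENNReal.ofReal (Real.exp (x ^ 2 / 4)) ∂(gaussianReal 0 1) ≤ 2 := by
  rw [gaussianReal_of_var_ne_zero _ one_ne_zero, lintegral_withDensity_eq_lintegral_mul _
    (measurable_gaussianPDF 0 1) (by fun_prop)]
  have h1 : ∀ x : ℝ, (gaussianPDF 0 1 * fun x => ENNReal.ofReal (Real.exp (x ^ 2 / 4))) x
      = ENNReal.ofReal ((√(2 * Real.pi))⁻¹ * Real.exp (-(1 / 4) * x ^ 2)) := fun x => by
    simp only [Pi.mul_apply, gaussianPDF, gaussianPDFReal]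
    rw [← ENNReal.ofReal_mul (by positivity), mul_assoc, ← Real.exp_add]
    congr 2
    · simp
    · congr 1; simp; ring
  simp only [h1]
  rw [← ofReal_integral_eq_lintegral_ofReal
    ((integrable_exp_neg_mul_sq (by norm_num)).const_mul _) (ae_of_all _ fun x => by positivity),
    integral_const_mul, integral_gaussian]
  have h2 : (2 : ℝ≥0∞) = ENNReal.ofReal 2 := by simp
  rw [h2]
  refine ENNReal.ofReal_le_ofReal ?_
  have h3 : 0 < √(2 * Real.pi) := Real.sqrt_pos.2 (by positivity)
  rw [inv_mul_le_iff₀ h3]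
  have h4 : √(Real.pi / (1 / 4)) ≤ √(2 * Real.pi * 2 ^ 2) :=
    Real.sqrt_le_sqrt (by have := Real.pi_pos; linarith)
  rwa [Real.sqrt_mul (by positivity), Real.sqrt_sq (by norm_num)] at h4

variable {Ω : Type*} [MeasurableSpace Ω] {μ : Measure Ω} [IsProbabilityMeasure μ]

/-- For a standard Gaussian `g`, `exp(wY²) = E_g exp(√(2w) g Y)`. After exchanging integrals the
hypothesis on linear forms applies for fixed `g`, and a product of Gaussian square moments remains.
The `Y j` need not be independent. -/
theorem lintegral_exp_sum_mul_sq_le {J : Type*} [Fintype J] {Y : J → Ω → ℝ}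
    (hY : ∀ j, Measurable (Y j)) {K : ℝ} (hK : 0 ≤ K)
    (h : ∀ u : J → ℝ, ∫⁻ ω, ENNReal.ofReal (Real.exp (∑ j, u j * Y j ω)) ∂μ
      ≤ ENNReal.ofReal (Real.exp (K * ∑ j, u j ^ 2)))
    {w : J → ℝ} (hw : ∀ j, 0 ≤ w j) (hw1 : ∀ j, 8 * K * w j ≤ 1) :
    ∫⁻ ω, ENNReal.ofReal (Real.exp (∑ j, w j * Y j ω ^ 2)) ∂μ
      ≤ ENNReal.ofReal (Real.exp (8 * K * ∑ j, w j)) := by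
  classical
  let γ : Measure (J → ℝ) := Measure.pi fun _ => gaussianReal 0 1
  have hpi : ∀ φ : J → ℝ → ℝ≥0∞, (∀ j, Measurable (φ j)) →
      ∫⁻ g, ∏ j, φ j (g j) ∂γ = ∏ j, ∫⁻ x, φ j x ∂(gaussianReal 0 1) := fun φ hφ => by
    have hind : iIndepFun (fun j (g : J → ℝ) => φ j (g j)) γ :=
      iIndepFun_pi (X := φ) (μ := fun _ => gaussianReal 0 1) fun j => (hφ j).aemeasurable
    rw [lintegral_prod_eq_prod_lintegral_of_indepFun Finset.univ _ hind
      fun j => (hφ j).comp (measurable_pi_apply j)]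
    refine Finset.prod_congr rfl fun j _ => ?_
    exact (measurePreserving_eval (fun _ : J => gaussianReal 0 1) j).lintegral_comp (hφ j)
  have h1 : ∀ y : J → ℝ, ENNReal.ofReal (Real.exp (∑ i, y i))
      = ∏ i, ENNReal.ofReal (Real.exp (y i)) := fun y => by
    rw [Real.exp_sum, ENNReal.ofReal_prod_of_nonneg fun i _ => (Real.exp_pos _).le]
  have hlin : ∀ ω, ENNReal.ofReal (Real.exp (∑ j, w j * Y j ω ^ 2))
      = ∫⁻ g, ENNReal.ofReal (Real.exp (∑ j, (√(2 * w j) * g j) * Y j ω)) ∂γ := fun ω => by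
    have e1 : ∀ g : J → ℝ, ENNReal.ofReal (Real.exp (∑ j, (√(2 * w j) * g j) * Y j ω))
        = ∏ j, ENNReal.ofReal (Real.exp ((√(2 * w j) * Y j ω) * g j)) := fun g => by
      rw [h1]
      exact Finset.prod_congr rfl fun j _ => by ring_nf
    simp only [e1]
    rw [hpi (fun j x => ENNReal.ofReal (Real.exp ((√(2 * w j) * Y j ω) * x)))
      (fun j => by fun_prop), h1]
    refine Finset.prod_congr rfl fun j _ => ?_
    rw [lintegral_exp_mul_gaussianReal, mul_pow, Real.sq_sqrt (by have := hw j; positivity)]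
    ring_nf
  simp only [hlin]
  rw [lintegral_lintegral_swap (by
    have : Measurable (Function.uncurry fun (ω : Ω) (g : J → ℝ) =>
        ENNReal.ofReal (Real.exp (∑ j, (√(2 * w j) * g j) * Y j ω))) := by
      simp only [Function.uncurry_def]
      have := hY
      fun_prop
    exact this.aemeasurable)]
  calc ∫⁻ g, ∫⁻ ω, ENNReal.ofReal (Real.exp (∑ j, (√(2 * w j) * g j) * Y j ω)) ∂μ ∂γ
      ≤ ∫⁻ g, ENNReal.ofReal (Real.exp (K * ∑ j, (√(2 * w j) * g j) ^ 2)) ∂γ :=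
        lintegral_mono fun g => h fun j => √(2 * w j) * g j
    -- The exponent `2Kw g²` is written as a multiple `8Kw ≤ 1` of `g²/4`, whose exponential moment
    -- is at most 2.
    _ = ∫⁻ g, ∏ j, ENNReal.ofReal (Real.exp (8 * K * w j * (g j ^ 2 / 4))) ∂γ := by
        refine lintegral_congr fun g => ?_
        rw [Finset.mul_sum, h1]
        refine Finset.prod_congr rfl fun j _ => ?_
        rw [mul_pow, Real.sq_sqrt (by have := hw j; positivity)]
        ring_nf
    _ = ∏ j, ∫⁻ x, ENNReal.ofReal (Real.exp (8 * K * w j * (x ^ 2 / 4))) ∂(gaussianReal 0 1) :=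
        hpi (fun j x => ENNReal.ofReal (Real.exp (8 * K * w j * (x ^ 2 / 4))))
          (fun j => by fun_prop)
    _ ≤ ∏ j, ENNReal.ofReal (Real.exp (8 * K * w j)) := by
        refine Finset.prod_le_prod' fun j _ => ?_
        refine (lintegral_exp_mul_le (by fun_prop) lintegral_exp_sq_gaussianReal
          (by have := hw j; positivity) (hw1 j)).trans (ENNReal.ofReal_le_ofReal ?_)
        have := Real.add_one_le_exp (8 * K * w j); linarith
    _ = ENNReal.ofReal (Real.exp (8 * K * ∑ j, w j)) := by rw [← h1, Finset.mul_sum]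

end Gaussian

/-! ### Sub-gaussian norms -/

section SubGaussian

variable {Ω : Type*} [MeasurableSpace Ω] {μ : Measure Ω}

/-- Some admissible scale lies strictly below `s`, and the exponential moment decreases in the
scale. The strict inequality `σ < s` avoids asking whether the infimum is attained. -/
theorem lintegral_exp_sq_le_of_psi2Norm_le {Z : Ω → ℝ} {σ s : ℝ}
    (h : psi2Norm μ Z ≤ ENNReal.ofReal σ) (hσs : σ < s) (hs : 0 < s) :
    ∫⁻ ω, ENNReal.ofReal (Real.exp (Z ω ^ 2 / s ^ 2)) ∂μ ≤ 2 := by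
  have h1 : psi2Norm μ Z < ENNReal.ofReal s :=
    h.trans_lt ((ENNReal.ofReal_lt_ofReal_iff hs).2 hσs)
  simp only [psi2Norm, iInf_lt_iff] at h1
  obtain ⟨t, ht, hle, hts⟩ := h1
  have hts' : t < s := (ENNReal.ofReal_lt_ofReal_iff hs).1 hts
  refine le_trans (lintegral_mono fun ω => ENNReal.ofReal_le_ofReal (Real.exp_le_exp.2 ?_)) hle
  gcongr

theorem lintegral_exp_sq_le_of_psi2NormVec_le [IsProbabilityMeasure μ] {p : ℕ}
    {Z : Ω → Fin p → ℝ} {σ s : ℝ} (h : psi2NormVec μ Z ≤ ENNReal.ofReal σ) (hσs : σ < s)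
    (hs : 0 < s) {u : Fin p → ℝ} (hu : u ⬝ᵥ u ≤ 1) :
    ∫⁻ ω, ENNReal.ofReal (Real.exp ((u ⬝ᵥ Z ω) ^ 2 / s ^ 2)) ∂μ ≤ 2 := by
  by_cases hu0 : u = 0
  · simp [hu0]
  have h1 : psi2Norm μ (fun ω => (u ⬝ᵥ Z ω) / √(u ⬝ᵥ u)) ≤ ENNReal.ofReal σ :=
    le_trans (le_iSup₂ (f := fun (s : Fin p → ℝ) (_ : s ≠ 0) =>
      psi2Norm μ (fun ω => (s ⬝ᵥ Z ω) / √(s ⬝ᵥ s))) u hu0) h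
  refine le_trans (lintegral_mono fun ω => ENNReal.ofReal_le_ofReal (Real.exp_le_exp.2 ?_))
    (lintegral_exp_sq_le_of_psi2Norm_le h1 hσs hs)
  have hpos : 0 < u ⬝ᵥ u := lt_of_le_of_ne (dotProduct_self_nonneg' u)
    (fun h => hu0 (dotProduct_self_eq_zero.1 h.symm))
  rw [div_pow, Real.sq_sqrt hpos.le]
  gcongr
  exact le_div_self (sq_nonneg _) hpos hu

/-- Every `s > 0` is admissible and gives `E Z² ≤ 2s²`; let `s` tend to 0. This covers noiseless
models. -/
theorem ae_eq_zero_of_psi2Norm_eq_zero {Z : Ω → ℝ} (hZ : Measurable Z)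
    (h : psi2Norm μ Z ≤ ENNReal.ofReal 0) : ∀ᵐ ω ∂μ, Z ω = 0 := by
  have h1 : ∀ s : ℝ, 0 < s →
      ∫⁻ ω, ENNReal.ofReal (Z ω ^ 2) ∂μ ≤ ENNReal.ofReal (s ^ 2) * 2 := fun s hs => by
    refine le_trans ?_ (mul_le_mul_right (lintegral_exp_sq_le_of_psi2Norm_le h hs hs)
      (ENNReal.ofReal (s ^ 2)))
    rw [← lintegral_const_mul _ (by fun_prop)]
    refine lintegral_mono fun ω => ?_
    rw [← ENNReal.ofReal_mul (by positivity)]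
    refine ENNReal.ofReal_le_ofReal ?_
    have h2 := Real.add_one_le_exp (Z ω ^ 2 / s ^ 2)
    calc Z ω ^ 2 = s ^ 2 * (Z ω ^ 2 / s ^ 2) := by field_simp
      _ ≤ s ^ 2 * Real.exp (Z ω ^ 2 / s ^ 2) := by gcongr; linarith
  have h2 : Filter.Tendsto (fun s : ℝ => ENNReal.ofReal (s ^ 2) * 2) (nhdsWithin 0 (Set.Ioi 0))
      (nhds 0) := by
    have : Filter.Tendsto (fun s : ℝ => ENNReal.ofReal (s ^ 2) * 2) (nhds 0)
        (nhds (ENNReal.ofReal ((0 : ℝ) ^ 2) * 2)) :=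
      ENNReal.Tendsto.mul_const (ENNReal.tendsto_ofReal (by
        exact (continuous_pow 2).tendsto 0)) (Or.inr ENNReal.ofNat_ne_top)
    simpa using this.mono_left nhdsWithin_le_nhds
  have h3 : ∫⁻ ω, ENNReal.ofReal (Z ω ^ 2) ∂μ = 0 :=
    le_antisymm (ge_of_tendsto h2 (eventually_nhdsWithin_of_forall fun s hs => h1 s hs)) zero_le
  rw [lintegral_eq_zero_iff (by fun_prop)] at h3
  filter_upwards [h3] with ω hω
  have h4 : Z ω ^ 2 ≤ 0 := ENNReal.ofReal_eq_zero.1 hω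
  exact pow_eq_zero_iff (two_ne_zero) |>.1 (le_antisymm h4 (sq_nonneg _))

end SubGaussian

/-! ### Tail bounds for sums of independent variables -/

section Tails

variable {Ω : Type*} [MeasurableSpace Ω] {μ : Measure Ω} {n : ℕ} {x : Fin n → Ω → ℝ}

/-- Each factor of the exponential moment is at most `2 ≤ e`, so the product is at most `exp n`;
Markov's inequality at level `2n` leaves `exp(-n)`. -/
theorem measure_sum_gt_le (hx : ∀ i, Measurable (x i)) (hind : iIndepFun x μ) {b : ℝ} (hb : 0 < b)
    (h : ∀ i, ∫⁻ ω, ENNReal.ofReal (Real.exp (x i ω / b)) ∂μ ≤ 2) :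
    μ {ω | 2 * b * n < ∑ i, x i ω} ≤ ENNReal.ofReal (Real.exp (-n)) := by
  have h2 : (2 : ℝ≥0∞) ≤ ENNReal.ofReal (Real.exp 1) := by
    have h2 : (2 : ℝ≥0∞) = ENNReal.ofReal 2 := by simp
    rw [h2]
    exact ENNReal.ofReal_le_ofReal (by have := Real.add_one_le_exp 1; linarith)
  have h3 := lintegral_exp_sum_le (x := fun i ω => x i ω / b) (c := fun _ => 1)
    (fun i => (hx i).div_const b) (hind.comp (fun _ y => y / b) fun _ => by fun_prop)
    (fun i => (h i).trans h2)
  have h4 := measure_lt_le_of_lintegral_exp_le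
    (Finset.measurable_sum _ fun i _ => (hx i).div_const b) h3 (2 * n)
  rw [← ENNReal.ofReal_mul (Real.exp_pos _).le, ← Real.exp_add] at h4
  refine le_trans (measure_mono fun ω hω => ?_) (h4.trans (le_of_eq ?_))
  · simp only [Set.mem_ofPred_eq] at hω ⊢
    rw [← Finset.sum_div, lt_div_iff₀ hb]; linarith
  · congr 2; simp; ring

/-- Nonnegativity makes the lower tail accessible through `E exp(-ax)`, whose second-order term is
controlled by the exponential moment. -/
theorem measure_sum_lt_le [IsProbabilityMeasure μ] (hx : ∀ i, Measurable (x i))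
    (hind : iIndepFun x μ) (hx0 : ∀ i ω, 0 ≤ x i ω) {b : ℝ} (hb : 0 < b)
    (h : ∀ i, ∫⁻ ω, ENNReal.ofReal (Real.exp (x i ω / b)) ∂μ ≤ 2)
    (hmean : ∀ i, ∫ ω, x i ω ∂μ = 1) :
    μ {ω | ∑ i, x i ω < n / 2} ≤ ENNReal.ofReal (Real.exp (-(n / (32 * b ^ 2)))) := by
  -- With `ab² = 1/8`, `E exp(-ax) ≤ 1 - a + 2a²b² = 1 - 3a/4`. Comparing with level `n/2` leaves
  -- the exponent `-an/4 = -n/(32b²)`.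
  set a : ℝ := 1 / (8 * b ^ 2) with ha
  have ha0 : 0 < a := by positivity
  have hab : a * b ^ 2 = 1 / 8 := by rw [ha]; field_simp
  have key : ∀ i, ∫⁻ ω, ENNReal.ofReal (Real.exp (-a * x i ω)) ∂μ
      ≤ ENNReal.ofReal (Real.exp (-(3 / 4 * a))) := fun i => by
    have hxi := hx i
    have hint0 : Integrable (fun ω => Real.exp (x i ω / b)) μ :=
      integrable_of_lintegral_exp_le (by fun_prop) ENNReal.ofNat_ne_top (h i)
    have hI : ∫ ω, Real.exp (x i ω / b) ∂μ ≤ 2 := by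
      have h5 := h i
      rw [← ofReal_integral_eq_lintegral_ofReal hint0
        (ae_of_all _ fun ω => (Real.exp_pos _).le)] at h5
      exact (ENNReal.ofReal_le_ofNat (n := 2)).1 h5
    have hintx : Integrable (x i) μ := by
      refine (hint0.const_mul b).mono' (by fun_prop) (ae_of_all _ fun ω => ?_)
      have h2 := Real.add_one_le_exp (x i ω / b)
      rw [Real.norm_eq_abs, abs_of_nonneg (hx0 i ω)]
      calc x i ω = b * (x i ω / b) := by field_simp
        _ ≤ b * Real.exp (x i ω / b) := by gcongr; linarith
    have hpt : ∀ ω, Real.exp (-a * x i ω)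
        ≤ 1 - a * x i ω + a ^ 2 * b ^ 2 * Real.exp (x i ω / b) := fun ω => by
      have h1 := exp_neg_le_quadratic (mul_nonneg ha0.le (hx0 i ω))
      have h2 := Real.quadratic_le_exp_of_nonneg (div_nonneg (hx0 i ω) hb.le)
      have h3 : (x i ω / b) ^ 2 / 2 ≤ Real.exp (x i ω / b) := by
        have := div_nonneg (hx0 i ω) hb.le; linarith
      have h4 := mul_le_mul_of_nonneg_left h3 (show 0 ≤ a ^ 2 * b ^ 2 by positivity)
      have h5 : a ^ 2 * b ^ 2 * ((x i ω / b) ^ 2 / 2) = (a * x i ω) ^ 2 / 2 := by field_simp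
      rw [neg_mul]
      linarith
    have hint2 : Integrable (fun ω => 1 - a * x i ω) μ :=
      (integrable_const 1).sub (hintx.const_mul a)
    have hint3 : Integrable (fun ω => 1 - a * x i ω + a ^ 2 * b ^ 2 * Real.exp (x i ω / b)) μ :=
      hint2.add (hint0.const_mul _)
    calc ∫⁻ ω, ENNReal.ofReal (Real.exp (-a * x i ω)) ∂μ
        ≤ ∫⁻ ω, ENNReal.ofReal (1 - a * x i ω + a ^ 2 * b ^ 2 * Real.exp (x i ω / b)) ∂μ :=
          lintegral_mono fun ω => ENNReal.ofReal_le_ofReal (hpt ω)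
      _ = ENNReal.ofReal (∫ ω, (1 - a * x i ω + a ^ 2 * b ^ 2 * Real.exp (x i ω / b)) ∂μ) :=
          (ofReal_integral_eq_lintegral_ofReal hint3
            (ae_of_all _ fun ω => (Real.exp_pos _).le.trans (hpt ω))).symm
      _ ≤ ENNReal.ofReal (Real.exp (-(3 / 4 * a))) := by
          refine ENNReal.ofReal_le_ofReal ?_
          rw [integral_add hint2 (hint0.const_mul _),
            integral_sub (integrable_const 1) (hintx.const_mul a), integral_const_mul,
            integral_const_mul, hmean i]
          have h1 := Real.add_one_le_exp (-(3 / 4 * a))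
          have h2 := mul_le_mul_of_nonneg_left hI (show 0 ≤ a ^ 2 * b ^ 2 by positivity)
          have h3 : a ^ 2 * b ^ 2 = a / 8 := by rw [sq, mul_assoc, hab]; ring
          rw [h3] at h2 ⊢
          simp only [integral_const, probReal_univ, smul_eq_mul, mul_one]
          linarith
  have h3 := lintegral_exp_sum_le (x := fun i ω => -a * x i ω)
    (fun i => (hx i).const_mul _) (hind.comp (fun _ y => -a * y) fun _ => by fun_prop) key
  have h4 := measure_lt_le_of_lintegral_exp_le
    (Finset.measurable_sum _ fun i _ => (hx i).const_mul (-a)) h3 (-(a * n / 2))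
  rw [← ENNReal.ofReal_mul (Real.exp_pos _).le, ← Real.exp_add] at h4
  refine le_trans (measure_mono fun ω hω => ?_) (h4.trans (le_of_eq ?_))
  · simp only [Set.mem_ofPred_eq] at hω ⊢
    rw [← Finset.mul_sum]
    nlinarith [mul_lt_mul_of_pos_left hω ha0]
  · congr 2
    simp only [Finset.sum_const, Finset.card_univ, Fintype.card_fin, nsmul_eq_mul]
    rw [ha]; field_simp; ring

end Tails

/-! ### Linear images of the noise -/

section Noise

variable {Ω : Type*} [MeasurableSpace Ω] {μ : Measure Ω} [IsProbabilityMeasure μ]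
  {ι J : Type*} [Fintype ι] [Fintype J]

theorem lintegral_exp_linearComb_le {e : ι → Ω → ℝ} (he : ∀ i, Measurable (e i))
    (hind : iIndepFun e μ) (h0 : ∀ i, ∫ ω, e i ω ∂μ = 0) {s : ℝ} (hs : 0 < s)
    (h : ∀ i, ∫⁻ ω, ENNReal.ofReal (Real.exp (e i ω ^ 2 / s ^ 2)) ∂μ ≤ 2) (u : ι → ℝ) :
    ∫⁻ ω, ENNReal.ofReal (Real.exp (∑ i, u i * e i ω)) ∂μ
      ≤ ENNReal.ofReal (Real.exp (s ^ 2 * ∑ i, u i ^ 2)) := by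
  have h1 := lintegral_exp_sum_le (x := fun i ω => u i * e i ω) (c := fun i => u i ^ 2 * s ^ 2)
    (fun i => (he i).const_mul _) (hind.comp (fun i y => u i * y) fun _ => by fun_prop)
    (fun i => lintegral_exp_mul_le_of_centered (he i) (h0 i) hs (h i) (u i))
  rwa [← Finset.sum_mul, mul_comm] at h1

/-- Each coordinate `Y_j` of the image, divided by its row norm, has a bounded square-exponential
moment. Jensen's inequality with weights proportional to the squared row norms `R_j` merges these
without any independence between coordinates. -/
theorem measure_mulVec_sq_gt_le {e : ι → Ω → ℝ} (he : ∀ i, Measurable (e i))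
    (hind : iIndepFun e μ) (h0 : ∀ i, ∫ ω, e i ω ∂μ = 0) {s : ℝ} (hs : 0 < s)
    (h : ∀ i, ∫⁻ ω, ENNReal.ofReal (Real.exp (e i ω ^ 2 / s ^ 2)) ∂μ ≤ 2)
    (M : Matrix J ι ℝ) (t : ℝ) :
    μ {ω | 16 * s ^ 2 * t * ∑ j, ∑ i, M j i ^ 2 < ∑ j, (∑ i, M j i * e i ω) ^ 2}
      ≤ 2 * ENNReal.ofReal (Real.exp (-t)) := by
  set R : J → ℝ := fun j => ∑ i, M j i ^ 2 with hR
  have hR0 : ∀ j, 0 ≤ R j := fun j => Finset.sum_nonneg fun i _ => sq_nonneg _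
  set Y : J → Ω → ℝ := fun j ω => ∑ i, M j i * e i ω with hY
  have hYm : ∀ j, Measurable (Y j) := fun j => by simp only [hY]; fun_prop
  have hY0 : ∀ j, R j = 0 → ∀ ω, Y j ω = 0 := fun j hj ω => by
    have h1 := (Finset.sum_eq_zero_iff_of_nonneg fun i _ => sq_nonneg (M j i)).1 hj
    refine Finset.sum_eq_zero fun i hi => ?_
    rw [pow_eq_zero_iff two_ne_zero |>.1 (h1 i hi), zero_mul]
  -- The scale gives `8Kw = 1/2`, hence a moment at most `exp(1/2) ≤ 2`. If `R j = 0` the inverse is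
  -- `0` by convention and the exponent vanishes.
  have hone : ∀ j, ∫⁻ ω, ENNReal.ofReal (Real.exp ((16 * s ^ 2 * R j)⁻¹ * Y j ω ^ 2)) ∂μ ≤ 2 :=
    fun j => by
    have hle : 8 * (s ^ 2 * R j) * (16 * s ^ 2 * R j)⁻¹ ≤ 1 / 2 := by
      rcases (hR0 j).eq_or_lt with h1 | h1
      · simp [← h1]
      · apply le_of_eq; field_simp; norm_num
    have h1 := lintegral_exp_sum_mul_sq_le (μ := μ) (J := Unit) (Y := fun _ => Y j)
      (fun _ => hYm j) (K := s ^ 2 * R j) (mul_nonneg (sq_nonneg s) (hR0 j))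
      (fun u => by
        have h2 := lintegral_exp_linearComb_le he hind h0 hs h (fun i => u () * M j i)
        simp only [mul_assoc, ← Finset.mul_sum, mul_pow] at h2
        simpa [hY, hR, mul_assoc, mul_comm, mul_left_comm] using h2)
      (w := fun _ => (16 * s ^ 2 * R j)⁻¹) (fun _ => inv_nonneg.2 (by
        have := hR0 j; positivity)) (fun _ => hle.trans (by norm_num))
    simp only [Finset.univ_unique, Finset.sum_singleton] at h1
    refine h1.trans ?_
    have h2 : (2 : ℝ≥0∞) = ENNReal.ofReal 2 := by simp
    rw [h2]
    refine ENNReal.ofReal_le_ofReal ((Real.exp_le_exp.2 hle).trans ?_)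
    have h3 := exp_mul_le_of_le_one (θ := 1 / 2) (by norm_num) (by norm_num) 1
    have h4 := Real.exp_one_lt_d9
    rw [mul_one] at h3
    linarith
  rcases (Finset.sum_nonneg fun j _ => hR0 j : 0 ≤ ∑ j, R j).eq_or_lt with hz | hpos
  · have h1 := (Finset.sum_eq_zero_iff_of_nonneg fun j _ => hR0 j).1 hz.symm
    have h2 : ∀ ω, ∑ j, Y j ω ^ 2 = 0 := fun ω =>
      Finset.sum_eq_zero fun j hj => by rw [hY0 j (h1 j hj) ω]; simp
    simp only [hY] at h2
    simp only [← hz, h2]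
    simp
  · have h1 := lintegral_exp_convexComb_le (μ := μ) (w := fun j => R j / ∑ j, R j)
      (q := fun j ω => (16 * s ^ 2 * R j)⁻¹ * Y j ω ^ 2)
      (fun j => by have := hYm j; fun_prop) (fun j => div_nonneg (hR0 j) hpos.le)
      (by rw [← Finset.sum_div, div_self hpos.ne']) hone
    have h2 := measure_lt_le_of_lintegral_exp_le
      (Finset.measurable_sum _ fun j _ => by have := hYm j; fun_prop) h1 t
    refine le_trans (measure_mono fun ω hω => ?_) h2
    simp only [Set.mem_ofPred_eq] at hω ⊢
    have h3 : ∑ j, R j / (∑ j, R j) * ((16 * s ^ 2 * R j)⁻¹ * Y j ω ^ 2)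
        = (∑ j, Y j ω ^ 2) / (16 * s ^ 2 * ∑ j, R j) := by
      rw [Finset.sum_div]
      refine Finset.sum_congr rfl fun j _ => ?_
      rcases (hR0 j).eq_or_lt with h4 | h4
      · rw [hY0 j h4.symm ω]; simp
      · field_simp
    rw [h3, lt_div_iff₀ (by positivity)]
    linarith

/-- The bound of `measure_mulVec_sq_gt_le` for a matrix that depends measurably on a variable
independent of the noise. -/
theorem measure_random_mulVec_sq_gt_le {β : Type*} [MeasurableSpace β] {Φ : Ω → β}
    (hΦ : Measurable Φ) {e : Ω → ι → ℝ} (he : ∀ i, Measurable fun ω => e ω i)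
    (hΦe : IndepFun Φ e μ) (hind : iIndepFun (fun i ω => e ω i) μ)
    (h0 : ∀ i, ∫ ω, e ω i ∂μ = 0) {s : ℝ} (hs : 0 < s)
    (h : ∀ i, ∫⁻ ω, ENNReal.ofReal (Real.exp (e ω i ^ 2 / s ^ 2)) ∂μ ≤ 2)
    {M : β → Matrix J ι ℝ} (hM : ∀ j i, Measurable fun b => M b j i) (t : ℝ) :
    μ {ω | 16 * s ^ 2 * t * ∑ j, ∑ i, M (Φ ω) j i ^ 2 < ∑ j, (∑ i, M (Φ ω) j i * e ω i) ^ 2}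
      ≤ 2 * ENNReal.ofReal (Real.exp (-t)) := by
  have hem : Measurable e := measurable_pi_iff.2 he
  set S : Set (β × (ι → ℝ)) :=
    {z | 16 * s ^ 2 * t * ∑ j, ∑ i, M z.1 j i ^ 2 < ∑ j, (∑ i, M z.1 j i * z.2 i) ^ 2} with hS
  have hSm : MeasurableSet S := by
    have hM' : ∀ j i, Measurable fun z : β × (ι → ℝ) => M z.1 j i :=
      fun j i => (hM j i).comp measurable_fst
    refine measurableSet_lt ?_ ?_
    · fun_prop
    · fun_prop
  have hmap := hΦe.map_prod_eq_prod_map_map hΦ.aemeasurable hem.aemeasurable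
  have h1 : μ {ω | 16 * s ^ 2 * t * ∑ j, ∑ i, M (Φ ω) j i ^ 2
      < ∑ j, (∑ i, M (Φ ω) j i * e ω i) ^ 2} = (μ.map fun ω => (Φ ω, e ω)) S := by
    rw [Measure.map_apply (hΦ.prodMk hem) hSm]; rfl
  have : IsProbabilityMeasure (μ.map Φ) := Measure.isProbabilityMeasure_map hΦ.aemeasurable
  have : IsProbabilityMeasure (μ.map e) := Measure.isProbabilityMeasure_map hem.aemeasurable
  -- By independence the joint law is a product, so the fixed-matrix bound applies to each section.
  rw [h1, hmap, Measure.prod_apply hSm]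
  calc ∫⁻ b, (μ.map e) (Prod.mk b ⁻¹' S) ∂(μ.map Φ)
      ≤ ∫⁻ _b, 2 * ENNReal.ofReal (Real.exp (-t)) ∂(μ.map Φ) := by
        refine lintegral_mono fun b => ?_
        rw [Measure.map_apply hem (measurable_prodMk_left hSm)]
        exact measure_mulVec_sq_gt_le (e := fun i ω => e ω i) he hind h0 hs h (M b) t
    _ = 2 * ENNReal.ofReal (Real.exp (-t)) := by simp

end Noise

/-! ### Nets of the unit ball -/

section Nets

variable {E : Type*} [NormedAddCommGroup E] [NormedSpace ℝ E]

variable (E) in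
-- A 1-separated subset of the ball of radius 2 of maximal cardinality is a 1-net there, since any
-- uncovered point could be added; halving it gives the net. A separation bound controls its size.
theorem exists_half_net [FiniteDimensional ℝ E] : ∃ F : Finset E, F.card ≤ 5 ^ Module.finrank ℝ E ∧ (∀ x ∈ F, ‖x‖ ≤ 1) ∧
    ∀ u : E, ‖u‖ ≤ 1 → ∃ x ∈ F, ‖u - x‖ ≤ 1 / 2 := by
  classical
  let P : Finset E → Prop := fun s =>
    (∀ c ∈ s, ‖c‖ ≤ 2) ∧ ∀ c ∈ s, ∀ d ∈ s, c ≠ d → 1 ≤ ‖c - d‖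
  let cards : Set ℕ := {m | ∃ s, P s ∧ s.card = m}
  have hne : cards.Nonempty := ⟨0, ∅, by simp [P], by simp⟩
  have hbdd : BddAbove cards := ⟨5 ^ Module.finrank ℝ E, by
    rintro m ⟨s, hs, rfl⟩
    exact Besicovitch.card_le_of_separated s hs.1 hs.2⟩
  obtain ⟨s, hs, hcard⟩ := Nat.sSup_mem hne hbdd
  refine ⟨s.image fun c => (1 / 2 : ℝ) • c, ?_, ?_, ?_⟩
  · exact Finset.card_image_le.trans (Besicovitch.card_le_of_separated s hs.1 hs.2)
  · intro x hx
    obtain ⟨c, hc, rfl⟩ := Finset.mem_image.1 hx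
    rw [norm_smul]
    have := hs.1 c hc
    norm_num
    linarith
  · intro u hu
    by_contra! hcon
    have hfar : ∀ c ∈ s, 1 < ‖(2 : ℝ) • u - c‖ := fun c hc => by
      have h1 := hcon _ (Finset.mem_image_of_mem _ hc)
      have h2 : (2 : ℝ) • u - c = (2 : ℝ) • (u - (1 / 2 : ℝ) • c) := by
        rw [smul_sub, smul_smul]; norm_num
      rw [h2, norm_smul]
      norm_num
      norm_num at h1
      linarith
    have hnot : (2 : ℝ) • u ∉ s := fun hmem => by
      have := hfar _ hmem
      simp at this
      linarith
    have hP : P (insert ((2 : ℝ) • u) s) := by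
      refine ⟨fun c hc => ?_, fun c hc d hd hcd => ?_⟩
      · rcases Finset.mem_insert.1 hc with rfl | hc
        · rw [norm_smul]; norm_num; exact hu
        · exact hs.1 c hc
      · rcases Finset.mem_insert.1 hc with rfl | hc <;> rcases Finset.mem_insert.1 hd with rfl | hd
        · exact absurd rfl hcd
        · exact (hfar d hd).le
        · rw [norm_sub_rev]; exact (hfar c hc).le
        · exact hs.2 c hc d hd hcd
    have hle := le_csSup hbdd ⟨_, hP, rfl⟩
    rw [Finset.card_insert_of_notMem hnot, hcard] at hle
    omega

variable (E) in
-- The residual after a half-net approximation, doubled, lies in the unit ball again. Each round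
-- halves the error and multiplies the size by at most `5^d`, with `d` the dimension.
theorem exists_net [FiniteDimensional ℝ E] (m : ℕ) : ∃ F : Finset E, F.card ≤ 5 ^ (m * Module.finrank ℝ E) ∧
    ∀ u : E, ‖u‖ ≤ 1 → ∃ x ∈ F, ‖u - x‖ ≤ (1 / 2) ^ m := by
  classical
  induction m with
  | zero => exact ⟨{0}, by simp, fun u hu => ⟨0, by simp, by simpa using hu⟩⟩
  | succ m ih =>
    obtain ⟨F, hF, hnet⟩ := ih
    obtain ⟨G, hG, -, hnetG⟩ := exists_half_net E
    refine ⟨Finset.image₂ (fun x y => x + (1 / 2 : ℝ) • y) G F, ?_, fun u hu => ?_⟩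
    · refine (Finset.card_image₂_le _ _ _).trans ?_
      rw [Nat.succ_mul, pow_add, mul_comm]
      exact Nat.mul_le_mul hF hG
    · obtain ⟨x, hx, hux⟩ := hnetG u hu
      obtain ⟨y, hy, huy⟩ := hnet ((2 : ℝ) • (u - x)) (by
        rw [norm_smul]; norm_num; norm_num at hux; linarith)
      refine ⟨_, Finset.mem_image₂_of_mem hx hy, ?_⟩
      have h2 : u - (x + (1 / 2 : ℝ) • y) = (1 / 2 : ℝ) • ((2 : ℝ) • (u - x) - y) := by
        rw [smul_sub (1 / 2 : ℝ), smul_smul]; norm_num; abel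
      rw [h2, norm_smul, pow_succ']
      norm_num at huy ⊢
      exact huy

theorem norm_apply_le_of_net {G : Type*} [NormedAddCommGroup G] [NormedSpace ℝ G] {F : Finset E}
    (hF : ∀ u : E, ‖u‖ ≤ 1 → ∃ x ∈ F, ‖u - x‖ ≤ 1 / 2) (N : E →L[ℝ] G) {c : ℝ} (hc0 : 0 ≤ c)
    (hc : ∀ x ∈ F, ‖N x‖ ≤ c) (v : E) : ‖N v‖ ≤ 2 * c * ‖v‖ := by
  have h1 : ‖N‖ ≤ c + ‖N‖ / 2 := by
    refine ContinuousLinearMap.opNorm_le_of_unit_norm (by positivity) fun u hu => ?_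
    obtain ⟨x, hx, hux⟩ := hF u hu.le
    calc ‖N u‖ = ‖N x + N (u - x)‖ := by rw [← map_add]; congr 2; abel
      _ ≤ ‖N x‖ + ‖N (u - x)‖ := norm_add_le _ _
      _ ≤ c + ‖N‖ * (1 / 2) := by
        gcongr
        · exact hc x hx
        · exact (N.le_opNorm _).trans (by gcongr)
      _ = c + ‖N‖ / 2 := by ring
  calc ‖N v‖ ≤ ‖N‖ * ‖v‖ := N.le_opNorm v
    _ ≤ 2 * c * ‖v‖ := by gcongr; linarith

end Nets

/-! ### Isotropic sub-gaussian rows -/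

/-- The rows of `Z` are independent, centered, isotropic, and `E exp(⟨u, zᵢ⟩² / s²) ≤ 2` for `u` in
the unit ball. -/
structure IsoRows {Ω : Type*} [MeasurableSpace Ω] (μ : Measure Ω) {n : ℕ} {J : Type*} [Fintype J]
    [DecidableEq J] (Z : Ω → Fin n → J → ℝ) (s : ℝ) : Prop where
  meas : ∀ i j, Measurable fun ω => Z ω i j
  indep : iIndepFun (fun i ω => Z ω i) μ
  centered : ∀ i j, ∫ ω, Z ω i j ∂μ = 0
  cov : ∀ i j j', ∫ ω, Z ω i j * Z ω i j' ∂μ = if j = j' then 1 else 0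
  pos : 0 < s
  subgaussian : ∀ i (u : J → ℝ), u ⬝ᵥ u ≤ 1 →
    ∫⁻ ω, ENNReal.ofReal (Real.exp ((u ⬝ᵥ Z ω i) ^ 2 / s ^ 2)) ∂μ ≤ 2

namespace IsoRows

variable {Ω : Type*} [MeasurableSpace Ω] {μ : Measure Ω} {n : ℕ}
  {J : Type*} [Fintype J] [DecidableEq J] {Z : Ω → Fin n → J → ℝ} {s : ℝ}

theorem restrict (h : IsoRows μ Z s) (P : J → Prop) [DecidablePred P] :
    IsoRows μ (fun ω i (j : {j // P j}) => Z ω i j) s where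
  meas i j := h.meas i j
  indep := h.indep.comp (fun _ z (j : {j // P j}) => z j) fun _ => by fun_prop
  centered i j := h.centered i j
  cov i j j' := by simpa [Subtype.ext_iff] using h.cov i j j'
  pos := h.pos
  subgaussian i u hu := by
    have key : ∀ z : J → ℝ, (fun j => if hj : P j then u ⟨j, hj⟩ else 0) ⬝ᵥ z
        = u ⬝ᵥ fun j : {j // P j} => z j := fun z => by
      simp only [dotProduct]
      rw [← Fintype.sum_subtype_add_sum_subtype P, Finset.sum_eq_zero (s := Finset.univ)
        (f := fun j : {j // ¬ P j} => _)]
      · simp only [add_zero]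
        exact Finset.sum_congr rfl fun j _ => by rw [dif_pos j.2]
      · intro j _; rw [dif_neg j.2, zero_mul]
    have h2 := h.subgaussian i (fun j => if hj : P j then u ⟨j, hj⟩ else 0) (by
      rw [key]
      refine le_trans (le_of_eq ?_) hu
      congr 1
      funext j
      rw [dif_pos j.2])
    simpa only [key] using h2

/-- The covariance condition forces it: the Bochner integral of a non-integrable function is 0,
whereas the second moment is 1. -/
theorem integrable_sq (h : IsoRows μ Z s) (i : Fin n) (j : J) :
    Integrable (fun ω => Z ω i j ^ 2) μ := by
  by_contra hcon
  have h1 := h.cov i j j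
  simp only [← sq] at h1
  rw [integral_undef hcon] at h1
  simp at h1

theorem integrable_mul (h : IsoRows μ Z s) (i : Fin n) (j j' : J) :
    Integrable (fun ω => Z ω i j * Z ω i j') μ := by
  have h1 := h.meas i j
  have h2 := h.meas i j'
  refine ((h.integrable_sq i j).add (h.integrable_sq i j')).mono' (by fun_prop)
    (ae_of_all _ fun ω => ?_)
  rw [Real.norm_eq_abs, Pi.add_apply, abs_le]
  constructor <;> nlinarith [sq_nonneg (Z ω i j + Z ω i j'), sq_nonneg (Z ω i j - Z ω i j'),
    sq_nonneg (Z ω i j), sq_nonneg (Z ω i j')]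

theorem integral_dotProduct_sq (h : IsoRows μ Z s) (i : Fin n) (u : J → ℝ) :
    ∫ ω, (u ⬝ᵥ Z ω i) ^ 2 ∂μ = u ⬝ᵥ u := by
  have h1 : ∀ ω, (u ⬝ᵥ Z ω i) ^ 2 = ∑ j, ∑ j', (u j * u j') * (Z ω i j * Z ω i j') := fun ω => by
    rw [sq, dotProduct, Finset.sum_mul_sum]
    exact Finset.sum_congr rfl fun j _ => Finset.sum_congr rfl fun j' _ => by ring
  simp only [h1]
  rw [integral_finsetSum _ fun j _ => integrable_finsetSum _ fun j' _ =>
    (h.integrable_mul i j j').const_mul _]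
  refine Finset.sum_congr rfl fun j _ => ?_
  rw [integral_finsetSum _ fun j' _ => (h.integrable_mul i j j').const_mul _]
  simp only [integral_const_mul, h.cov]
  simp

/-- Weighted sums of squares of a row, normalized by the total weight. -/
theorem lintegral_exp_weighted_sq (h : IsoRows μ Z s) (i : Fin n) {w : J → ℝ}
    (hw : ∀ j, 0 ≤ w j) (hpos : 0 < ∑ j, w j) :
    ∫⁻ ω, ENNReal.ofReal (Real.exp ((∑ j, w j * Z ω i j ^ 2) / (∑ j, w j) / s ^ 2)) ∂μ ≤ 2 := by
  have h1 := lintegral_exp_convexComb_le (μ := μ) (w := fun j => w j / ∑ j, w j)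
    (q := fun j ω => Z ω i j ^ 2 / s ^ 2) (fun j => by have := h.meas i j; fun_prop)
    (fun j => div_nonneg (hw j) hpos.le) (by rw [← Finset.sum_div, div_self hpos.ne'])
    (fun j => by
      have := h.subgaussian i (Pi.single j 1) (by simp)
      simpa using this)
  refine le_of_eq_of_le (lintegral_congr fun ω => ?_) h1
  rw [Finset.sum_div, Finset.sum_div]
  congr 2
  exact Finset.sum_congr rfl fun j _ => by ring

theorem integral_weighted_sq (h : IsoRows μ Z s) (i : Fin n) {w : J → ℝ}
    (hpos : 0 < ∑ j, w j) :
    ∫ ω, (∑ j, w j * Z ω i j ^ 2) / (∑ j, w j) ∂μ = 1 := by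
  rw [integral_div, integral_finsetSum _ fun j _ => (h.integrable_sq i j).const_mul _]
  have h1 : ∀ j, ∫ ω, w j * Z ω i j ^ 2 ∂μ = w j := fun j => by
    have := h.cov i j j
    simp only [← sq, if_true] at this
    rw [integral_const_mul, this, mul_one]
  simp only [h1]
  exact div_self hpos.ne'

theorem indep_comp (h : IsoRows μ Z s) {f : (J → ℝ) → ℝ} (hf : Measurable f) :
    iIndepFun (fun i ω => f (Z ω i)) μ :=
  h.indep.comp (fun _ => f) fun _ => hf

theorem measure_weighted_sq_gt (h : IsoRows μ Z s) {w : J → ℝ} (hw : ∀ j, 0 ≤ w j) :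
    μ {ω | 2 * s ^ 2 * n * ∑ j, w j < ∑ i, ∑ j, w j * Z ω i j ^ 2}
      ≤ ENNReal.ofReal (Real.exp (-n)) := by
  rcases (Finset.sum_nonneg fun j _ => hw j : 0 ≤ ∑ j, w j).eq_or_lt with h0 | h0
  · have h1 := (Finset.sum_eq_zero_iff_of_nonneg fun j _ => hw j).1 h0.symm
    simp only [fun j => h1 j (Finset.mem_univ j)]
    simp
  have h1 := measure_sum_gt_le (μ := μ) (x := fun i ω => (∑ j, w j * Z ω i j ^ 2) / ∑ j, w j)
    (fun i => by have := h.meas i; fun_prop)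
    (h.indep_comp (f := fun z => (∑ j, w j * z j ^ 2) / ∑ j, w j) (by fun_prop))
    (pow_pos h.pos 2) (fun i => h.lintegral_exp_weighted_sq i hw h0)
  refine le_trans (measure_mono fun ω hω => ?_) h1
  simp only [Set.mem_ofPred_eq] at hω ⊢
  rwa [← Finset.sum_div, lt_div_iff₀ h0]

variable [IsProbabilityMeasure μ]

theorem integrable_entry (h : IsoRows μ Z s) (i : Fin n) (j : J) :
    Integrable (fun ω => Z ω i j) μ := by
  have h1 := h.meas i j
  refine ((integrable_const (1 : ℝ)).add (h.integrable_sq i j)).mono' (by fun_prop)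
    (ae_of_all _ fun ω => ?_)
  rw [Real.norm_eq_abs, Pi.add_apply, abs_le]
  constructor <;> nlinarith [sq_nonneg (Z ω i j + 1), sq_nonneg (Z ω i j - 1)]

theorem integral_dotProduct (h : IsoRows μ Z s) (i : Fin n) (u : J → ℝ) :
    ∫ ω, u ⬝ᵥ Z ω i ∂μ = 0 := by
  simp only [dotProduct]
  rw [integral_finsetSum _ fun j _ => (h.integrable_entry i j).const_mul _]
  exact Finset.sum_eq_zero fun j _ => by rw [integral_const_mul, h.centered, mul_zero]

theorem lintegral_exp_dotProduct_sq (h : IsoRows μ Z s) (i : Fin n) (u : J → ℝ) :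
    ∫⁻ ω, ENNReal.ofReal (Real.exp ((u ⬝ᵥ Z ω i) ^ 2 / (u ⬝ᵥ u) / s ^ 2)) ∂μ ≤ 2 := by
  rcases (dotProduct_self_nonneg' u).eq_or_lt with h0 | h0
  · simp [← h0]
  have hsq : 0 < √(u ⬝ᵥ u) := Real.sqrt_pos.2 h0
  have h1 := h.subgaussian i ((√(u ⬝ᵥ u))⁻¹ • u) (by
    rw [smul_dotProduct, dotProduct_smul, smul_eq_mul, smul_eq_mul, ← mul_assoc, ← mul_inv,
      Real.mul_self_sqrt h0.le, inv_mul_cancel₀ h0.ne'])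
  refine le_of_eq_of_le (lintegral_congr fun ω => ?_) h1
  rw [smul_dotProduct, smul_eq_mul, mul_pow, inv_pow, Real.sq_sqrt h0.le]
  ring_nf

theorem measure_weighted_sq_lt (h : IsoRows μ Z s) {w : J → ℝ} (hw : ∀ j, 0 ≤ w j) :
    μ {ω | ∑ i, ∑ j, w j * Z ω i j ^ 2 < n / 2 * ∑ j, w j}
      ≤ ENNReal.ofReal (Real.exp (-(n / (32 * s ^ 4)))) := by
  rcases (Finset.sum_nonneg fun j _ => hw j : 0 ≤ ∑ j, w j).eq_or_lt with h0 | h0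
  · have h1 := (Finset.sum_eq_zero_iff_of_nonneg fun j _ => hw j).1 h0.symm
    simp only [fun j => h1 j (Finset.mem_univ j)]
    simp
  have h1 := measure_sum_lt_le (μ := μ) (x := fun i ω => (∑ j, w j * Z ω i j ^ 2) / ∑ j, w j)
    (fun i => by have := h.meas i; fun_prop)
    (h.indep_comp (f := fun z => (∑ j, w j * z j ^ 2) / ∑ j, w j) (by fun_prop))
    (fun i ω => div_nonneg (Finset.sum_nonneg fun j _ => mul_nonneg (hw j) (sq_nonneg _)) h0.le)
    (pow_pos h.pos 2) (fun i => h.lintegral_exp_weighted_sq i hw h0)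
    (fun i => h.integral_weighted_sq i h0)
  rw [← pow_mul] at h1
  refine le_trans (measure_mono fun ω hω => ?_) h1
  simp only [Set.mem_ofPred_eq] at hω ⊢
  rwa [← Finset.sum_div, div_lt_iff₀ h0]

theorem measure_mulVec_sq_gt (h : IsoRows μ Z s) (u : J → ℝ) :
    μ {ω | 2 * s ^ 2 * n * (u ⬝ᵥ u) < ∑ i, (u ⬝ᵥ Z ω i) ^ 2}
      ≤ ENNReal.ofReal (Real.exp (-n)) := by
  rcases (dotProduct_self_nonneg' u).eq_or_lt with h0 | h0
  · have hu : u = 0 := dotProduct_self_eq_zero.1 h0.symm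
    simp [hu]
  have h1 := measure_sum_gt_le (μ := μ) (x := fun i ω => (u ⬝ᵥ Z ω i) ^ 2 / (u ⬝ᵥ u))
    (fun i => by have := h.meas i; simp only [dotProduct]; fun_prop)
    (h.indep_comp (f := fun z => (u ⬝ᵥ z) ^ 2 / (u ⬝ᵥ u)) (by simp only [dotProduct]; fun_prop))
    (pow_pos h.pos 2) (fun i => h.lintegral_exp_dotProduct_sq i u)
  refine le_trans (measure_mono fun ω hω => ?_) h1
  simp only [Set.mem_ofPred_eq] at hω ⊢
  rwa [← Finset.sum_div, lt_div_iff₀ h0]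

theorem measure_mulVec_sq_lt (h : IsoRows μ Z s) (u : J → ℝ) :
    μ {ω | ∑ i, (u ⬝ᵥ Z ω i) ^ 2 < n / 2 * (u ⬝ᵥ u)}
      ≤ ENNReal.ofReal (Real.exp (-(n / (32 * s ^ 4)))) := by
  rcases (dotProduct_self_nonneg' u).eq_or_lt with h0 | h0
  · have hu : u = 0 := dotProduct_self_eq_zero.1 h0.symm
    simp [hu]
  have h1 := measure_sum_lt_le (μ := μ) (x := fun i ω => (u ⬝ᵥ Z ω i) ^ 2 / (u ⬝ᵥ u))
    (fun i => by have := h.meas i; simp only [dotProduct]; fun_prop)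
    (h.indep_comp (f := fun z => (u ⬝ᵥ z) ^ 2 / (u ⬝ᵥ u)) (by simp only [dotProduct]; fun_prop))
    (fun i ω => div_nonneg (sq_nonneg _) h0.le)
    (pow_pos h.pos 2) (fun i => h.lintegral_exp_dotProduct_sq i u)
    (fun i => by rw [integral_div, h.integral_dotProduct_sq, div_self h0.ne'])
  rw [← pow_mul] at h1
  refine le_trans (measure_mono fun ω hω => ?_) h1
  simp only [Set.mem_ofPred_eq] at hω ⊢
  rwa [← Finset.sum_div, div_lt_iff₀ h0]

end IsoRows

/-! ### Bounds for isotropic rows uniform over all directions -/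

namespace IsoRows

variable {Ω : Type*} [MeasurableSpace Ω] {μ : Measure Ω} [IsProbabilityMeasure μ] {n : ℕ}
  {J : Type*} [Fintype J] [DecidableEq J] {Z : Ω → Fin n → J → ℝ} {s : ℝ}

/-- For `|v| ≤ 1` the vector `Zᵀv` is jointly sub-gaussian although the coordinates within a row may
be dependent: `⟨u, Zᵀv⟩` is a combination of the independent variables `⟨u, z_i⟩`. This is the input
for Gaussian linearization. -/
theorem lintegral_exp_bilinear_le (h : IsoRows μ Z s) {v : Fin n → ℝ} (hv : ∑ i, v i ^ 2 ≤ 1)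
    (u : J → ℝ) :
    ∫⁻ ω, ENNReal.ofReal (Real.exp (∑ j, u j * ∑ i, v i * Z ω i j)) ∂μ
      ≤ ENNReal.ofReal (Real.exp (s ^ 2 * ∑ j, u j ^ 2)) := by
  have hswap : ∀ ω, ∑ j, u j * ∑ i, v i * Z ω i j = ∑ i, v i * (u ⬝ᵥ Z ω i) := fun ω => by
    simp only [dotProduct, Finset.mul_sum]
    rw [Finset.sum_comm]
    exact Finset.sum_congr rfl fun i _ => Finset.sum_congr rfl fun j _ => by ring
  simp only [hswap]
  have huu : ∑ j, u j ^ 2 = u ⬝ᵥ u := Finset.sum_congr rfl fun j _ => sq (u j)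
  rcases (dotProduct_self_nonneg' u).eq_or_lt with h0 | h0
  · have hu : u = 0 := dotProduct_self_eq_zero.1 h0.symm
    simp [hu]
  have hsq : 0 < √(u ⬝ᵥ u) := Real.sqrt_pos.2 h0
  have h1 := lintegral_exp_linearComb_le (μ := μ) (e := fun i ω => u ⬝ᵥ Z ω i)
    (fun i => by have := h.meas i; simp only [dotProduct]; fun_prop)
    (h.indep_comp (f := fun z => u ⬝ᵥ z) (by simp only [dotProduct]; fun_prop))
    (fun i => h.integral_dotProduct i u) (s := s * √(u ⬝ᵥ u)) (mul_pos h.pos hsq)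
    (fun i => by
      refine le_of_eq_of_le (lintegral_congr fun ω => ?_) (h.lintegral_exp_dotProduct_sq i u)
      rw [mul_pow, Real.sq_sqrt h0.le, div_div, mul_comm (s ^ 2)]) v
  refine h1.trans (ENNReal.ofReal_le_ofReal (Real.exp_le_exp.2 ?_))
  rw [mul_pow, Real.sq_sqrt h0.le, huu]
  have h2 : 0 ≤ s ^ 2 * (u ⬝ᵥ u) := by positivity
  nlinarith [mul_le_mul_of_nonneg_left hv h2]

theorem measure_weighted_form_gt (h : IsoRows μ Z s) {w : J → ℝ} (hw : ∀ j, 0 ≤ w j) {b : ℝ}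
    (hb : 0 < b) (hwb : ∀ j, w j ≤ b) {v : Fin n → ℝ} (hv : ∑ i, v i ^ 2 ≤ 1) :
    μ {ω | 8 * s ^ 2 * (∑ j, w j + 4 * n * b) < ∑ j, w j * (∑ i, v i * Z ω i j) ^ 2}
      ≤ ENNReal.ofReal (Real.exp (-(4 * n))) := by
  have hs := h.pos
  -- Scaling the weights by `8s²b` meets `8Kw ≤ 1` and gives the moment bound `exp(∑w/b)`. Markov's
  -- inequality at `∑w/b + 4n` leaves `exp(-4n)`.
  have h1 := lintegral_exp_sum_mul_sq_le (μ := μ) (Y := fun j ω => ∑ i, v i * Z ω i j)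
    (fun j => by have := fun i => h.meas i j; fun_prop) (sq_nonneg s)
    (h.lintegral_exp_bilinear_le hv) (w := fun j => w j / (8 * s ^ 2 * b))
    (fun j => div_nonneg (hw j) (by positivity))
    (fun j => by
      have h2 : 8 * s ^ 2 * (w j / (8 * s ^ 2 * b)) = w j / b := by field_simp
      rw [h2]; exact (div_le_one hb).2 (hwb j))
  have h2 := measure_lt_le_of_lintegral_exp_le
    (Finset.measurable_sum _ fun j _ => by have := fun i => h.meas i j; fun_prop) h1
    ((∑ j, w j) / b + 4 * n)
  rw [← ENNReal.ofReal_mul (Real.exp_pos _).le, ← Real.exp_add] at h2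
  refine le_trans (measure_mono fun ω hω => ?_) (h2.trans (le_of_eq ?_))
  · simp only [Set.mem_ofPred_eq] at hω ⊢
    have h3 : ∑ j, w j / (8 * s ^ 2 * b) * (∑ i, v i * Z ω i j) ^ 2
        = (∑ j, w j * (∑ i, v i * Z ω i j) ^ 2) / (8 * s ^ 2 * b) := by
      rw [Finset.sum_div]
      exact Finset.sum_congr rfl fun j _ => by ring
    rw [h3, lt_div_iff₀ (by positivity)]
    refine lt_of_eq_of_lt ?_ hω
    field_simp
  · congr 2
    rw [← Finset.sum_div]
    field_simp
    ring

/-- Uniform bound on the quadratic forms `∑ⱼ wⱼ ⟨v, Z_{·j}⟩²`. -/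
theorem measure_exists_form_gt (h : IsoRows μ Z s) {w : J → ℝ} (hw : ∀ j, 0 ≤ w j) {b : ℝ}
    (hb : 0 < b) (hwb : ∀ j, w j ≤ b) :
    μ {ω | ∃ v : Fin n → ℝ, 128 * s ^ 2 * (∑ j, w j + n * b) * (v ⬝ᵥ v)
        < ∑ j, w j * (∑ i, v i * Z ω i j) ^ 2}
      ≤ ENNReal.ofReal (Real.exp (-n)) := by
  have hs := h.pos
  obtain ⟨F, hcard, hF1, hnet⟩ := exists_half_net (EuclideanSpace ℝ (Fin n))
  rw [finrank_euclideanSpace, Fintype.card_fin] at hcard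
  have hSw : 0 ≤ ∑ j, w j := Finset.sum_nonneg fun j _ => hw j
  set U : ℝ := 8 * s ^ 2 * (∑ j, w j + 4 * n * b) with hU
  have hU0 : 0 ≤ U := by positivity
  have hsub : {ω | ∃ v : Fin n → ℝ, 128 * s ^ 2 * (∑ j, w j + n * b) * (v ⬝ᵥ v)
        < ∑ j, w j * (∑ i, v i * Z ω i j) ^ 2}
      ⊆ ⋃ x ∈ F, {ω | U < ∑ j, w j * (∑ i, x i * Z ω i j) ^ 2} := by
    rintro ω ⟨v, hv⟩
    by_contra hcon
    simp only [Set.mem_iUnion, Set.mem_ofPred_eq, not_exists, not_lt] at hcon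
    let B : Matrix J (Fin n) ℝ := Matrix.of fun j i => √(w j) * Z ω i j
    let N := LinearMap.toContinuousLinearMap (Matrix.toEuclideanLin B)
    have hN : ∀ x : EuclideanSpace ℝ (Fin n),
        ‖N x‖ ^ 2 = ∑ j, w j * (∑ i, x i * Z ω i j) ^ 2 := fun x => by
      rw [EuclideanSpace.norm_sq_eq]
      refine Finset.sum_congr rfl fun j _ => ?_
      have h1 : (N x) j = √(w j) * ∑ i, x i * Z ω i j := by
        simp only [N, B, LinearMap.coe_toContinuousLinearMap', Matrix.toLpLin_apply, Matrix.mulVec,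
          dotProduct, Matrix.of_apply, Finset.mul_sum]
        exact Finset.sum_congr rfl fun i _ => by ring
      rw [h1, Real.norm_eq_abs, sq_abs, mul_pow, Real.sq_sqrt (hw j)]
    have h1 := norm_apply_le_of_net hnet N (c := √U) (Real.sqrt_nonneg _) (fun x hx => by
      rw [← Real.sqrt_sq (norm_nonneg (N x)), hN]
      exact Real.sqrt_le_sqrt (hcon x hx)) (WithLp.toLp 2 v)
    have h2 : ‖N (WithLp.toLp 2 v)‖ ^ 2 ≤ (2 * √U * ‖WithLp.toLp 2 v‖) ^ 2 :=
      pow_le_pow_left₀ (norm_nonneg _) h1 2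
    rw [hN, mul_pow, mul_pow, Real.sq_sqrt hU0, EuclideanSpace.norm_sq_eq] at h2
    have h3 : ∑ i, ‖(WithLp.toLp 2 v : EuclideanSpace ℝ (Fin n)) i‖ ^ 2 = v ⬝ᵥ v := by
      simp [dotProduct, sq]
    rw [h3] at h2
    -- Passing from the half-net to all vectors doubles the norm, hence quadruples the form.
    have h4 : 4 * U ≤ 128 * s ^ 2 * (∑ j, w j + n * b) := by
      have : 0 ≤ s ^ 2 * ∑ j, w j := by positivity
      rw [hU]; linarith
    have h5 := mul_le_mul_of_nonneg_right h4 (dotProduct_self_nonneg' v)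
    norm_num at h2
    linarith
  refine (measure_mono hsub).trans ((measure_biUnion_finset_le _ _).trans ?_)
  calc ∑ x ∈ F, μ {ω | U < ∑ j, w j * (∑ i, x i * Z ω i j) ^ 2}
      ≤ ∑ _x ∈ F, ENNReal.ofReal (Real.exp (-(4 * n))) := by
        refine Finset.sum_le_sum fun x hx => ?_
        refine h.measure_weighted_form_gt hw hb hwb ?_
        have h1 := hF1 x hx
        have h2 := EuclideanSpace.norm_sq_eq x
        simp only [Real.norm_eq_abs, sq_abs] at h2
        rw [← h2]
        exact pow_le_one₀ (norm_nonneg _) h1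
    _ = ENNReal.ofReal (F.card * Real.exp (-(4 * n))) := by
        rw [Finset.sum_const, nsmul_eq_mul, ENNReal.ofReal_mul (by positivity),
          ENNReal.ofReal_natCast]
    _ ≤ ENNReal.ofReal (Real.exp (-n)) := by
        refine ENNReal.ofReal_le_ofReal ?_
        have h1 : (F.card : ℝ) ≤ 5 ^ n := by exact_mod_cast hcard
        -- The net has at most `5^n ≤ exp(3n)` points, which `exp(-4n)` pays for.
        have h2 : (5 : ℝ) ≤ Real.exp 3 := by
          have := Real.quadratic_le_exp_of_nonneg (show (0 : ℝ) ≤ 3 by norm_num); linarith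
        calc (F.card : ℝ) * Real.exp (-(4 * n)) ≤ (Real.exp 3) ^ n * Real.exp (-(4 * n)) := by
              gcongr
              exact h1.trans (pow_le_pow_left₀ (by norm_num) h2 n)
          _ = Real.exp (-n) := by
              rw [← Real.exp_nat_mul, ← Real.exp_add]; congr 1; ring

/-- Lower bound on the least singular value of a tall matrix with isotropic sub-gaussian rows. -/
theorem measure_exists_mulVec_sq_lt (h : IsoRows μ Z s) (hJ : Fintype.card J ≤ n) {m : ℕ}
    (hm : ((1 : ℝ) / 4) ^ m * (256 * s ^ 2 + 1 / 4) ≤ 1 / 16)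
    (hmJ : 2 * (m * Fintype.card J : ℝ) ≤ n / (64 * s ^ 4)) :
    μ {ω | ∃ u : J → ℝ, ∑ i, (u ⬝ᵥ Z ω i) ^ 2 < n / 16 * (u ⬝ᵥ u)}
      ≤ ENNReal.ofReal (Real.exp (-n)) + ENNReal.ofReal (Real.exp (-(n / (64 * s ^ 4)))) := by
  have hs := h.pos
  obtain ⟨F, hcard, hnet⟩ := exists_net (EuclideanSpace ℝ J) m
  rw [finrank_euclideanSpace] at hcard
  set E₁ : Set Ω := {ω | ∃ v : Fin n → ℝ, 128 * s ^ 2 * (∑ _j : J, (1 : ℝ) + n * 1) * (v ⬝ᵥ v)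
        < ∑ j, 1 * (∑ i, v i * Z ω i j) ^ 2} with hE₁
  have hE₁m : μ E₁ ≤ ENNReal.ofReal (Real.exp (-n)) :=
    h.measure_exists_form_gt (w := fun _ => 1) (fun _ => zero_le_one) one_pos (fun _ => le_rfl)
  set E₂ : Set Ω := ⋃ x ∈ F, {ω | ∑ i, (x.ofLp ⬝ᵥ Z ω i) ^ 2 < n / 2 * (x.ofLp ⬝ᵥ x.ofLp)} with hE₂
  have hE₂m : μ E₂ ≤ ENNReal.ofReal (Real.exp (-(n / (64 * s ^ 4)))) := by
    refine (measure_biUnion_finset_le _ _).trans ?_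
    calc ∑ x ∈ F, μ {ω | ∑ i, (x.ofLp ⬝ᵥ Z ω i) ^ 2 < n / 2 * (x.ofLp ⬝ᵥ x.ofLp)}
        ≤ ∑ _x ∈ F, ENNReal.ofReal (Real.exp (-(n / (32 * s ^ 4)))) :=
          Finset.sum_le_sum fun x _ => h.measure_mulVec_sq_lt x.ofLp
      _ = ENNReal.ofReal (F.card * Real.exp (-(n / (32 * s ^ 4)))) := by
          rw [Finset.sum_const, nsmul_eq_mul, ENNReal.ofReal_mul (by positivity),
            ENNReal.ofReal_natCast]
      _ ≤ ENNReal.ofReal (Real.exp (-(n / (64 * s ^ 4)))) := by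
          refine ENNReal.ofReal_le_ofReal ?_
          have h1 : (F.card : ℝ) ≤ 5 ^ (m * Fintype.card J) := by exact_mod_cast hcard
          -- The net size is at most `exp(2m|J|)`; `hmJ` spends half of the pointwise exponent
          -- `n/(32s⁴)` on it.
          have h2 : (5 : ℝ) ≤ Real.exp 2 := by
            have := Real.quadratic_le_exp_of_nonneg (show (0 : ℝ) ≤ 2 by norm_num); linarith
          calc (F.card : ℝ) * Real.exp (-(n / (32 * s ^ 4)))
              ≤ (Real.exp 2) ^ (m * Fintype.card J) * Real.exp (-(n / (32 * s ^ 4))) := by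
                gcongr
                exact h1.trans (pow_le_pow_left₀ (by norm_num) h2 _)
            _ ≤ Real.exp (-(n / (64 * s ^ 4))) := by
                rw [← Real.exp_nat_mul, ← Real.exp_add]
                refine Real.exp_le_exp.2 ?_
                have h3 : (n : ℝ) / (32 * s ^ 4) = n / (64 * s ^ 4) + n / (64 * s ^ 4) := by
                  field_simp; ring
                rw [h3]
                push_cast
                linarith
  refine le_trans (measure_mono (t := E₁ ∪ E₂) ?_)
    ((measure_union_le _ _).trans (add_le_add hE₁m hE₂m))
  rintro ω ⟨u, hu⟩
  by_contra hcon
  rw [Set.mem_union, not_or] at hcon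
  obtain ⟨h1, h2⟩ := hcon
  simp only [hE₁, Set.mem_ofPred_eq, not_exists, not_lt, one_mul, mul_one] at h1
  simp only [hE₂, Set.mem_iUnion, Set.mem_ofPred_eq, not_exists, not_lt] at h2
  have hn0 : (0 : ℝ) ≤ n := Nat.cast_nonneg n
  -- the dual form of the uniform upper bound
  have hup : ∀ a : J → ℝ, ∑ i, (a ⬝ᵥ Z ω i) ^ 2 ≤ 256 * s ^ 2 * n * (a ⬝ᵥ a) := fun a => by
    set y : Fin n → ℝ := fun i => a ⬝ᵥ Z ω i with hy
    have h3 := h1 y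
    set g : J → ℝ := fun j => ∑ i, y i * Z ω i j with hg
    have h4 : ∑ i, y i ^ 2 = a ⬝ᵥ g := by
      simp only [hg, dotProduct, Finset.mul_sum]
      rw [Finset.sum_comm]
      refine Finset.sum_congr rfl fun i _ => ?_
      rw [sq]
      nth_rewrite 2 [hy]
      simp only [dotProduct, Finset.mul_sum]
      exact Finset.sum_congr rfl fun j _ => by ring
    have h5 : y ⬝ᵥ y = ∑ i, y i ^ 2 := Finset.sum_congr rfl fun i _ => (sq _).symm
    have h6 : ∑ j, g j ^ 2 = g ⬝ᵥ g := Finset.sum_congr rfl fun i _ => (sq _)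
    have h7 : (∑ _j : J, (1 : ℝ)) ≤ n := by simpa using hJ
    set Kn := 256 * s ^ 2 * n with hKn
    have hKn0 : 0 ≤ Kn := by positivity
    have h8 : g ⬝ᵥ g ≤ Kn * (y ⬝ᵥ y) := by
      rw [← h6]
      refine h3.trans (mul_le_mul_of_nonneg_right ?_ (dotProduct_self_nonneg' y))
      have : s ^ 2 * (∑ _j : J, (1 : ℝ)) ≤ s ^ 2 * n := by gcongr
      rw [hKn]; linarith
    rcases hKn0.eq_or_lt with h9 | h9
    · have hg0 : g = 0 := by
        rw [← h9, zero_mul] at h8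
        exact dotProduct_self_eq_zero.1 (le_antisymm h8 (dotProduct_self_nonneg' g))
      rw [h4, hg0, dotProduct_zero]
      exact mul_nonneg hKn0 (dotProduct_self_nonneg' a)
    · have h10 := dotProduct_self_nonneg' (Kn • a - g)
      simp only [sub_dotProduct, dotProduct_sub, smul_dotProduct, dotProduct_smul, smul_eq_mul,
        dotProduct_comm g a] at h10
      rw [h5, h4] at h8
      rw [h4]
      have h11 : 0 ≤ Kn * (Kn * (a ⬝ᵥ a) - a ⬝ᵥ g) := by linarith
      have := nonneg_of_mul_nonneg_right h11 h9
      linarith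
  -- reduction to the unit sphere
  have hu0 : 0 < u ⬝ᵥ u := by
    rcases (dotProduct_self_nonneg' u).eq_or_lt with h0 | h0
    · have hu' : u = 0 := dotProduct_self_eq_zero.1 h0.symm
      simp [hu'] at hu
    · exact h0
  set r := √(u ⬝ᵥ u) with hr
  have hr0 : 0 < r := Real.sqrt_pos.2 hu0
  have hr2 : r ^ 2 = u ⬝ᵥ u := Real.sq_sqrt hu0.le
  set a : J → ℝ := r⁻¹ • u with ha
  have haa : a ⬝ᵥ a = 1 := by
    rw [ha, smul_dotProduct, dotProduct_smul, smul_eq_mul, smul_eq_mul, ← hr2]; field_simp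
  have hnorm : ∀ z : J → ℝ, ‖(WithLp.toLp 2 z : EuclideanSpace ℝ J)‖ ^ 2 = z ⬝ᵥ z := fun z => by
    rw [EuclideanSpace.norm_sq_eq]
    simp [dotProduct, sq]
  have hlt : ∑ i, (a ⬝ᵥ Z ω i) ^ 2 < n / 16 := by
    have h3 : ∑ i, (u ⬝ᵥ Z ω i) ^ 2 = r ^ 2 * ∑ i, (a ⬝ᵥ Z ω i) ^ 2 := by
      rw [Finset.mul_sum]
      refine Finset.sum_congr rfl fun i _ => ?_
      rw [ha, smul_dotProduct, smul_eq_mul, mul_pow]; field_simp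
    rw [h3, ← hr2, mul_comm (n / 16 : ℝ)] at hu
    exact lt_of_mul_lt_mul_left hu (sq_nonneg r)
  obtain ⟨x, hx, hax⟩ := hnet (WithLp.toLp 2 a) (by
    have h3 := hnorm a
    rw [haa] at h3
    nlinarith [norm_nonneg (WithLp.toLp 2 a : EuclideanSpace ℝ J)])
  set z := x.ofLp with hz
  set d := a - z with hd
  have hdd : d ⬝ᵥ d ≤ (1 / 4) ^ m := by
    rw [← hnorm d]
    have h3 := pow_le_pow_left₀ (norm_nonneg _) hax 2
    rw [← pow_mul, mul_comm m 2, pow_mul] at h3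
    norm_num at h3 ⊢
    exact h3
  have h3 := h2 x hx
  have h4 := hup d
  -- The net point may leave the unit sphere, but `1 = |z + d|² ≤ 2|z|² + 2|d|²`.
  have hz2 : 1 / 2 ≤ z ⬝ᵥ z + d ⬝ᵥ d := by
    have h5 : a = z + d := by rw [hd]; abel
    have h6 := dotProduct_self_nonneg' (z - d)
    rw [h5] at haa
    simp only [sub_dotProduct, dotProduct_sub, add_dotProduct, dotProduct_add,
      dotProduct_comm d z] at h6 haa
    linarith
  have hsplit : ∑ i, (z ⬝ᵥ Z ω i) ^ 2
      ≤ 2 * ∑ i, (a ⬝ᵥ Z ω i) ^ 2 + 2 * ∑ i, (d ⬝ᵥ Z ω i) ^ 2 := by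
    rw [Finset.mul_sum, Finset.mul_sum, ← Finset.sum_add_distrib]
    refine Finset.sum_le_sum fun i _ => ?_
    rw [hd, sub_dotProduct]
    nlinarith [sq_nonneg (a ⬝ᵥ Z ω i + (a ⬝ᵥ Z ω i - z ⬝ᵥ Z ω i))]
  -- If `|Za|² < n/16`, then `n/4 - n|d|²/2 ≤ n|z|²/2 ≤ |Zz|² < n/8 + 512s²n|d|²`. Choosing `m` by
  -- `hm` makes the `|d|²` terms total at most `n/8`, a contradiction.
  have h7 : n * (d ⬝ᵥ d) * (256 * s ^ 2 + 1 / 4) ≤ n * (1 / 16 : ℝ) := by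
    rw [mul_assoc]
    refine mul_le_mul_of_nonneg_left (le_trans ?_ hm) hn0
    gcongr
  have h8 := mul_le_mul_of_nonneg_left hz2 hn0
  nlinarith

end IsoRows

/-! ### Splitting the design into its head and its tail -/

section Split

variable {n p : ℕ}

/-- `M_{0:k}`: the first `k` columns of `M`. -/
def headCols (k : ℕ) (M : Matrix (Fin n) (Fin p) ℝ) : Matrix (Fin n) (Head p k) ℝ :=
  M.submatrix id Subtype.val

theorem sum_eq_head_add_tail (k : ℕ) (f : Fin p → ℝ) :
    ∑ j, f j = ∑ j : Head p k, f j + ∑ j : Tail p k, f j := by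
  rw [← Fintype.sum_subtype_add_sum_subtype (fun j : Fin p => (j : ℕ) < k) f]
  congr 1
  exact Fintype.sum_equiv (Equiv.subtypeEquivRight fun j => not_lt) _ _ fun j => rfl

theorem mul_transpose_eq_add (k : ℕ) (X : Matrix (Fin n) (Fin p) ℝ) :
    X * Xᵀ = headCols k X * (headCols k X)ᵀ + tailCols k X * (tailCols k X)ᵀ := by
  ext i i'
  simp only [Matrix.mul_apply, Matrix.add_apply, Matrix.transpose_apply]
  exact sum_eq_head_add_tail k _

theorem ridge_matrix_eq (k : ℕ) (X : Matrix (Fin n) (Fin p) ℝ) (r : ℝ) :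
    r • (1 : Matrix (Fin n) (Fin n) ℝ) + X * Xᵀ
      = Amat X r k + headCols k X * (headCols k X)ᵀ := by
  rw [mul_transpose_eq_add k, Amat]; abel

theorem mulVec_eq_head_add_tail (k : ℕ) (X : Matrix (Fin n) (Fin p) ℝ) (θ : Fin p → ℝ) :
    X *ᵥ θ = headCols k X *ᵥ headVec k θ + tailCols k X *ᵥ tailVec k θ := by
  ext i
  simp only [Matrix.mulVec, dotProduct, Pi.add_apply]
  exact sum_eq_head_add_tail k _

theorem mNorm_diagonal_sq {ι : Type*} [Fintype ι] [DecidableEq ι] {l : ι → ℝ} (hl : ∀ j, 0 ≤ l j)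
    (x : ι → ℝ) : mNorm (Matrix.diagonal l) x ^ 2 = ∑ j, l j * x j ^ 2 := by
  have h1 : x ⬝ᵥ (Matrix.diagonal l *ᵥ x) = ∑ j, l j * x j ^ 2 := by
    simp only [dotProduct, Matrix.mulVec_diagonal]
    exact Finset.sum_congr rfl fun j _ => by ring
  rw [mNorm, Real.sq_sqrt, h1]
  rw [h1]
  exact Finset.sum_nonneg fun j _ => mul_nonneg (hl j) (sq_nonneg _)

theorem mNorm_diagonal_inv_sq {ι : Type*} [Fintype ι] [DecidableEq ι] {l : ι → ℝ}
    (hl : ∀ j, 0 < l j) (x : ι → ℝ) :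
    mNorm (Matrix.diagonal l)⁻¹ x ^ 2 = ∑ j, x j ^ 2 / l j := by
  have h1 : (Matrix.diagonal l)⁻¹ = Matrix.diagonal fun j => (l j)⁻¹ := by
    refine Matrix.inv_eq_right_inv ?_
    rw [Matrix.diagonal_mul_diagonal, ← Matrix.diagonal_one]
    congr 1
    funext j
    exact mul_inv_cancel₀ (hl j).ne'
  rw [h1, mNorm_diagonal_sq fun j => inv_nonneg.2 (hl j).le]
  exact Finset.sum_congr rfl fun j _ => by rw [div_eq_inv_mul]

theorem bias_eq {lam : Fin p → ℝ} (hlam : ∀ j, 0 < lam j) (X : Matrix (Fin n) (Fin p) ℝ) (r : ℝ)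
    (k : ℕ) (θ : Fin p → ℝ) {w : Fin n → ℝ}
    (hw : w = (Amat X r k + headCols k X * (headCols k X)ᵀ)⁻¹ *ᵥ
      (headCols k X *ᵥ headVec k θ + tailCols k X *ᵥ tailVec k θ)) :
    bias lam X r θ = ∑ j, headVec k lam j * (headVec k θ j - ((headCols k X)ᵀ *ᵥ w) j) ^ 2
      + ∑ j, tailVec k lam j * (tailVec k θ j - ((tailCols k X)ᵀ *ᵥ w) j) ^ 2 := by
  rw [bias, mNorm_diagonal_sq fun j => (hlam j).le]
  have h1 : (1 - Xᵀ * (r • (1 : Matrix (Fin n) (Fin n) ℝ) + X * Xᵀ)⁻¹ * X) *ᵥ θ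
      = θ - Xᵀ *ᵥ w := by
    rw [Matrix.sub_mulVec, Matrix.one_mulVec, ← Matrix.mulVec_mulVec, ← Matrix.mulVec_mulVec,
      mulVec_eq_head_add_tail k X, ridge_matrix_eq k, ← hw]
  rw [h1, sum_eq_head_add_tail k]
  rfl

theorem variance_eq {lam : Fin p → ℝ} (hlam : ∀ j, 0 < lam j) (X : Matrix (Fin n) (Fin p) ℝ)
    (r : ℝ) (k : ℕ) (e : Fin n → ℝ) {w : Fin n → ℝ}
    (hw : w = (Amat X r k + headCols k X * (headCols k X)ᵀ)⁻¹ *ᵥ e) :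
    variance lam X r e = ∑ j, headVec k lam j * ((headCols k X)ᵀ *ᵥ w) j ^ 2
      + ∑ j, tailVec k lam j * ((tailCols k X)ᵀ *ᵥ w) j ^ 2 := by
  rw [variance, mNorm_diagonal_sq fun j => (hlam j).le]
  have h1 : (Xᵀ * (r • (1 : Matrix (Fin n) (Fin n) ℝ) + X * Xᵀ)⁻¹) *ᵥ e = Xᵀ *ᵥ w := by
    rw [← Matrix.mulVec_mulVec, ridge_matrix_eq k, ← hw]
  rw [h1, sum_eq_head_add_tail k]
  rfl

theorem card_head_le (p k : ℕ) : Fintype.card (Head p k) ≤ k := by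
  have h : Function.Injective fun j : Head p k => (⟨j.1, j.2⟩ : Fin k) := fun a b hab => by
    simpa [Subtype.ext_iff, Fin.ext_iff] using hab
  simpa using Fintype.card_le_of_injective _ h

/-- The whitened head columns applied to the residual of the noise. -/
noncomputable def headNoise (lam : Fin p → ℝ) (r : ℝ) (k : ℕ) (X : Matrix (Fin n) (Fin p) ℝ) :
    Matrix (Head p k) (Fin n) ℝ :=
  Matrix.of fun j i => (√(lam j))⁻¹ * ((headCols k X)ᵀ * (Amat X r k)⁻¹) j i

/-- The tail of the estimator as a linear function of the noise, weighted by `Σ_{k:∞}^{1/2}`. -/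
noncomputable def tailNoise (lam : Fin p → ℝ) (r : ℝ) (k : ℕ) (X : Matrix (Fin n) (Fin p) ℝ) :
    Matrix (Tail p k) (Fin n) ℝ :=
  Matrix.of fun j i => √(lam j) *
    ((tailCols k X)ᵀ * (Amat X r k + headCols k X * (headCols k X)ᵀ)⁻¹) j i

/-- The good event for a realization `X` of the design: `Z` denotes the whitened design. -/
structure GoodDesign (lam : Fin p → ℝ) (k : ℕ) (θ : Fin p → ℝ) (s : ℝ)
    (X : Matrix (Fin n) (Fin p) ℝ) : Prop where
  head_lower : ∀ u : Head p k → ℝ,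
    n / 16 * (u ⬝ᵥ u) ≤ ∑ i, (u ⬝ᵥ fun j : Head p k => X i j / √(lam j)) ^ 2
  tail_signal : ∑ i, ((fun j : Tail p k => √(lam j) * θ j) ⬝ᵥ
      fun j : Tail p k => X i j / √(lam j)) ^ 2
    ≤ 2 * s ^ 2 * n * ((fun j : Tail p k => √(lam j) * θ j) ⬝ᵥ
      fun j : Tail p k => √(lam j) * θ j)
  tail_form : ∀ v : Fin n → ℝ, ∑ j : Tail p k, lam j ^ 2 * (∑ i, v i * (X i j / √(lam j))) ^ 2
    ≤ 128 * s ^ 2 * (∑ j : Tail p k, lam j ^ 2 + n * lamNext lam k ^ 2) * (v ⬝ᵥ v)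
  head_trace : ∑ i, ∑ j : Head p k, 1 * (X i j / √(lam j)) ^ 2
    ≤ 2 * s ^ 2 * n * ∑ _j : Head p k, (1 : ℝ)
  tail_trace : ∑ i, ∑ j : Tail p k, lam j ^ 2 * (X i j / √(lam j)) ^ 2
    ≤ 2 * s ^ 2 * n * ∑ j : Tail p k, lam j ^ 2

/-- The good event for the noise given the design. -/
structure GoodNoise (lam : Fin p → ℝ) (r : ℝ) (k : ℕ) (σ t : ℝ) (X : Matrix (Fin n) (Fin p) ℝ)
    (e : Fin n → ℝ) : Prop where
  head : ∑ j, (∑ i, headNoise lam r k X j i * e i) ^ 2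
    ≤ 64 * σ ^ 2 * t * ∑ j, ∑ i, headNoise lam r k X j i ^ 2
  tail : ∑ j, (∑ i, tailNoise lam r k X j i * e i) ^ 2
    ≤ 64 * σ ^ 2 * t * ∑ j, ∑ i, tailNoise lam r k X j i ^ 2

/-- Whitening replaces `ζ` by `Σ₀^{1/2}ζ`, where `Σ₀` is the head covariance. This supplies `η =
μ_n(A⁻¹) n/16` in the deterministic bounds. -/
theorem head_form_lower {lam : Fin p → ℝ} (hlam : ∀ j, 0 < lam j) {k : ℕ} {θ : Fin p → ℝ} {s : ℝ}
    {X : Matrix (Fin n) (Fin p) ℝ} (hX : GoodDesign lam k θ s X) {B : Matrix (Fin n) (Fin n) ℝ}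
    {m : ℝ} (hm : 0 ≤ m) (hB : ∀ v, m * (v ⬝ᵥ v) ≤ v ⬝ᵥ (B *ᵥ v)) (ζ : Head p k → ℝ) :
    m * n / 16 * ∑ j, headVec k lam j * ζ j ^ 2
      ≤ (headCols k X *ᵥ ζ) ⬝ᵥ (B *ᵥ (headCols k X *ᵥ ζ)) := by
  have h1 := hX.head_lower fun j => √(lam j) * ζ j
  have h2 : ∀ i, ((fun j : Head p k => √(lam j) * ζ j) ⬝ᵥ fun j : Head p k => X i j / √(lam j))
      = (headCols k X *ᵥ ζ) i := fun i => by
    simp only [dotProduct, Matrix.mulVec, headCols, Matrix.submatrix_apply, id]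
    refine Finset.sum_congr rfl fun j _ => ?_
    have := Real.sqrt_pos.2 (hlam j)
    field_simp
  have h3 : ((fun j : Head p k => √(lam j) * ζ j) ⬝ᵥ fun j : Head p k => √(lam j) * ζ j)
      = ∑ j, headVec k lam j * ζ j ^ 2 := by
    simp only [dotProduct, headVec]
    refine Finset.sum_congr rfl fun j _ => ?_
    rw [mul_mul_mul_comm, Real.mul_self_sqrt (hlam j).le, sq]
  simp only [h2, h3] at h1
  refine le_trans ?_ (hB _)
  have h4 : (headCols k X *ᵥ ζ) ⬝ᵥ (headCols k X *ᵥ ζ) = ∑ i, (headCols k X *ᵥ ζ) i ^ 2 :=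
    Finset.sum_congr rfl fun i _ => (sq _).symm
  rw [h4]
  have := mul_le_mul_of_nonneg_left h1 hm
  linarith

theorem bias_bound_arith {a s m₁ mₙ E G R S ℓ : ℝ} (ha : 0 < a) (hs : 1 ≤ s) (hmₙ : 0 < mₙ)
    (hmm : mₙ ≤ m₁) (hE : 0 ≤ E) (hG : 0 ≤ G) (hS : 0 ≤ S) (hℓ : 0 ≤ ℓ)
    (hR : R ≤ 2 * s ^ 2 * a * E) :
    (2 * (m₁ * R) + 2 * (G / (mₙ * a / 16))) / (mₙ * a / 16) + 3 * E
        + 3 * (128 * s ^ 2 * (S + a * ℓ)) * m₁ * (3 * (m₁ * R) + 2 * (G / (mₙ * a / 16)))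
      ≤ 50000 * s ^ 4 * (E * (1 + m₁ ^ 2 / mₙ ^ 2 + m₁ ^ 2 * (a ^ 2 * ℓ + a * S))
        + G * (1 / (a ^ 2 * mₙ ^ 2) + m₁ ^ 2 / mₙ ^ 2 * (ℓ + 1 / a * S))) := by
  have hm₁ : 0 < m₁ := hmₙ.trans_le hmm
  have hs2 : s ^ 2 ≤ s ^ 4 := pow_le_pow_right₀ hs (by norm_num)
  have hs4 : 1 ≤ s ^ 4 := one_le_pow₀ hs
  -- The expansion contains the first power of this ratio; since the ratio is at least 1, its square
  -- dominates.
  have hq : m₁ / mₙ ≤ m₁ ^ 2 / mₙ ^ 2 := by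
    rw [← div_pow]
    exact le_self_pow₀ ((one_le_div hmₙ).2 hmm) (by norm_num)
  calc (2 * (m₁ * R) + 2 * (G / (mₙ * a / 16))) / (mₙ * a / 16) + 3 * E
        + 3 * (128 * s ^ 2 * (S + a * ℓ)) * m₁ * (3 * (m₁ * R) + 2 * (G / (mₙ * a / 16)))
      ≤ (2 * (m₁ * (2 * s ^ 2 * a * E)) + 2 * (G / (mₙ * a / 16))) / (mₙ * a / 16) + 3 * E
        + 3 * (128 * s ^ 2 * (S + a * ℓ)) * m₁
          * (3 * (m₁ * (2 * s ^ 2 * a * E)) + 2 * (G / (mₙ * a / 16))) := by gcongr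
    _ = 3 * 1 * (E * 1) + 64 * s ^ 2 * (E * (m₁ / mₙ))
        + 2304 * s ^ 4 * (E * (m₁ ^ 2 * (a ^ 2 * ℓ + a * S)))
        + 512 * 1 * (G * (1 / (a ^ 2 * mₙ ^ 2)))
        + 12288 * s ^ 2 * (G * (m₁ / mₙ * (ℓ + 1 / a * S))) := by
        field_simp
        ring
    _ ≤ 50000 * s ^ 4 * (E * 1) + 50000 * s ^ 4 * (E * (m₁ ^ 2 / mₙ ^ 2))
        + 50000 * s ^ 4 * (E * (m₁ ^ 2 * (a ^ 2 * ℓ + a * S)))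
        + 50000 * s ^ 4 * (G * (1 / (a ^ 2 * mₙ ^ 2)))
        + 50000 * s ^ 4 * (G * (m₁ ^ 2 / mₙ ^ 2 * (ℓ + 1 / a * S))) := by
        gcongr <;> norm_num
    _ = _ := by ring

theorem bias_le_of_goodDesign {lam : Fin p → ℝ} (hlam : ∀ j, 0 < lam j) (hn : 1 ≤ n) {r : ℝ}
    {k : ℕ} {θ : Fin p → ℝ} {s : ℝ} (hs : 1 ≤ s) {X : Matrix (Fin n) (Fin p) ℝ}
    (hX : GoodDesign lam k θ s X) (hA : (Amat X r k).PosDef) {m₁ mₙ : ℝ}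
    (hm₁ : m₁ = eig (Amat X r k)⁻¹ 1) (hmₙ : mₙ = eig (Amat X r k)⁻¹ n) :
    bias lam X r θ ≤ 50000 * s ^ 4 *
      (mNorm (SigmaTail lam k) (tailVec k θ) ^ 2 *
        (1 + m₁ ^ 2 / mₙ ^ 2 + m₁ ^ 2 *
          (n ^ 2 * lamNext lam k ^ 2 + n * tailSum (fun i => lam i ^ 2) k))
      + mNorm (SigmaHead lam k)⁻¹ (headVec k θ) ^ 2 *
        (1 / (n ^ 2 * mₙ ^ 2) + m₁ ^ 2 / mₙ ^ 2 *
          (lamNext lam k ^ 2 + 1 / n * tailSum (fun i => lam i ^ 2) k))) := by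
  have hn0 : (0 : ℝ) < n := by exact_mod_cast hn
  have hm₁0 : 0 < m₁ := hm₁ ▸ eig_pos hA.inv le_rfl hn
  have hmₙ0 : 0 < mₙ := hmₙ ▸ eig_pos hA.inv hn le_rfl
  have hmm : mₙ ≤ m₁ := by rw [hm₁, hmₙ]; exact eig_last_le_eig_one hA.inv.isHermitian hn
  have hup : ∀ v, v ⬝ᵥ ((Amat X r k)⁻¹ *ᵥ v) ≤ m₁ * (v ⬝ᵥ v) :=
    hm₁ ▸ dotProduct_mulVec_le_eig_one hA.inv.isHermitian
  have hlo : ∀ v, mₙ * (v ⬝ᵥ v) ≤ v ⬝ᵥ ((Amat X r k)⁻¹ *ᵥ v) :=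
    hmₙ ▸ eig_last_le_dotProduct_mulVec hA.inv.isHermitian
  rw [bias_eq hlam X r k θ rfl]
  have hE : mNorm (SigmaTail lam k) (tailVec k θ) ^ 2 = ∑ j, tailVec k lam j * tailVec k θ j ^ 2 :=
    mNorm_diagonal_sq (l := tailVec k lam) (fun j => (hlam j).le) _
  have hG : mNorm (SigmaHead lam k)⁻¹ (headVec k θ) ^ 2
      = ∑ j, headVec k θ j ^ 2 / headVec k lam j :=
    mNorm_diagonal_inv_sq (l := headVec k lam) (fun j => hlam j) _
  have hform : ∀ x : Fin n → ℝ, ∑ j, tailVec k lam j * ((tailCols k X)ᵀ *ᵥ x) j ^ 2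
      ≤ 128 * s ^ 2 * (tailSum (fun i => lam i ^ 2) k + n * lamNext lam k ^ 2) * (x ⬝ᵥ x) :=
    fun x => by
    refine le_trans (le_of_eq ?_) (hX.tail_form x)
    refine Finset.sum_congr rfl fun j _ => ?_
    have h1 : ∑ i, x i * (X i j / √(lam j)) = ((tailCols k X)ᵀ *ᵥ x) j / √(lam j) := by
      simp only [Matrix.mulVec, dotProduct, Matrix.transpose_apply, tailCols,
        Matrix.submatrix_apply, id, Finset.sum_div]
      exact Finset.sum_congr rfl fun i _ => by ring
    rw [h1, div_pow, Real.sq_sqrt (hlam j).le, tailVec]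
    have := hlam j
    field_simp
  have hR : (tailCols k X *ᵥ tailVec k θ) ⬝ᵥ (tailCols k X *ᵥ tailVec k θ)
      ≤ 2 * s ^ 2 * n * ∑ j, tailVec k lam j * tailVec k θ j ^ 2 := by
    refine le_of_eq_of_le ?_ (hX.tail_signal.trans (le_of_eq ?_))
    · rw [dotProduct]
      refine Finset.sum_congr rfl fun i _ => ?_
      rw [← sq]
      congr 1
      simp only [dotProduct, Matrix.mulVec, tailCols, Matrix.submatrix_apply, id, tailVec]
      refine Finset.sum_congr rfl fun j _ => ?_
      have := Real.sqrt_pos.2 (hlam j)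
      field_simp
    · congr 1
      simp only [dotProduct, tailVec]
      refine Finset.sum_congr rfl fun j _ => ?_
      rw [mul_mul_mul_comm, Real.mul_self_sqrt (hlam j).le, sq]
  have hS0 : 0 ≤ tailSum (fun i => lam i ^ 2) k := Finset.sum_nonneg fun j _ => sq_nonneg _
  have hop0 : 0 ≤ 128 * s ^ 2 * (tailSum (fun i => lam i ^ 2) k + n * lamNext lam k ^ 2) := by
    positivity
  refine (bias_split_le hA (headCols k X) (tailCols k X) (l₀ := headVec k lam)
    (fun j => hlam j) (l₁ := tailVec k lam) (fun j => (hlam j).le) hm₁0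
    (η := mₙ * n / 16) (by positivity) hop0 hup (head_form_lower hlam hX hmₙ0.le hlo) hform
    (headVec k θ) (tailVec k θ) rfl).trans ?_
  rw [hE, hG]
  refine bias_bound_arith hn0 hs hmₙ0 hmm
    (Finset.sum_nonneg fun j _ => mul_nonneg (hlam j).le (sq_nonneg _))
    (Finset.sum_nonneg fun j _ => div_nonneg (sq_nonneg _) (hlam j).le) hS0 (sq_nonneg _) hR

theorem sum_headNoise_sq_le {lam : Fin p → ℝ} (hlam : ∀ j, 0 < lam j) {r : ℝ}
    {k : ℕ} {θ : Fin p → ℝ} {s : ℝ} {X : Matrix (Fin n) (Fin p) ℝ}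
    (hX : GoodDesign lam k θ s X) (hA : (Amat X r k).PosDef) {m : ℝ} (hm : 0 < m)
    (hup : ∀ v, v ⬝ᵥ ((Amat X r k)⁻¹ *ᵥ v) ≤ m * (v ⬝ᵥ v)) :
    ∑ j, ∑ i, headNoise lam r k X j i ^ 2 ≤ m ^ 2 * (2 * s ^ 2 * n * k) := by
  have h1 : ∀ j, ∑ i, headNoise lam r k X j i ^ 2 ≤ m ^ 2 * ∑ i, (X i j / √(lam j)) ^ 2 :=
    fun j => by
    have h2 := sum_transpose_mul_sq_le hA.inv.isHermitian
      (mulVec_sq_le_sq hA.inv.posSemidef hm hup) (headCols k X) j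
    have hl := hlam j
    simp only [headNoise, Matrix.of_apply, mul_pow, ← Finset.mul_sum, div_pow,
      Real.sq_sqrt hl.le, inv_pow, ← Finset.sum_div]
    rw [inv_mul_le_iff₀ hl]
    refine h2.trans (le_of_eq ?_)
    simp only [headCols, Matrix.submatrix_apply, id]
    field_simp
  have h2 := hX.head_trace
  simp only [one_mul] at h2
  rw [Finset.sum_comm] at h2
  have h3 : (∑ _j : Head p k, (1 : ℝ)) ≤ k := by
    have h := card_head_le p k
    simp only [Finset.sum_const, Finset.card_univ, nsmul_eq_mul, mul_one]
    exact_mod_cast h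
  calc ∑ j, ∑ i, headNoise lam r k X j i ^ 2
      ≤ ∑ j : Head p k, m ^ 2 * ∑ i, (X i j / √(lam j)) ^ 2 := Finset.sum_le_sum fun j _ => h1 j
    _ = m ^ 2 * ∑ j : Head p k, ∑ i, (X i j / √(lam j)) ^ 2 := by rw [Finset.mul_sum]
    _ ≤ m ^ 2 * (2 * s ^ 2 * n * k) := by gcongr; exact h2.trans (by gcongr)

/-- The matrix here is `A + X₀X₀ᵀ`, not `A`, but adding a positive semidefinite term cannot increase
the norm of the inverse, so the same `m` serves. -/
theorem sum_tailNoise_sq_le {lam : Fin p → ℝ} (hlam : ∀ j, 0 < lam j) {r : ℝ}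
    {k : ℕ} {θ : Fin p → ℝ} {s : ℝ} {X : Matrix (Fin n) (Fin p) ℝ}
    (hX : GoodDesign lam k θ s X) (hA : (Amat X r k).PosDef) {m : ℝ} (hm : 0 < m)
    (hup : ∀ v, v ⬝ᵥ ((Amat X r k)⁻¹ *ᵥ v) ≤ m * (v ⬝ᵥ v)) :
    ∑ j, ∑ i, tailNoise lam r k X j i ^ 2
      ≤ m ^ 2 * (2 * s ^ 2 * n * tailSum (fun i => lam i ^ 2) k) := by
  have hF : (Amat X r k + headCols k X * (headCols k X)ᵀ).PosDef :=
    hA.add_posSemidef (posSemidef_mul_transpose _)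
  have hAF : ∀ v, v ⬝ᵥ (Amat X r k *ᵥ v)
      ≤ v ⬝ᵥ ((Amat X r k + headCols k X * (headCols k X)ᵀ) *ᵥ v) := fun v => by
    rw [Matrix.add_mulVec, dotProduct_add, dotProduct_mul_transpose_mulVec]
    exact le_add_of_nonneg_right (dotProduct_self_nonneg' _)
  have h1 : ∀ j, ∑ i, tailNoise lam r k X j i ^ 2
      ≤ m ^ 2 * ∑ i, lam j ^ 2 * (X i j / √(lam j)) ^ 2 := fun j => by
    have h2 := sum_transpose_mul_sq_le hF.inv.isHermitian
      (inv_mulVec_sq_le_of_le hA hF hAF hm hup) (tailCols k X) j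
    have hl := hlam j
    simp only [tailNoise, Matrix.of_apply, mul_pow, ← Finset.mul_sum, div_pow,
      Real.sq_sqrt hl.le, ← Finset.sum_div]
    refine (mul_le_mul_of_nonneg_left h2 hl.le).trans (le_of_eq ?_)
    simp only [tailCols, Matrix.submatrix_apply, id]
    field_simp
  have h2 := hX.tail_trace
  rw [Finset.sum_comm] at h2
  calc ∑ j, ∑ i, tailNoise lam r k X j i ^ 2
      ≤ ∑ j : Tail p k, m ^ 2 * ∑ i, lam j ^ 2 * (X i j / √(lam j)) ^ 2 :=
        Finset.sum_le_sum fun j _ => h1 j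
    _ = m ^ 2 * ∑ j : Tail p k, ∑ i, lam j ^ 2 * (X i j / √(lam j)) ^ 2 := by rw [Finset.mul_sum]
    _ ≤ m ^ 2 * (2 * s ^ 2 * n * tailSum (fun i => lam i ^ 2) k) := by gcongr; exact h2

theorem variance_le_of_good {lam : Fin p → ℝ} (hlam : ∀ j, 0 < lam j) (hn : 1 ≤ n) {r : ℝ}
    {k : ℕ} {θ : Fin p → ℝ} {s : ℝ} (hs : 1 ≤ s) {X : Matrix (Fin n) (Fin p) ℝ}
    (hX : GoodDesign lam k θ s X) (hA : (Amat X r k).PosDef) {m₁ mₙ : ℝ}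
    (hm₁ : m₁ = eig (Amat X r k)⁻¹ 1) (hmₙ : mₙ = eig (Amat X r k)⁻¹ n) {σ t : ℝ} (ht : 0 ≤ t)
    {e : Fin n → ℝ} (he : GoodNoise lam r k σ t X e) :
    variance lam X r e ≤ 50000 * s ^ 4 * (σ ^ 2 * t) *
      (m₁ ^ 2 / mₙ ^ 2 * (k / n) + n * m₁ ^ 2 * tailSum (fun i => lam i ^ 2) k) := by
  have hn0 : (0 : ℝ) < n := by exact_mod_cast hn
  have hm₁0 : 0 < m₁ := hm₁ ▸ eig_pos hA.inv le_rfl hn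
  have hmₙ0 : 0 < mₙ := hmₙ ▸ eig_pos hA.inv hn le_rfl
  have hup : ∀ v, v ⬝ᵥ ((Amat X r k)⁻¹ *ᵥ v) ≤ m₁ * (v ⬝ᵥ v) :=
    hm₁ ▸ dotProduct_mulVec_le_eig_one hA.inv.isHermitian
  have hlo : ∀ v, mₙ * (v ⬝ᵥ v) ≤ v ⬝ᵥ ((Amat X r k)⁻¹ *ᵥ v) :=
    hmₙ ▸ eig_last_le_dotProduct_mulVec hA.inv.isHermitian
  have hS0 : 0 ≤ tailSum (fun i => lam i ^ 2) k := Finset.sum_nonneg fun j _ => sq_nonneg _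
  rw [variance_eq hlam X r k e rfl]
  have h1 := variance_split_le hA (headCols k X) (l₀ := headVec k lam) (fun j => hlam j)
    (η := mₙ * n / 16) (by positivity) (head_form_lower hlam hX hmₙ0.le hlo) e rfl
  have h2 : ∑ j, ((headCols k X)ᵀ *ᵥ ((Amat X r k)⁻¹ *ᵥ e)) j ^ 2 / headVec k lam j
      = ∑ j, (∑ i, headNoise lam r k X j i * e i) ^ 2 := by
    refine Finset.sum_congr rfl fun j _ => ?_
    have h3 : ∑ i, headNoise lam r k X j i * e i
        = (√(lam j))⁻¹ * ((headCols k X)ᵀ *ᵥ ((Amat X r k)⁻¹ *ᵥ e)) j := by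
      rw [Matrix.mulVec_mulVec]
      simp only [headNoise, Matrix.of_apply, Matrix.mulVec, dotProduct, Finset.mul_sum, mul_assoc]
    rw [h3, mul_pow, inv_pow, Real.sq_sqrt (hlam j).le, headVec, div_eq_inv_mul]
  have h4 : ∑ j, tailVec k lam j * ((tailCols k X)ᵀ *ᵥ
      ((Amat X r k + headCols k X * (headCols k X)ᵀ)⁻¹ *ᵥ e)) j ^ 2
      = ∑ j, (∑ i, tailNoise lam r k X j i * e i) ^ 2 := by
    refine Finset.sum_congr rfl fun j _ => ?_
    have h3 : ∑ i, tailNoise lam r k X j i * e i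
        = √(lam j) * ((tailCols k X)ᵀ *ᵥ
          ((Amat X r k + headCols k X * (headCols k X)ᵀ)⁻¹ *ᵥ e)) j := by
      rw [Matrix.mulVec_mulVec]
      simp only [tailNoise, Matrix.of_apply, Matrix.mulVec, dotProduct, Finset.mul_sum, mul_assoc]
    rw [h3, mul_pow, Real.sq_sqrt (hlam j).le, tailVec]
  rw [h4]
  rw [h2] at h1
  have hσt : 0 ≤ 64 * σ ^ 2 * t := by positivity
  have h5 := he.head.trans (mul_le_mul_of_nonneg_left (sum_headNoise_sq_le hlam hX hA hm₁0 hup) hσt)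
  have h6 := he.tail.trans (mul_le_mul_of_nonneg_left (sum_tailNoise_sq_le hlam hX hA hm₁0 hup) hσt)
  have hs2 : s ^ 2 ≤ s ^ 4 := pow_le_pow_right₀ hs (by norm_num)
  have hhead : ∑ j, headVec k lam j * ((headCols k X)ᵀ *ᵥ
      ((Amat X r k + headCols k X * (headCols k X)ᵀ)⁻¹ *ᵥ e)) j ^ 2
      ≤ 50000 * s ^ 4 * ((σ ^ 2 * t) * (m₁ ^ 2 / mₙ ^ 2 * (k / n))) := by
    refine h1.trans ?_
    calc 4 / 3 * (∑ j, (∑ i, headNoise lam r k X j i * e i) ^ 2) / (mₙ * n / 16) ^ 2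
        ≤ 4 / 3 * (64 * σ ^ 2 * t * (m₁ ^ 2 * (2 * s ^ 2 * n * k))) / (mₙ * n / 16) ^ 2 := by
          gcongr
      _ = 131072 / 3 * s ^ 2 * ((σ ^ 2 * t) * (m₁ ^ 2 / mₙ ^ 2 * (k / n))) := by
          field_simp; ring
      _ ≤ 50000 * s ^ 4 * ((σ ^ 2 * t) * (m₁ ^ 2 / mₙ ^ 2 * (k / n))) := by
          gcongr; norm_num
  have htail : ∑ j, (∑ i, tailNoise lam r k X j i * e i) ^ 2
      ≤ 50000 * s ^ 4 * ((σ ^ 2 * t) * (n * m₁ ^ 2 * tailSum (fun i => lam i ^ 2) k)) := by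
    refine h6.trans ?_
    calc 64 * σ ^ 2 * t * (m₁ ^ 2 * (2 * s ^ 2 * n * tailSum (fun i => lam i ^ 2) k))
        = 128 * s ^ 2 * ((σ ^ 2 * t) * (n * m₁ ^ 2 * tailSum (fun i => lam i ^ 2) k)) := by ring
      _ ≤ 50000 * s ^ 4 * ((σ ^ 2 * t) * (n * m₁ ^ 2 * tailSum (fun i => lam i ^ 2) k)) := by
          gcongr; norm_num
  calc _ ≤ _ := add_le_add hhead htail
    _ = _ := by ring

end Split

/-! ### Probabilities of the good events -/

section Measurability

variable {β N : Type*} [MeasurableSpace β] [Fintype N] [DecidableEq N]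

theorem measurable_det {B : β → Matrix N N ℝ} (hB : ∀ i j, Measurable fun b => B b i j) :
    Measurable fun b => (B b).det := by
  simp only [Matrix.det_apply']
  exact Finset.measurable_sum _ fun σ _ =>
    (Finset.measurable_prod _ fun i _ => hB _ _).const_mul _

/-- By the adjugate formula the entries are determinants times the inverse of a determinant.
Singular matrices need no separate case, since inversion on the reals is measurable with value 0 at
0. -/
theorem measurable_matrix_inv {B : β → Matrix N N ℝ} (hB : ∀ i j, Measurable fun b => B b i j)
    (i j : N) : Measurable fun b => (B b)⁻¹ i j := by
  simp only [Matrix.inv_def, Ring.inverse_eq_inv', Matrix.smul_apply, smul_eq_mul,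
    Matrix.adjugate_apply]
  refine (measurable_det hB).inv.mul (measurable_det fun i' j' => ?_)
  simp only [Matrix.updateRow_apply]
  split_ifs
  · exact measurable_const
  · exact hB i' j'

variable {n p : ℕ}

theorem measurable_Amat (r : ℝ) (k : ℕ) (i i' : Fin n) :
    Measurable fun X : Fin n → Fin p → ℝ => Amat (Matrix.of X) r k i i' := by
  simp only [Amat, Matrix.add_apply, Matrix.mul_apply, tailCols, Matrix.transpose_apply,
    Matrix.submatrix_apply, Matrix.of_apply]
  fun_prop

theorem measurable_headNoise (lam : Fin p → ℝ) (r : ℝ) (k : ℕ) (j : Head p k) (i : Fin n) :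
    Measurable fun X : Fin n → Fin p → ℝ => headNoise lam r k (Matrix.of X) j i := by
  have h := fun i i' => measurable_matrix_inv (measurable_Amat (n := n) (p := p) r k) i i'
  simp only [headNoise]
  simp only [Matrix.mul_apply (M := (headCols k _)ᵀ), Matrix.of_apply]
  refine (Finset.measurable_sum _ fun i' _ => Measurable.mul ?_ (h i' i)).const_mul _
  simp only [headCols, Matrix.transpose_apply, Matrix.submatrix_apply, Matrix.of_apply]
  fun_prop

theorem measurable_tailNoise (lam : Fin p → ℝ) (r : ℝ) (k : ℕ) (j : Tail p k) (i : Fin n) :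
    Measurable fun X : Fin n → Fin p → ℝ => tailNoise lam r k (Matrix.of X) j i := by
  have hA := measurable_Amat (n := n) (p := p) r k
  have h := fun i i' => measurable_matrix_inv (B := fun X : Fin n → Fin p → ℝ =>
      Amat (Matrix.of X) r k + headCols k (Matrix.of X) * (headCols k (Matrix.of X))ᵀ)
    (fun i i' => by
      simp only [Matrix.add_apply]
      refine (hA i i').add ?_
      simp only [Matrix.mul_apply, headCols, Matrix.transpose_apply,
        Matrix.submatrix_apply, Matrix.of_apply]
      fun_prop) i i'
  simp only [tailNoise]
  simp only [Matrix.mul_apply (M := (tailCols k _)ᵀ), Matrix.of_apply]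
  refine (Finset.measurable_sum _ fun i' _ => Measurable.mul ?_ (h i' i)).const_mul _
  simp only [tailCols, Matrix.transpose_apply, Matrix.submatrix_apply, Matrix.of_apply]
  fun_prop

end Measurability

/-! ### Probability of the good events in the model -/

namespace IsModel

variable {Ω : Type*} [MeasurableSpace Ω] {μ : Measure Ω} {n p : ℕ}
  {X : Ω → Matrix (Fin n) (Fin p) ℝ} {ε : Ω → Fin n → ℝ} {lam : Fin p → ℝ} {σx σε : ℝ}

theorem lam_le_lamNext (h : IsModel μ X ε lam σx σε) {k : ℕ} (j : Tail p k) :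
    lam j ≤ lamNext lam k := by
  have hkp : k < p := lt_of_le_of_lt j.2 j.1.2
  rw [lamNext, dif_pos hkp]
  exact h.lam_antitone (Fin.mk_le_of_le_val j.2)

variable [IsProbabilityMeasure μ]

theorem isoRows (h : IsModel μ X ε lam σx σε) {s : ℝ} (hσ : σx < s) (hs : 0 < s) :
    IsoRows μ (fun ω i j => X ω i j / √(lam j)) s where
  meas i j := (h.measurable_X i j).div_const _
  indep := h.rows_indep.comp (fun _ x j => x j / √(lam j)) fun _ => by fun_prop
  centered i j := by rw [integral_div, h.rows_centered, zero_div]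
  cov i j j' := by
    have h1 : ∀ ω, X ω i j / √(lam j) * (X ω i j' / √(lam j'))
        = (X ω i j * X ω i j') / (√(lam j) * √(lam j')) := fun ω => div_mul_div_comm _ _ _ _
    simp only [h1]
    rw [integral_div, h.rows_cov, Matrix.diagonal_apply]
    split_ifs with hjj
    · subst hjj
      rw [Real.mul_self_sqrt (h.lam_pos j).le, div_self (h.lam_pos j).ne']
    · exact zero_div _
  pos := hs
  subgaussian i u hu := by
    have h1 := lintegral_exp_sq_le_of_psi2NormVec_le (h.rows_subgaussian i) hσ hs hu
    simpa only [Matrix.mul_diagonal, ← div_eq_mul_inv, dotProduct] using h1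

/-- The lower singular value bound costs `2q` and each of the four remaining conditions costs `q`.
-/
theorem measure_not_goodDesign (h : IsModel μ X ε lam σx σε) {s : ℝ} (hσ : σx < s) (hs : 0 < s)
    (θ : Fin p → ℝ) {k m : ℕ} (hk : k ≤ n)
    (hm : ((1 : ℝ) / 4) ^ m * (256 * s ^ 2 + 1 / 4) ≤ 1 / 16)
    (hmk : 2 * (m * k : ℝ) ≤ n / (64 * s ^ 4)) {q : ℝ≥0∞}
    (hq₁ : ENNReal.ofReal (Real.exp (-n)) ≤ q)
    (hq₂ : ENNReal.ofReal (Real.exp (-(n / (64 * s ^ 4)))) ≤ q) :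
    μ {ω | ¬ GoodDesign lam k θ s (X ω)} ≤ 6 * q := by
  have hZ := h.isoRows hσ hs
  have hH := hZ.restrict fun j : Fin p => (j : ℕ) < k
  have hT := hZ.restrict fun j : Fin p => k ≤ (j : ℕ)
  have hcard := card_head_le p k
  have hmk' : 2 * (m * (Fintype.card (Head p k) : ℝ)) ≤ n / (64 * s ^ 4) := by
    refine le_trans ?_ hmk
    gcongr
  have e1 := (hH.measure_exists_mulVec_sq_lt (hcard.trans hk) hm hmk').trans (add_le_add hq₁ hq₂)
  have e2 := (hT.measure_mulVec_sq_gt fun j : Tail p k => √(lam j) * θ j).trans hq₁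
  have e3 : μ {ω | ∃ v : Fin n → ℝ,
      128 * s ^ 2 * (∑ j : Tail p k, lam j ^ 2 + n * lamNext lam k ^ 2) * (v ⬝ᵥ v)
        < ∑ j : Tail p k, lam j ^ 2 * (∑ i, v i * (X ω i j / √(lam j))) ^ 2} ≤ q := by
    by_cases hkp : k < p
    · have hpos : 0 < lamNext lam k := by rw [lamNext, dif_pos hkp]; exact h.lam_pos _
      exact (hT.measure_exists_form_gt (w := fun j : Tail p k => lam j ^ 2)
        (fun j => sq_nonneg _) (pow_pos hpos 2) (fun j =>
          pow_le_pow_left₀ (h.lam_pos j).le (h.lam_le_lamNext j) 2)).trans hq₁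
    -- For `k ≥ p` the convention `λ_{k+1} = 0` prevents its square from being a positive bound `b`,
    -- but the tail is empty and the form is zero.
    · have : IsEmpty (Tail p k) := ⟨fun j => hkp (lt_of_le_of_lt j.2 j.1.2)⟩
      refine le_of_eq_of_le ?_ (zero_le (a := q))
      rw [lamNext, dif_neg hkp]
      simp
  have e4 := (hH.measure_weighted_sq_gt (w := fun _ => 1) fun _ => zero_le_one).trans hq₁
  have e5 := (hT.measure_weighted_sq_gt (w := fun j : Tail p k => lam j ^ 2)
    fun _ => sq_nonneg _).trans hq₁
  refine le_trans (measure_mono (t := _ ∪ (_ ∪ (_ ∪ (_ ∪ _)))) ?_)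
    ((measure_union_le _ _).trans (add_le_add e1 ((measure_union_le _ _).trans
      (add_le_add e2 ((measure_union_le _ _).trans (add_le_add e3
        ((measure_union_le _ _).trans (add_le_add e4 e5)))))))) |>.trans (le_of_eq (by ring))
  intro ω hω
  by_contra hcon
  simp only [Set.mem_union, not_or, Set.mem_ofPred_eq, not_exists, not_lt] at hcon
  obtain ⟨h1, h2, h3, h4, h5⟩ := hcon
  exact hω ⟨h1, h2, h3, h4, h5⟩

theorem measure_noise_gt (h : IsModel μ X ε lam σx σε) (hσ : 0 ≤ σε) {J : Type*} [Fintype J]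
    {M : (Fin n → Fin p → ℝ) → Matrix J (Fin n) ℝ} (hM : ∀ j i, Measurable fun b => M b j i)
    (t : ℝ) :
    μ {ω | 64 * σε ^ 2 * t * ∑ j, ∑ i, M (X ω) j i ^ 2
        < ∑ j, (∑ i, M (X ω) j i * ε ω i) ^ 2}
      ≤ 2 * ENNReal.ofReal (Real.exp (-t)) := by
  rcases hσ.eq_or_lt with h0 | h0
  · have h1 : ∀ᵐ ω ∂μ, ∀ i, ε ω i = 0 := ae_all_iff.2 fun i =>
      ae_eq_zero_of_psi2Norm_eq_zero (h.measurable_ε i) (h0 ▸ h.noise_subgaussian i)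
    refine le_of_eq_of_le ?_ zero_le
    rw [measure_eq_zero_iff_ae_notMem]
    filter_upwards [h1] with ω hω
    simp [hω, ← h0]
  -- The scale `2σε` lies strictly above the sub-gaussian norm and turns the constant 16 into 64.
  · have h1 := measure_random_mulVec_sq_gt_le (μ := μ) (Φ := fun ω i j => X ω i j)
      (measurable_pi_iff.2 fun i => measurable_pi_iff.2 (h.measurable_X i)) h.measurable_ε
      h.noise_indep_design h.noise_indep h.noise_centered (s := 2 * σε) (by positivity)
      (fun i => lintegral_exp_sq_le_of_psi2Norm_le (h.noise_subgaussian i) (by linarith)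
        (by positivity)) hM t
    refine le_trans (measure_mono fun ω hω => ?_) h1
    simp only [Set.mem_ofPred_eq] at hω ⊢
    refine lt_of_eq_of_lt ?_ hω
    ring_nf

theorem measure_not_goodNoise (h : IsModel μ X ε lam σx σε) (hσ : 0 ≤ σε) (r : ℝ) (k : ℕ)
    (t : ℝ) :
    μ {ω | ¬ GoodNoise lam r k σε t (X ω) (ε ω)} ≤ 4 * ENNReal.ofReal (Real.exp (-t)) := by
  have e1 := h.measure_noise_gt hσ (fun j i => measurable_headNoise (n := n) lam r k j i) t
  have e2 := h.measure_noise_gt hσ (fun j i => measurable_tailNoise (n := n) lam r k j i) t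
  refine le_trans (measure_mono (t := _ ∪ _) ?_)
    ((measure_union_le _ _).trans (add_le_add e1 e2)) |>.trans (le_of_eq (by ring))
  intro ω hω
  by_contra hcon
  simp only [Set.mem_union, not_or, Set.mem_ofPred_eq, not_lt] at hcon
  exact hω ⟨hcon.1, hcon.2⟩

end IsModel

/-! ### Consequences of a bounded condition number -/

section Condition

variable {n p : ℕ}

theorem of_condNumber_le {A : Matrix (Fin n) (Fin n) ℝ} (hn : 1 ≤ n) {L : ℝ}
    (h : condNumber A ≤ ENNReal.ofReal L) : A.PosDef ∧ 1 ≤ L ∧ eig A 1 ≤ L * eig A n := by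
  have hA : A.PosDef := by
    by_contra hcon
    rw [condNumber, if_neg hcon] at h
    exact absurd h (by simp)
  rw [condNumber, if_pos hA] at h
  have hpos := eig_pos hA hn le_rfl
  have h1 : 1 ≤ eig A 1 / eig A n := (one_le_div hpos).2 (eig_last_le_eig_one hA.isHermitian hn)
  have h2 : eig A 1 / eig A n ≤ L := by
    rcases ENNReal.ofReal_le_ofReal_iff'.1 h with h2 | h2
    · exact h2
    · linarith
  exact ⟨hA, h1.trans h2, (div_le_iff₀ hpos).1 h2⟩

theorem trace_Amat {lam : Fin p → ℝ} (hlam : ∀ j, 0 < lam j) (X : Matrix (Fin n) (Fin p) ℝ) (r : ℝ)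
    (k : ℕ) : (Amat X r k).trace
      = (∑ i, ∑ j : Tail p k, lam j * (X i j / √(lam j)) ^ 2) + n * r := by
  simp only [Amat, Matrix.trace_add, Matrix.trace_smul, Matrix.trace_one, Fintype.card_fin,
    smul_eq_mul, mul_comm r]
  congr 1
  refine Finset.sum_congr rfl fun i _ => ?_
  simp only [Matrix.diag_apply, Matrix.mul_apply, Matrix.transpose_apply, tailCols,
    Matrix.submatrix_apply, id]
  refine Finset.sum_congr rfl fun j _ => ?_
  have := hlam j
  rw [div_pow, Real.sq_sqrt this.le]
  field_simp

/-- Test the form of `A` on the column `v` itself: one coordinate of `X₁ᵀv` equals `|v|²`, so `|v|⁴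
≤ μ₁(A)|v|²`. -/
theorem sum_col_sq_le_eig_one {X : Matrix (Fin n) (Fin p) ℝ} {r : ℝ} (hr : 0 ≤ r) {k : ℕ}
    (hA : (Amat X r k).PosDef) (hn : 1 ≤ n) (j : Tail p k) :
    ∑ i, X i j ^ 2 ≤ eig (Amat X r k) 1 := by
  set v : Fin n → ℝ := fun i => X i j with hv
  have h1 := dotProduct_mulVec_le_eig_one hA.isHermitian v
  rw [Amat, Matrix.add_mulVec, dotProduct_add, dotProduct_mul_transpose_mulVec,
    Matrix.smul_mulVec, Matrix.one_mulVec, dotProduct_smul, smul_eq_mul] at h1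
  have hvv : ∑ i, X i j ^ 2 = v ⬝ᵥ v := Finset.sum_congr rfl fun i _ => sq _
  have h0 := dotProduct_self_nonneg' v
  rw [hvv]
  have h2 : (v ⬝ᵥ v) ^ 2 ≤ ((tailCols k X)ᵀ *ᵥ v) ⬝ᵥ ((tailCols k X)ᵀ *ᵥ v) := by
    have h3 : ((tailCols k X)ᵀ *ᵥ v) j = v ⬝ᵥ v := rfl
    rw [← h3, sq]
    exact Finset.single_le_sum
      (f := fun l => ((tailCols k X)ᵀ *ᵥ v) l * ((tailCols k X)ᵀ *ᵥ v) l)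
      (fun l _ => mul_self_nonneg _) (Finset.mem_univ j)
  have h3 : (v ⬝ᵥ v) ^ 2 ≤ eig (Amat X r k) 1 * (v ⬝ᵥ v) := by
    have := mul_nonneg hr h0
    rw [Amat]
    linarith
  rcases h0.eq_or_lt with h4 | h4
  · rw [← h4]; exact (eig_pos hA le_rfl hn).le
  · rw [sq] at h3
    exact le_of_mul_le_mul_right h3 h4

/-- The two-sided control of the trace of the tail used together with the condition number. -/
structure GoodTrace (lam : Fin p → ℝ) (k : ℕ) (s : ℝ) (X : Matrix (Fin n) (Fin p) ℝ) : Prop where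
  upper : ∑ i, ∑ j : Tail p k, lam j * (X i j / √(lam j)) ^ 2 ≤ 2 * s ^ 2 * n * tailSum lam k
  lower : n / 2 * tailSum lam k ≤ ∑ i, ∑ j : Tail p k, lam j * (X i j / √(lam j)) ^ 2

theorem tailSum_nonneg {a : Fin p → ℝ} (ha : ∀ j, 0 ≤ a j) (k : ℕ) : 0 ≤ tailSum a k :=
  Finset.sum_nonneg fun j _ => ha j

/-- The smallest eigenvalue is at most the average, `trace / n`. -/
theorem eig_last_le_of_trace_le {lam : Fin p → ℝ} (hlam : ∀ j, 0 < lam j) (hn : 1 ≤ n) {s : ℝ}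
    (hs : 1 ≤ s) {r : ℝ} (hr : 0 ≤ r) {k : ℕ} {X : Matrix (Fin n) (Fin p) ℝ}
    (hA : (Amat X r k).IsHermitian)
    (hX : ∑ i, ∑ j : Tail p k, lam j * (X i j / √(lam j)) ^ 2 ≤ 2 * s ^ 2 * n * tailSum lam k) :
    eig (Amat X r k) n ≤ 2 * s ^ 2 * (r + tailSum lam k) := by
  have hn0 : (0 : ℝ) < n := by exact_mod_cast hn
  have h1 := eig_last_le_trace hA
  rw [trace_Amat hlam] at h1
  refine le_of_mul_le_mul_left (h1.trans ?_) hn0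
  have hs2 : 1 ≤ s ^ 2 := one_le_pow₀ hs
  have h2 : n * r ≤ (2 * s ^ 2) * (n * r) :=
    le_mul_of_one_le_left (by positivity) (by linarith)
  linarith

theorem le_eig_one_of_le_trace {lam : Fin p → ℝ} (hlam : ∀ j, 0 < lam j) (hn : 1 ≤ n)
    {r : ℝ} (hr : 0 ≤ r) {k : ℕ} {X : Matrix (Fin n) (Fin p) ℝ} (hA : (Amat X r k).IsHermitian)
    (hX : n / 2 * tailSum lam k ≤ ∑ i, ∑ j : Tail p k, lam j * (X i j / √(lam j)) ^ 2) :
    (r + tailSum lam k) / 2 ≤ eig (Amat X r k) 1 := by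
  have hn0 : (0 : ℝ) < n := by exact_mod_cast hn
  have h1 := trace_le_eig_one hA
  rw [trace_Amat hlam] at h1
  refine le_of_mul_le_mul_left (le_trans ?_ h1) hn0
  have := mul_nonneg hn0.le hr
  linarith

theorem condition_arith {a s L T m₁ mₙ lk S : ℝ} (ha : 0 < a) (hs : 1 ≤ s) (hL : 1 ≤ L)
    (hT : 0 < T) (hm₁ : 0 < m₁) (hmₙ : 0 < mₙ) (h₁ : m₁ ≤ 2 * L / T)
    (hₙ : 1 / mₙ ≤ 2 * s ^ 2 * L * T) (hq : m₁ / mₙ ≤ L) (hlk : 0 ≤ lk)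
    (hak : a * lk ≤ 4 * s ^ 2 * L * T) (hS : 0 ≤ S) (hSk : S ≤ lk * T) :
    1 + m₁ ^ 2 / mₙ ^ 2 + m₁ ^ 2 * (a ^ 2 * lk ^ 2 + a * S) ≤ 100 * s ^ 4 * L ^ 4 ∧
    1 / (a ^ 2 * mₙ ^ 2) + m₁ ^ 2 / mₙ ^ 2 * (lk ^ 2 + 1 / a * S)
      ≤ 100 * s ^ 4 * L ^ 4 * (T / a) ^ 2 ∧
    a * m₁ ^ 2 * S ≤ 4 * L ^ 2 * (a * S / T ^ 2) := by
  have hs0 : 0 < s := by linarith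
  have hL0 : 0 < L := by linarith
  have hs2 : 1 ≤ s ^ 2 := one_le_pow₀ hs
  have hs4 : 1 ≤ s ^ 4 := one_le_pow₀ hs
  have hs24 : s ^ 2 ≤ s ^ 4 := pow_le_pow_right₀ hs (by norm_num)
  have hL4 : 1 ≤ L ^ 4 := one_le_pow₀ hL
  have hL24 : L ^ 2 ≤ L ^ 4 := pow_le_pow_right₀ hL (by norm_num)
  have hL34 : L ^ 3 ≤ L ^ 4 := pow_le_pow_right₀ hL (by norm_num)
  have hq2 : m₁ ^ 2 / mₙ ^ 2 ≤ L ^ 2 := by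
    rw [← div_pow]; exact pow_le_pow_left₀ (by positivity) hq 2
  have hm2 : m₁ ^ 2 ≤ 4 * L ^ 2 / T ^ 2 := by
    refine (pow_le_pow_left₀ hm₁.le h₁ 2).trans (le_of_eq ?_)
    rw [div_pow, mul_pow]; norm_num
  have hak2 : a ^ 2 * lk ^ 2 ≤ 16 * s ^ 4 * L ^ 2 * T ^ 2 := by
    have := pow_le_pow_left₀ (by positivity) hak 2
    rw [mul_pow] at this
    refine this.trans (le_of_eq (by ring))
  have haS : a * S ≤ 4 * s ^ 2 * L * T ^ 2 := by
    calc a * S ≤ a * (lk * T) := by gcongr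
      _ = (a * lk) * T := by ring
      _ ≤ (4 * s ^ 2 * L * T) * T := by gcongr
      _ = _ := by ring
  have hss : s ^ 4 * L ^ 4 ≥ 1 := one_le_mul_of_one_le_of_one_le hs4 hL4
  have b1 : L ^ 2 ≤ s ^ 4 * L ^ 4 := by
    calc L ^ 2 = 1 * L ^ 2 := by ring
      _ ≤ s ^ 4 * L ^ 4 := by gcongr
  have b2 : s ^ 2 * L ^ 3 ≤ s ^ 4 * L ^ 4 := by gcongr
  have b3 : s ^ 4 * L ^ 2 ≤ s ^ 4 * L ^ 4 := by gcongr
  refine ⟨?_, ?_, ?_⟩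
  · have h3 : m₁ ^ 2 * (a ^ 2 * lk ^ 2 + a * S)
        ≤ 64 * (s ^ 4 * L ^ 4) + 16 * (s ^ 2 * L ^ 3) := by
      calc m₁ ^ 2 * (a ^ 2 * lk ^ 2 + a * S)
          ≤ 4 * L ^ 2 / T ^ 2 * (16 * s ^ 4 * L ^ 2 * T ^ 2 + 4 * s ^ 2 * L * T ^ 2) := by gcongr
        _ = _ := by field_simp; ring
    linarith
  · have hT2 : 0 ≤ (T / a) ^ 2 := by positivity
    have h3 : 1 / (a ^ 2 * mₙ ^ 2) ≤ 4 * (s ^ 4 * L ^ 2) * (T / a) ^ 2 := by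
      calc 1 / (a ^ 2 * mₙ ^ 2) = (1 / mₙ) ^ 2 * (1 / a ^ 2) := by field_simp
        _ ≤ (2 * s ^ 2 * L * T) ^ 2 * (1 / a ^ 2) := by gcongr
        _ = _ := by field_simp; ring
    have h4 : m₁ ^ 2 / mₙ ^ 2 * (lk ^ 2 + 1 / a * S)
        ≤ (16 * (s ^ 4 * L ^ 4) + 4 * (s ^ 2 * L ^ 3)) * (T / a) ^ 2 := by
      calc m₁ ^ 2 / mₙ ^ 2 * (lk ^ 2 + 1 / a * S)
          = m₁ ^ 2 / mₙ ^ 2 * ((a ^ 2 * lk ^ 2 + a * S) * (1 / a ^ 2)) := by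
            field_simp
        _ ≤ L ^ 2 * ((16 * s ^ 4 * L ^ 2 * T ^ 2 + 4 * s ^ 2 * L * T ^ 2) * (1 / a ^ 2)) := by
            gcongr
        _ = _ := by field_simp
    calc _ ≤ _ := add_le_add h3 h4
      _ = (4 * (s ^ 4 * L ^ 2) + (16 * (s ^ 4 * L ^ 4) + 4 * (s ^ 2 * L ^ 3))) * (T / a) ^ 2 := by
          ring
      _ ≤ 100 * s ^ 4 * L ^ 4 * (T / a) ^ 2 := by
          gcongr
          linarith
  · calc a * m₁ ^ 2 * S ≤ a * (4 * L ^ 2 / T ^ 2) * S := by gcongr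
      _ = _ := by field_simp

/-- With `T = λ + ∑_{i>k} λ_i`, the trace gives `μ₁(A) ≥ T/2` and `μ_n(A) ≤ 2s²T`. The condition
number carries these over to the opposite ends: `μ_n(A) ≥ T/(2L)` and `μ₁(A) ≤ 2s²LT`. -/
theorem bounds_of_condNumber_le {lam : Fin p → ℝ} (hlam : ∀ j, 0 < lam j) (hn : 1 ≤ n)
    {r : ℝ} (hr : 0 ≤ r) {k : ℕ} {θ : Fin p → ℝ} {s : ℝ} (hs : 1 ≤ s)
    {X : Matrix (Fin n) (Fin p) ℝ} (hX : GoodDesign lam k θ s X) (hX' : GoodTrace lam k s X)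
    {σ t : ℝ} (ht : 0 ≤ t) {e : Fin n → ℝ} (he : GoodNoise lam r k σ t X e) {L : ℝ}
    (hlk : ∀ j : Tail p k, lam j ≤ lamNext lam k) (hlk0 : 0 ≤ lamNext lam k)
    (hnext : n * lamNext lam k ≤ 4 * s ^ 2 * L * (r + tailSum lam k))
    (hcond : condNumber (Amat X r k) ≤ ENNReal.ofReal L) :
    bias lam X r θ ≤ 5000000 * s ^ 8 * L ^ 4 *
        (mNorm (SigmaTail lam k) (tailVec k θ) ^ 2
        + mNorm (SigmaHead lam k)⁻¹ (headVec k θ) ^ 2 * ((r + tailSum lam k) / n) ^ 2) ∧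
      variance lam X r e ≤ 5000000 * s ^ 8 * (σ ^ 2 * t * L ^ 2) *
        (k / n + n * tailSum (fun i => lam i ^ 2) k / (r + tailSum lam k) ^ 2) := by
  obtain ⟨hA, hL, hL1⟩ := of_condNumber_le hn hcond
  have hn0 : (0 : ℝ) < n := by exact_mod_cast hn
  have hL0 : 0 < L := by linarith
  set T := r + tailSum lam k with hT
  have hlow := le_eig_one_of_le_trace hlam hn hr hA.isHermitian hX'.lower
  have hupp := eig_last_le_of_trace_le hlam hn hs hr hA.isHermitian hX'.upper
  rw [← hT] at hlow hupp
  have hAn := eig_pos hA hn le_rfl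
  have hA1 := eig_pos hA le_rfl hn
  have hs0 : 0 < s := by linarith
  have hT0 : 0 < T := by
    have : 0 < 2 * s ^ 2 * T := hAn.trans_le hupp
    exact pos_of_mul_pos_right this (by positivity)
  have hm₁0 := eig_pos hA.inv le_rfl hn
  have hmₙ0 := eig_pos hA.inv hn le_rfl
  have h1 := eig_inv_one_le hA hn
  have h2 := le_eig_inv_last hA hn
  set m₁ := eig (Amat X r k)⁻¹ 1 with hm₁
  set mₙ := eig (Amat X r k)⁻¹ n with hmₙ
  have h2' : 1 / mₙ ≤ eig (Amat X r k) 1 := by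
    rw [div_le_iff₀ hA1] at h2
    rw [div_le_iff₀ hmₙ0]; linarith
  have h3 : m₁ ≤ 2 * L / T := by
    refine h1.trans ?_
    rw [div_le_div_iff₀ hAn hT0]
    linarith
  have h4 : 1 / mₙ ≤ 2 * s ^ 2 * L * T := by
    have := mul_le_mul_of_nonneg_left hupp hL0.le
    linarith
  have h5 : m₁ / mₙ ≤ L := by
    calc m₁ / mₙ = m₁ * (1 / mₙ) := by ring
      _ ≤ (1 / eig (Amat X r k) n) * (L * eig (Amat X r k) n) := by
        gcongr
        exact h2'.trans hL1
      _ = L := by field_simp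
  have hS0 : 0 ≤ tailSum (fun i => lam i ^ 2) k := tailSum_nonneg (fun j => sq_nonneg _) k
  -- One factor `λ_i` is replaced by `λ_{k+1}`; nonnegativity of the regularization allows enlarging
  -- the remaining sum to `T`.
  have hSk : tailSum (fun i => lam i ^ 2) k ≤ lamNext lam k * T := by
    have h6 : tailSum (fun i => lam i ^ 2) k ≤ lamNext lam k * tailSum lam k := by
      simp only [tailSum, Finset.mul_sum, tailVec]
      refine Finset.sum_le_sum fun j _ => ?_
      rw [sq]
      exact mul_le_mul_of_nonneg_right (hlk j) (hlam j).le
    have h7 := mul_nonneg hlk0 hr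
    rw [hT, mul_add]; linarith
  obtain ⟨a1, a2, a3⟩ := condition_arith hn0 hs hL hT0 hm₁0 hmₙ0 h3 h4 h5 hlk0 hnext hS0 hSk
  constructor
  · refine (bias_le_of_goodDesign hlam hn hs hX hA hm₁ hmₙ).trans ?_
    have e0 := sq_nonneg (mNorm (SigmaTail lam k) (tailVec k θ))
    have g0 := sq_nonneg (mNorm (SigmaHead lam k)⁻¹ (headVec k θ))
    calc _ ≤ 50000 * s ^ 4 * (mNorm (SigmaTail lam k) (tailVec k θ) ^ 2 * (100 * s ^ 4 * L ^ 4)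
          + mNorm (SigmaHead lam k)⁻¹ (headVec k θ) ^ 2
            * (100 * s ^ 4 * L ^ 4 * (T / n) ^ 2)) := by gcongr
      _ = _ := by ring
  · refine (variance_le_of_good hlam hn hs hX hA hm₁ hmₙ ht he).trans ?_
    have hq2 : m₁ ^ 2 / mₙ ^ 2 ≤ L ^ 2 := by
      rw [← div_pow]; exact pow_le_pow_left₀ (by positivity) h5 2
    have hs48 : s ^ 4 ≤ s ^ 8 := pow_le_pow_right₀ hs (by norm_num)
    calc 50000 * s ^ 4 * (σ ^ 2 * t) * (m₁ ^ 2 / mₙ ^ 2 * (k / n)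
          + n * m₁ ^ 2 * tailSum (fun i => lam i ^ 2) k)
        ≤ 50000 * s ^ 4 * (σ ^ 2 * t) * (4 * L ^ 2 * (k / n)
          + 4 * L ^ 2 * (n * tailSum (fun i => lam i ^ 2) k / T ^ 2)) := by
          gcongr
          nlinarith [sq_nonneg L]
      _ = 200000 * s ^ 4 * ((σ ^ 2 * t * L ^ 2)
          * (k / n + n * tailSum (fun i => lam i ^ 2) k / T ^ 2)) := by ring
      _ ≤ 5000000 * s ^ 8 * ((σ ^ 2 * t * L ^ 2)
          * (k / n + n * tailSum (fun i => lam i ^ 2) k / T ^ 2)) := by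
          gcongr; norm_num
      _ = _ := by ring

end Condition

/-! ### Trace of the tail and the effective rank -/

namespace IsModel

variable {Ω : Type*} [MeasurableSpace Ω] {μ : Measure Ω} [IsProbabilityMeasure μ] {n p : ℕ}
  {X : Ω → Matrix (Fin n) (Fin p) ℝ} {ε : Ω → Fin n → ℝ} {lam : Fin p → ℝ} {σx σε : ℝ}

theorem measure_not_goodTrace (h : IsModel μ X ε lam σx σε) {s : ℝ} (hσ : σx < s) (hs : 0 < s)
    (k : ℕ) {q : ℝ≥0∞} (hq₁ : ENNReal.ofReal (Real.exp (-n)) ≤ q)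
    (hq₂ : ENNReal.ofReal (Real.exp (-(n / (32 * s ^ 4)))) ≤ q) :
    μ {ω | ¬ GoodTrace lam k s (X ω)} ≤ 2 * q := by
  have hT := (h.isoRows hσ hs).restrict fun j : Fin p => k ≤ (j : ℕ)
  have e1 := (hT.measure_weighted_sq_gt (w := fun j : Tail p k => lam j)
    fun j => (h.lam_pos j).le).trans hq₁
  have e2 := (hT.measure_weighted_sq_lt (w := fun j : Tail p k => lam j)
    fun j => (h.lam_pos j).le).trans hq₂
  refine le_trans (measure_mono (t := _ ∪ _) ?_)
    ((measure_union_le _ _).trans (add_le_add e1 e2)) |>.trans (le_of_eq (by ring))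
  intro ω hω
  by_contra hcon
  simp only [Set.mem_union, not_or, Set.mem_ofPred_eq, not_lt] at hcon
  exact hω ⟨hcon.1, hcon.2⟩

/-- If the condition number of `A_k` is at most `L` with non-negligible probability, then the
effective rank `ρ_k` is bounded below. -/
theorem mul_lamNext_le (h : IsModel μ X ε lam σx σε) {s : ℝ} (hσ : σx < s) (hs : 1 ≤ s)
    (hn : 1 ≤ n) {r : ℝ} (hr : 0 ≤ r) (k : ℕ) {L : ℝ}
    (hL : ENNReal.ofReal (Real.exp (-n)) + ENNReal.ofReal (Real.exp (-(n / (32 * s ^ 4))))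
      < μ {ω | condNumber (Amat (X ω) r k) ≤ ENNReal.ofReal L}) :
    1 ≤ L ∧ n * lamNext lam k ≤ 4 * s ^ 2 * L * (r + tailSum lam k) := by
  have hs0 : 0 < s := by linarith
  have hZ := h.isoRows hσ hs0
  have hS0 := tailSum_nonneg (fun j => (h.lam_pos j).le) k
  have hT := hZ.restrict fun j : Fin p => k ≤ (j : ℕ)
  have e1 := hT.measure_weighted_sq_gt (w := fun j : Tail p k => lam j)
    fun j => (h.lam_pos j).le
  by_cases hkp : k < p
  · have e2 := hZ.measure_mulVec_sq_lt (Pi.single ⟨k, hkp⟩ 1)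
    -- The condition number event has more mass than the two bad events together, so some outcome
    -- avoids both. There `nλ_{k+1}/2 ≤ μ₁(A) ≤ Lμ_n(A) ≤ 2s²LT`, with `T = λ + ∑_{i>k} λ_i`.
    have hnot := fun hsub => not_le.2 hL (measure_mono hsub |>.trans
      ((measure_union_le _ _).trans (add_le_add e1 e2)))
    obtain ⟨ω, hω, hbad⟩ := Set.not_subset.1 hnot
    simp only [Set.mem_union, not_or, Set.mem_ofPred_eq, not_lt, single_dotProduct, one_mul,
      Pi.single_eq_same, mul_one] at hbad
    obtain ⟨b1, b2⟩ := hbad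
    obtain ⟨hA, hL1, hLA⟩ := of_condNumber_le hn hω
    refine ⟨hL1, ?_⟩
    have h1 := eig_last_le_of_trace_le h.lam_pos hn hs hr hA.isHermitian b1
    have h2 := sum_col_sq_le_eig_one hr hA hn (⟨⟨k, hkp⟩, le_rfl⟩ : Tail p k)
    have hl := h.lam_pos ⟨k, hkp⟩
    simp only [div_pow, Real.sq_sqrt hl.le, ← Finset.sum_div] at b2
    rw [le_div_iff₀ hl] at b2
    rw [lamNext, dif_pos hkp]
    have h3 := mul_le_mul_of_nonneg_left h1 (show 0 ≤ L by linarith)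
    linarith
  · have hnot := fun hsub => not_le.2 (lt_of_le_of_lt le_self_add hL)
      (measure_mono hsub |>.trans e1)
    obtain ⟨ω, hω, -⟩ := Set.not_subset.1 hnot
    obtain ⟨-, hL1, -⟩ := of_condNumber_le hn hω
    refine ⟨hL1, ?_⟩
    rw [lamNext, dif_neg hkp, mul_zero]
    have : 0 ≤ L := by linarith
    positivity

end IsModel

/-- Only monotonicity and subadditivity are used, so the events need not be measurable. -/
theorem sub_le_measureReal_of_subset {Ω : Type*} [MeasurableSpace Ω] {μ : Measure Ω}
    [IsProbabilityMeasure μ] {P Q B : Set Ω} (h : Q ⊆ P ∪ B) {x : ℝ} (hx : 0 ≤ x)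
    (hB : μ B ≤ ENNReal.ofReal x) : μ.real Q - x ≤ μ.real P := by
  have h1 : μ.real Q ≤ μ.real P + μ.real B :=
    (measureReal_mono h).trans (measureReal_union_le _ _)
  have h2 : μ.real B ≤ x := ENNReal.toReal_le_of_le_ofReal hx hB
  linarith

end Ridge

/-! ### Choice of constants and conclusion -/

theorem mainTheorem1 (σx : ℝ) :
    ∃ c : ℝ, 0 < c ∧ ∃ C : ℝ, 0 < C ∧
      ∀ (Ω : Type*) [MeasurableSpace Ω] (μ : Measure Ω) [IsProbabilityMeasure μ]
        (n p : ℕ) (X : Ω → Matrix (Fin n) (Fin p) ℝ) (ε : Ω → Fin n → ℝ)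
        (lam : Fin p → ℝ) (σε : ℝ) (θ : Fin p → ℝ),
        0 ≤ σε → Ridge.IsModel μ X ε lam σx σε →
        ∀ (r : ℝ) (k : ℕ) (t : ℝ), (k : ℝ) ≤ n / c → 1 < t → t < n / c →
          -- general bound, in terms of the extreme eigenvalues of the inverse of `A_k`
          (1 - 18 * Real.exp (-t / c) ≤ μ.real {ω | (Ridge.Amat (X ω) r k).PosDef →
            let μ₁ := Ridge.eig (Ridge.Amat (X ω) r k)⁻¹ 1
            let μₙ := Ridge.eig (Ridge.Amat (X ω) r k)⁻¹ n
            Ridge.bias lam (X ω) r θ ≤ C *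
              (Ridge.mNorm (Ridge.SigmaTail lam k) (Ridge.tailVec k θ) ^ 2 *
                (1 + μ₁ ^ 2 / μₙ ^ 2 + μ₁ ^ 2 *
                  (n ^ 2 * Ridge.lamNext lam k ^ 2
                    + n * Ridge.tailSum (fun i => lam i ^ 2) k))
              + Ridge.mNorm (Ridge.SigmaHead lam k)⁻¹ (Ridge.headVec k θ) ^ 2 *
                (1 / (n ^ 2 * μₙ ^ 2) + μ₁ ^ 2 / μₙ ^ 2 *
                  (Ridge.lamNext lam k ^ 2
                    + 1 / n * Ridge.tailSum (fun i => lam i ^ 2) k))) ∧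
            Ridge.variance lam (X ω) r (ε ω) ≤ C * (σε ^ 2 * t) *
              (μ₁ ^ 2 / μₙ ^ 2 * (k / n)
                + n * μ₁ ^ 2 * Ridge.tailSum (fun i => lam i ^ 2) k)}) ∧
          -- bound under control of the condition number of `A_k`
          (0 ≤ r → ∀ (δ L : ℝ), δ < 1 - 4 * Real.exp (-n / c ^ 2) →
            1 - δ ≤ μ.real {ω | Ridge.condNumber (Ridge.Amat (X ω) r k) ≤ ENNReal.ofReal L} →
            (1 - δ - 20 * Real.exp (-t / c) ≤ μ.real {ω |
              Ridge.bias lam (X ω) r θ ≤ C * L ^ 4 *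
                (Ridge.mNorm (Ridge.SigmaTail lam k) (Ridge.tailVec k θ) ^ 2
                + Ridge.mNorm (Ridge.SigmaHead lam k)⁻¹ (Ridge.headVec k θ) ^ 2 *
                  ((r + Ridge.tailSum lam k) / n) ^ 2) ∧
              Ridge.variance lam (X ω) r (ε ω) ≤ C * (σε ^ 2 * t * L ^ 2) *
                (k / n + n * Ridge.tailSum (fun i => lam i ^ 2) k
                  / (r + Ridge.tailSum lam k) ^ 2)}) ∧
            (k < p → 1 / (c * L) ≤ Ridge.rho n lam r k)) := by
  -- The scale is strictly above `σx`, as the infimum in the norm requires, and at least 1, so that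
  -- higher powers dominate lower ones.
  obtain ⟨s, hs, hσs⟩ : ∃ s : ℝ, 1 ≤ s ∧ σx < s :=
    ⟨max σx 0 + 1, by have := le_max_right σx 0; linarith, by have := le_max_left σx 0; linarith⟩
  have hs0 : 0 < s := by linarith
  have hs2 : 1 ≤ s ^ 2 := one_le_pow₀ hs
  have hs4 : 1 ≤ s ^ 4 := one_le_pow₀ hs
  obtain ⟨m, hm⟩ : ∃ m : ℕ, ((1 : ℝ) / 4) ^ m * (256 * s ^ 2 + 1 / 4) ≤ 1 / 16 := by
    obtain ⟨m, hm⟩ := exists_pow_lt_of_lt_one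
      (show (0 : ℝ) < 1 / 16 / (256 * s ^ 2 + 1 / 4) by positivity)
      (show (1 : ℝ) / 4 < 1 by norm_num)
    exact ⟨m, ((lt_div_iff₀ (by positivity)).1 hm).le⟩
  -- The factor `m + 1` makes `k ≤ n/c` small enough for the net of scale `2^{-m}`. The factor
  -- `128s⁴` makes every exponent `n/(64s⁴)`, `n/(32s⁴)`, `n` exceed `t`.
  set c : ℝ := 128 * (m + 1) * s ^ 4 with hc
  have hcs : 128 * s ^ 4 ≤ c := by
    have : 0 ≤ (m : ℝ) * s ^ 4 := by positivity
    rw [hc]; linarith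
  have hc0 : 0 < c := by positivity
  have hc1 : 1 ≤ c := by linarith
  refine ⟨c, hc0, 5000000 * s ^ 8, by positivity, ?_⟩
  intro Ω _ μ _ n p X ε lam σε θ hσε hmodel r k t hk ht htn
  have ht0 : 0 < t := by linarith
  have hctn : c * t < n := by rw [lt_div_iff₀ hc0] at htn; linarith
  have hn0 : (0 : ℝ) < n := lt_trans (by positivity) hctn
  have hn : 1 ≤ n := by exact_mod_cast hn0
  have hkn' : c * k ≤ n := by rw [le_div_iff₀ hc0] at hk; linarith
  have hkn : k ≤ n := by
    have h1 : (k : ℝ) ≤ c * k := le_mul_of_one_le_left (Nat.cast_nonneg k) hc1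
    exact_mod_cast h1.trans hkn'
  have hmk : 2 * (m * k : ℝ) ≤ n / (64 * s ^ 4) := by
    rw [le_div_iff₀ (by positivity)]
    refine le_trans ?_ hkn'
    have : 0 ≤ s ^ 4 * (k : ℝ) := by positivity
    rw [hc]; nlinarith
  set q := Real.exp (-t / c) with hq
  have hq0 : 0 < q := Real.exp_pos _
  have htc : t / c ≤ t := div_le_self ht0.le hc1
  have hexp : ∀ y, t ≤ y → ENNReal.ofReal (Real.exp (-y)) ≤ ENNReal.ofReal q := fun y hy =>
    ENNReal.ofReal_le_ofReal (Real.exp_le_exp.2 (by rw [neg_div]; linarith))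
  have hq₁ := hexp n (by nlinarith)
  have hq₂ := hexp (n / (64 * s ^ 4)) (by rw [le_div_iff₀ (by positivity)]; nlinarith)
  have hq₃ := hexp (n / (32 * s ^ 4)) (by rw [le_div_iff₀ (by positivity)]; nlinarith)
  have hq₄ := hexp t le_rfl
  have hD := hmodel.measure_not_goodDesign hσs hs0 θ hkn hm hmk hq₁ hq₂
  have hN := (hmodel.measure_not_goodNoise hσε r k t).trans (mul_le_mul_right hq₄ 4)
  have hTr := hmodel.measure_not_goodTrace hσs hs0 k hq₁ hq₃
  have hB₁ := (measure_union_le _ _).trans (add_le_add hD hN)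
  have hB₂ := (measure_union_le _ _).trans (add_le_add hB₁ hTr)
  have hof : ∀ a : ℕ, (a : ℝ≥0∞) * ENNReal.ofReal q = ENNReal.ofReal (a * q) := fun a => by
    rw [ENNReal.ofReal_mul (Nat.cast_nonneg a), ENNReal.ofReal_natCast]
  rw [← add_mul] at hB₁
  rw [← add_mul, ← add_mul] at hB₂
  -- The failure mass is `6 + 4 = 10` times `q` for part (1), and 2 more for the trace event in part
  -- (2); both are below the stated 18 and 20.
  have hB₁' := hB₁.trans (le_of_eq_of_le (by norm_num) (hof 10).le)
  have hB₂' := hB₂.trans (le_of_eq_of_le (by norm_num) (hof 12).le)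
  refine ⟨?_, ?_⟩
  · refine le_trans ?_ (Ridge.sub_le_measureReal_of_subset (Q := Set.univ) (fun ω _ => ?_)
      (by positivity) hB₁')
    · rw [probReal_univ]
      push_cast
      linarith
    · by_contra hcon
      simp only [Set.mem_union, not_or, Set.mem_ofPred_eq, not_not] at hcon
      obtain ⟨hP, hX, he⟩ := hcon
      refine hP fun hA => ?_
      have hs48 : s ^ 4 ≤ s ^ 8 := pow_le_pow_right₀ hs (by norm_num)
      have hS0 := Ridge.tailSum_nonneg (a := fun i => lam i ^ 2) (fun j => sq_nonneg _) k
      have hCC : 50000 * s ^ 4 ≤ 5000000 * s ^ 8 := by linarith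
      constructor
      · refine (Ridge.bias_le_of_goodDesign hmodel.lam_pos hn hs hX hA rfl rfl).trans ?_
        exact mul_le_mul_of_nonneg_right hCC (by positivity)
      · refine (Ridge.variance_le_of_good hmodel.lam_pos hn hs hX hA rfl rfl ht0.le he).trans ?_
        rw [mul_assoc, mul_assoc (5000000 * s ^ 8)]
        exact mul_le_mul_of_nonneg_right hCC (by positivity)
  · intro hr δ L hδ hcond
    -- Each of the two exceptional probabilities is thus at most `exp(-n/c²)`, so the assumption on
    -- `δ` leaves a common good outcome.
    have hc2 : 32 * s ^ 4 ≤ c ^ 2 := by nlinarith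
    have hprob : ENNReal.ofReal (Real.exp (-n)) + ENNReal.ofReal (Real.exp (-(n / (32 * s ^ 4))))
        < μ {ω | Ridge.condNumber (Ridge.Amat (X ω) r k) ≤ ENNReal.ofReal L} := by
      rw [← ENNReal.ofReal_add (Real.exp_pos _).le (Real.exp_pos _).le,
        ← ofReal_measureReal (μ := μ)]
      have h1 : Real.exp (-n) ≤ Real.exp (-n / c ^ 2) := by
        refine Real.exp_le_exp.2 ?_
        rw [neg_div, neg_le_neg_iff]
        exact div_le_self hn0.le (by nlinarith)
      have h2 : Real.exp (-(n / (32 * s ^ 4))) ≤ Real.exp (-n / c ^ 2) := by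
        refine Real.exp_le_exp.2 ?_
        rw [neg_div, neg_le_neg_iff]
        gcongr
      have h3 := Real.exp_pos (-n / c ^ 2)
      have h4 : Real.exp (-n) + Real.exp (-(n / (32 * s ^ 4)))
          < μ.real {ω | Ridge.condNumber (Ridge.Amat (X ω) r k) ≤ ENNReal.ofReal L} := by linarith
      exact (ENNReal.ofReal_lt_ofReal_iff (lt_trans (by positivity) h4)).2 h4
    obtain ⟨hL1, hnext⟩ := hmodel.mul_lamNext_le hσs hs hn hr k hprob
    have hlk0 : 0 ≤ Ridge.lamNext lam k := by
      rw [Ridge.lamNext]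
      split_ifs
      · exact (hmodel.lam_pos _).le
      · exact le_rfl
    refine ⟨?_, fun hkp => ?_⟩
    · refine le_trans ?_ (Ridge.sub_le_measureReal_of_subset
        (Q := {ω | Ridge.condNumber (Ridge.Amat (X ω) r k) ≤ ENNReal.ofReal L}) (fun ω hω => ?_)
        (by positivity) hB₂')
      · push_cast
        linarith
      · by_contra hcon
        simp only [Set.mem_union, not_or, Set.mem_ofPred_eq, not_not] at hcon
        obtain ⟨hP, ⟨hX, he⟩, hX'⟩ := hcon
        exact hP (Ridge.bounds_of_condNumber_le hmodel.lam_pos hn hr hs hX hX' ht0.le he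
          (fun j => hmodel.lam_le_lamNext j) hlk0 hnext hω)
    · have hpos : 0 < Ridge.lamNext lam k := by
        rw [Ridge.lamNext, dif_pos hkp]; exact hmodel.lam_pos _
      have hS0 := Ridge.tailSum_nonneg (fun j => (hmodel.lam_pos j).le) k
      have hL0 : 0 < L := by linarith
      rw [Ridge.rho, div_le_div_iff₀ (by positivity) (by positivity), one_mul]
      refine hnext.trans ?_
      have h24 : s ^ 2 ≤ s ^ 4 := pow_le_pow_right₀ hs (by norm_num)
      have h5 : 4 * s ^ 2 ≤ c := by linarith
      calc 4 * s ^ 2 * L * (r + Ridge.tailSum lam k)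
          ≤ c * L * (r + Ridge.tailSum lam k) := by gcongr
        _ = (r + Ridge.tailSum lam k) * (c * L) := by ring
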